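/- All groups are abelian. Let $(*)$ denote the following principle: there are an enumeration $\langle f_\alpha \mid \alpha<\aleph_{\omega+1}\rangle$ of all $\omega$-sequences of elements of $\aleph_\omega$ (put $F_\alpha=\operatorname{ran} f_\alpha$), a stationary set $S\subseteq\aleph_{\omega+1}$ all of whose points have cofinality $\aleph_1$, cofinal sets $C_\beta\subseteq\beta$ of order type $\omega_1$ for $\beta\in S$, and a countable ordinal $\delta>0$, such that 1. for every $\beta\in S$ and every $D\subseteq C_\beta$ cofinal in $C_\beta$, the set $\bigcup_{\alpha\in D}F_\alpha$ has order type $\delta$; in particular $E_\beta=\bigcup_{\alpha\in C_\beta}F_\alpha$ has order type $\delta$; 2. if $\beta\neq\gamma$ are in $S$, then $E_\beta\cap E_\gamma$ has order type less than $\delta$; 3. $\delta$ is (additively) indecomposable, i.e. not a finite sum of smaller ordinals. Definitions. A group is completely decomposable if it is a direct sum of torsion-free groups of rank one. A finite rank Butler group is a group isomorphic to a pure subgroup of a completely decomposable group of finite rank. A torsion-free group $B$ is a $B_2$-group if it is the union of a continuous well-ordered increasing chain of pure subgroups $0=B_0\le B_1\le\dots\le B_\alpha\le\dots$ $(\alpha\le\tau)$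 such that for every $\alpha<\tau$, $B_{\alpha+1}=B_\alpha+L_\alpha$ for some finite rank Butler group $L_\alpha$. A subgroup $B$ of a torsion-free group $C$ is balanced if it is pure and every coset of $B$ contains an element of $C$ whose sequence of $p$-heights in $C$ equals that of the coset in $C/B$. A balanced projective resolution of a torsion-free group $G$ is an exact sequence $0\to B\to C\to G\to 0$ with $C$ completely decomposable and $B$ balanced in $C$. Write $\mathbf t(h)$ for the type of $h$, and $\cup$ for the join of types. A pure subgroup $P$ of a torsion-free group $H$ is $\aleph_0$-prebalanced if for every $h\in H\setminus P$ there are $g_0,g_1,\ldots\in P$ such that for every $g\in P$ there are natural numbers $n$ and $l\ge 1$ with $\mathbf t(h-g)\le \mathbf t(lh-g_0)\cup\dots\cup\mathbf t(lh-g_n)$, types being taken in $H$. $G$ admits an $\aleph_0$-prebalanced chain if it is the union of a continuous well-ordered increasing chain, starting with $0$, of pure $\aleph_0$-prebalanced subgroups of $G$ whose successive factors have rank $1$. **Corollary.** If $(*)$ holds, then there is a torsion-free group $G$ of cardinality $\aleph_{\omega+1}$ that does not admit an $\aleph_0$-prebalanced chain and that has a balanced projective resolution $0\to B\to C\to G\to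 0$ in which $B$ and $C$ have cardinality $\aleph_{\omega+1}$ and $B$ is not a $B_2$-group. In particular, $B$ is a balanced subgroup, of cardinality $\aleph_{\omega+1}$, of the completely decomposable group $C$, and $B$ is not a $B_2$-group. -/

import Mathlib

open Cardinal Ordinal

noncomputable section

/-! ### Torsion-free abelian groups: rank one, purity, characteristics and types -/

/-- A torsion-free abelian group of rank one (equivalently, a group isomorphic to a nonzero
subgroup of the rationals). -/
def IsRankOne (R : Type*) [AddCommGroup R] : Prop :=
  IsAddTorsionFree R ∧ Module.rank ℤ R = 1

/-- `P` is pure in `A` if `nA ∩ P = nP` for every natural number `n`. -/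
def IsPureSubgroup {A : Type*} [AddCommGroup A] (P : AddSubgroup A) : Prop :=
  ∀ (n : ℕ) (a : A), n • a ∈ P → ∃ b ∈ P, n • b = n • a

/-- The characteristic (height sequence) of `a` in `A`: its value at the prime `p` is the
`p`-height of `a`, the supremum of all `k` such that `p ^ k` divides `a` in `A`. -/
def characteristic {A : Type*} [AddCommGroup A] (a : A) : Nat.Primes → ℕ∞ :=
  fun p => ⨆ (k : ℕ) (_ : ∃ b : A, ((p : ℕ) ^ k) • b = a), (k : ℕ∞)

/-- Comparison of types. The type of an element is the class of its characteristic modulo the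
equivalence relation "equal at almost all primes, and at the remaining primes both values are
finite". The type of `χ` is at most the type of `ψ` when `χ p ≤ ψ p` for almost all primes `p`,
and at the remaining primes `χ p` (hence also `ψ p`) is finite. -/
def TypeLE (χ ψ : Nat.Primes → ℕ∞) : Prop :=
  {p | ¬ χ p ≤ ψ p}.Finite ∧ ∀ p, ¬ χ p ≤ ψ p → χ p ≠ ⊤

theorem TypeLE.refl (χ : Nat.Primes → ℕ∞) : TypeLE χ χ := by
  simp [TypeLE]

/-- The pointwise maximum of characteristics represents the union (join) of their types. -/
theorem sup_typeLE_iff (χ₁ χ₂ ψ : Nat.Primes → ℕ∞) :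
    TypeLE (χ₁ ⊔ χ₂) ψ ↔ TypeLE χ₁ ψ ∧ TypeLE χ₂ ψ := by
  have key : ∀ p, ¬ (χ₁ ⊔ χ₂) p ≤ ψ p ↔ (¬ χ₁ p ≤ ψ p ∨ ¬ χ₂ p ≤ ψ p) := by
    intro p
    rw [Pi.sup_apply, sup_le_iff]
    tauto
  have hset : {p | ¬ (χ₁ ⊔ χ₂) p ≤ ψ p} = {p | ¬ χ₁ p ≤ ψ p} ∪ {p | ¬ χ₂ p ≤ ψ p} := by
    ext p
    exact key p
  unfold TypeLE
  rw [hset, Set.finite_union]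
  constructor
  · rintro ⟨⟨h1, h2⟩, h⟩
    exact ⟨⟨h1, fun p hp e => h p ((key p).2 (Or.inl hp)) (by simp [e])⟩,
      ⟨h2, fun p hp e => h p ((key p).2 (Or.inr hp)) (by simp [e])⟩⟩
  · rintro ⟨⟨h1, g1⟩, h2, g2⟩
    refine ⟨⟨h1, h2⟩, fun p hp e => ?_⟩
    have hψ : ψ p ≠ ⊤ := fun h => hp (by simp [h])
    rw [Pi.sup_apply] at e
    rcases max_choice (χ₁ p) (χ₂ p) with h | h
    · have e1 : χ₁ p = ⊤ := h.symm.trans e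
      exact g1 p (by rw [e1]; simpa using hψ) e1
    · have e2 : χ₂ p = ⊤ := h.symm.trans e
      exact g2 p (by rw [e2]; simpa using hψ) e2

/-! ### Completely decomposable groups, Butler groups of finite rank, balanced subgroups -/

open Classical in
/-- A completely decomposable group: a direct sum of torsion-free groups of rank one. -/
def IsCompletelyDecomposable.{u} (C : Type u) [AddCommGroup C] : Prop :=
  ∃ (ι : Type u) (R : ι → AddSubgroup C), (∀ i, IsRankOne (R i)) ∧ DirectSum.IsInternal R

/-- A Butler group of finite rank: a group isomorphic to a pure subgroup of a completely
decomposable group of finite rank. -/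
def IsFiniteRankButler.{u} (L : Type u) [AddCommGroup L] : Prop :=
  ∃ (D : Type u) (_ : AddCommGroup D) (φ : L →+ D),
    IsCompletelyDecomposable D ∧ Module.rank ℤ D < ℵ₀ ∧
      Function.Injective φ ∧ IsPureSubgroup φ.range

/-- A subgroup `P` of a torsion-free group `A` is balanced if it is pure and every coset `a + P`
contains an element with the same characteristic in `A` as the coset has in `A ⧸ P`. -/
def IsBalancedSubgroup {A : Type*} [AddCommGroup A] (P : AddSubgroup A) : Prop :=
  IsPureSubgroup P ∧
    ∀ a : A, ∃ b ∈ P, characteristic (a + b) = characteristic (QuotientAddGroup.mk a : A ⧸ P)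

/-- `0 → ker π → C → G → 0` is a balanced projective resolution of `G`: `π` is onto, `C` is
completely decomposable, and the kernel of `π` is balanced in `C`. -/
def IsBalancedProjectiveResolution.{u} {C G : Type u} [AddCommGroup C] [AddCommGroup G]
    (π : C →+ G) : Prop :=
  IsCompletelyDecomposable C ∧ Function.Surjective π ∧ IsBalancedSubgroup π.ker

/-! ### Chains of subgroups -/

/-- `⟨A α | α ≤ τ⟩` is a continuous well-ordered increasing chain of subgroups from `0` to `G`. -/
structure IsContinuousChain.{u} {G : Type u} [AddCommGroup G] (τ : Ordinal.{u})
    (A : Ordinal.{u} → AddSubgroup G) : Prop where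
  zero : A 0 = ⊥
  mono : ∀ α β, α ≤ β → β ≤ τ → A α ≤ A β
  limit : ∀ α, Order.IsSuccLimit α → α ≤ τ → A α = ⨆ β : Set.Iio α, A β
  top : A τ = ⊤

/-- A `B₂`-group: a torsion-free group which is the union of a continuous well-ordered increasing
chain of pure subgroups `B α`, starting from `0`, with `B (α + 1) = B α + L α` for Butler groups
`L α` of finite rank. -/
def IsB₂Group.{u} (B : Type u) [AddCommGroup B] : Prop :=
  IsAddTorsionFree B ∧
    ∃ (τ : Ordinal.{u}) (A : Ordinal.{u} → AddSubgroup B), IsContinuousChain τ A ∧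
      (∀ α ≤ τ, IsPureSubgroup (A α)) ∧
      ∀ α < τ, ∃ L : AddSubgroup B, IsFiniteRankButler L ∧ A (α + 1) = A α ⊔ L

/-- A pure subgroup `P` of `H` is `ℵ₀`-prebalanced if for every `h ∈ H \ P` there are `g₀, g₁, …`
in `P` such that for every `x ∈ P` there are `n` and `l ≥ 1` with
`t(h - x) ≤ t(l h - g₀) ∪ … ∪ t(l h - gₙ)`, types being computed in `H`. -/
def IsAleph0Prebalanced {H : Type*} [AddCommGroup H] (P : AddSubgroup H) : Prop :=
  IsPureSubgroup P ∧
    ∀ h : H, h ∉ P → ∃ g : ℕ → H, (∀ i, g i ∈ P) ∧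
      ∀ x ∈ P, ∃ n l : ℕ, 1 ≤ l ∧
        TypeLE (characteristic (h - x))
          ((Finset.range (n + 1)).sup fun i => characteristic (l • h - g i))

/-- `G` is the union of a continuous well-ordered increasing chain, starting from `0`, of pure
`ℵ₀`-prebalanced subgroups of `G` whose successive factors have rank one. -/
def AdmitsAleph0PrebalancedChain.{u} (G : Type u) [AddCommGroup G] : Prop :=
  ∃ (τ : Ordinal.{u}) (A : Ordinal.{u} → AddSubgroup G), IsContinuousChain τ A ∧
    (∀ α ≤ τ, IsAleph0Prebalanced (A α)) ∧
    ∀ α < τ, IsRankOne (A (α + 1) ⧸ (A α).addSubgroupOf (A (α + 1)))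

/-! ### The combinatorial hypothesis -/

/-- The well-order of all ordinals below `ℵ_ω`. -/
abbrev BelowAlephOmega : Type := (ω_ ω).ToType

/-- The well-order of all ordinals below `ℵ_{ω+1}`. -/
abbrev BelowAlephOmegaSucc : Type := (ω_ (ω + 1)).ToType

/-- `D` is a cofinal subset of (the set of predecessors of) `β`. -/
def IsCofinalBelow (D : Set BelowAlephOmegaSucc) (β : BelowAlephOmegaSucc) : Prop :=
  D ⊆ Set.Iio β ∧ ∀ γ < β, ∃ α ∈ D, γ ≤ α

/-- The union of the ranges `F_α` of the sequences `f_α`, for `α ∈ D`. -/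
def unionRanges (f : BelowAlephOmegaSucc → ℕ → BelowAlephOmega) (D : Set BelowAlephOmegaSucc) :
    Set BelowAlephOmega :=
  ⋃ α ∈ D, Set.range (f α)

/-- The principle `(*)`. Here `f` enumerates all `ω`-sequences from `ℵ_ω` in order type `ℵ_{ω+1}`,
`S` is a stationary set of points of cofinality `ℵ₁`, `C β` is a cofinal subset of `β` of order
type `ω₁` for `β ∈ S`, and `δ` is a countable indecomposable ordinal. -/
def StarPrinciple : Prop :=
  ∃ f : BelowAlephOmegaSucc → ℕ → BelowAlephOmega, Function.Surjective f ∧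
  ∃ (S : Set BelowAlephOmegaSucc) (C : BelowAlephOmegaSucc → Set BelowAlephOmegaSucc)
    (δ : Ordinal.{0}),
    IsStationary S ∧
    (∀ β ∈ S, Order.cof (Set.Iio β) = ℵ₁) ∧
    (∀ β ∈ S, IsCofinalBelow (C β) β ∧ typeLT (C β) = ω₁) ∧
    δ.card ≤ ℵ₀ ∧
    (∀ β ∈ S, ∀ D ⊆ C β, IsCofinalBelow D β → typeLT (unionRanges f D) = δ) ∧
    (∀ β ∈ S, ∀ γ ∈ S, β ≠ γ →
      typeLT (unionRanges f (C β) ∩ unionRanges f (C γ) : Set BelowAlephOmega) < δ) ∧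
    δ ≠ 0 ∧ IsPrincipal (· + ·) δ

end

/-! ### Characteristics and types -/

/-! Both negative conclusions come from one obstruction. A subgroup H of G is controlled
(`IsControlled`) when, for each h, countably many elements congruent modulo H to nonzero multiples
of h suffice to bound, by finite joins, all the types t(h - x) with x ∈ H.

If G has an ℵ₀-prebalanced chain, every subgroup closed under a suitable countable-valued operation
on finite sets is controlled (`AdmitsAleph0PrebalancedChain.exists_closure`). The same holds for
pure closed subgroups if the kernel of the standard resolution ⨁ ⟨g⟩_* → G is a B₂-group
(`rankOneSum.exists_closure_of_isB₂Group_ker`). This second implication rests on Butler's theorem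
that a pure subgroup of a finite sum of rank-one groups is again such a sum
(`IsFiniteSumRankOne.inf`). It makes closed subgroups of the kernel prebalanced, and the resulting
rank-one pieces, pushed to G, are the bounding elements.

It remains to find G with many closed, pure, uncontrolled subgroups. Label vertices at the primes
and let equal labels of u and v at p make v - u divisible by p. A converse
(`labelledGroup.exists_mem_agreement`) turns non-control of the subgroup supported on X into a
covering statement about sets of primes, `HasUncoveredVertices`.

Such a labelling exists in either of two cases. If 𝔠 ≥ ℵ₂, traces of ℵ₂ distinct sets of naturals
form an independent family, and a cardinality count suffices. If 𝔠 ≤ ℵ₁, the principle (*) is used: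
E_β is coded into the primes, vertices other than β agree with β on sets of order type below δ,
finite unions of these stay below δ by indecomposability, while cofinally many F_α with α ∈ C_β
always fill order type δ. Here 𝔠 ≤ ℵ₁ keeps the initial segments of the vertex set small enough for
a club argument. -/

theorem natCast_le_characteristic_iff {A : Type*} [AddCommGroup A] {a : A} {p : Nat.Primes}
    {k : ℕ} : (k : ℕ∞) ≤ characteristic a p ↔ ∃ b : A, ((p : ℕ) ^ k) • b = a := by
  constructor
  · intro h
    by_contra hk
    rcases k with _ | k
    · exact hk ⟨a, by simp⟩
    · have : characteristic a p ≤ (k : ℕ∞) := by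
        refine iSup₂_le fun j hj => ?_
        obtain ⟨b, hb⟩ := hj
        by_contra hjk
        have hjk' : k + 1 ≤ j := by
          rw [not_le, Nat.cast_lt] at hjk
          exact hjk
        refine hk ⟨((p : ℕ) ^ (j - (k + 1))) • b, ?_⟩
        rw [← mul_nsmul', ← pow_add, Nat.add_sub_cancel' hjk', hb]
      have h2 := h.trans this
      rw [Nat.cast_le] at h2
      omega
  · intro h
    exact le_iSup₂_of_le k h le_rfl

theorem characteristic_le_iff {A : Type*} [AddCommGroup A] {a : A} {p : Nat.Primes} {x : ℕ∞} :
    characteristic a p ≤ x ↔ ∀ k : ℕ, (∃ b : A, ((p : ℕ) ^ k) • b = a) → (k : ℕ∞) ≤ x := by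
  simp only [characteristic, iSup_le_iff]

@[simp]
theorem characteristic_zero {A : Type*} [AddCommGroup A] :
    characteristic (0 : A) = ⊤ := by
  funext p
  refine ENat.eq_top_iff_forall_ge.2 fun k => ?_
  exact natCast_le_characteristic_iff.2 ⟨0, by simp⟩

theorem characteristic_neg {A : Type*} [AddCommGroup A] (a : A) :
    characteristic (-a) = characteristic a := by
  have key : ∀ b : A, characteristic b ≤ characteristic (-b) := by
    intro b p
    refine characteristic_le_iff.2 fun k hk => natCast_le_characteristic_iff.2 ?_
    obtain ⟨c, hc⟩ := hk
    exact ⟨-c, by rw [smul_neg, hc]⟩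
  refine le_antisymm ?_ (key a)
  simpa using key (-a)

theorem inf_characteristic_le_add {A : Type*} [AddCommGroup A] (a b : A) :
    characteristic a ⊓ characteristic b ≤ characteristic (a + b) := by
  intro p
  refine ENat.forall_natCast_le_iff_le.1 fun k hk => ?_
  rw [Pi.inf_apply, le_inf_iff] at hk
  obtain ⟨c, hc⟩ := natCast_le_characteristic_iff.1 hk.1
  obtain ⟨d, hd⟩ := natCast_le_characteristic_iff.1 hk.2
  exact natCast_le_characteristic_iff.2 ⟨c + d, by rw [smul_add, hc, hd]⟩

theorem characteristic_le_map {A B : Type*} [AddCommGroup A] [AddCommGroup B] (f : A →+ B)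
    (a : A) : characteristic a ≤ characteristic (f a) := by
  intro p
  refine characteristic_le_iff.2 fun k hk => natCast_le_characteristic_iff.2 ?_
  obtain ⟨c, hc⟩ := hk
  exact ⟨f c, by rw [← map_nsmul, hc]⟩

theorem characteristic_le_nsmul {A : Type*} [AddCommGroup A] (n : ℕ) (a : A) :
    characteristic a ≤ characteristic (n • a) :=
  characteristic_le_map (nsmulAddMonoidHom n) a

theorem inf_characteristic_le_sub {A : Type*} [AddCommGroup A] (a b : A) :
    characteristic a ⊓ characteristic b ≤ characteristic (a - b) := by
  rw [sub_eq_add_neg, ← characteristic_neg b]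
  exact inf_characteristic_le_add a (-b)

theorem characteristic_equiv {A B : Type*} [AddCommGroup A] [AddCommGroup B] (f : A ≃+ B)
    (a : A) : characteristic (f a) = characteristic a := by
  refine le_antisymm ?_ (characteristic_le_map (f : A →+ B) a)
  simpa using characteristic_le_map (f.symm : B →+ A) (f a)

theorem TypeLE.of_le {χ ψ : Nat.Primes → ℕ∞} (h : χ ≤ ψ) : TypeLE χ ψ := by
  have : ∀ p, χ p ≤ ψ p := h
  simp [TypeLE, this]

theorem TypeLE.trans {χ ψ φ : Nat.Primes → ℕ∞} (h₁ : TypeLE χ ψ) (h₂ : TypeLE ψ φ) :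
    TypeLE χ φ := by
  refine ⟨(h₁.1.union h₂.1).subset fun p hp => ?_, fun p hp => ?_⟩
  · by_contra hc
    simp only [Set.mem_union, Set.mem_ofPred_eq, not_or, not_not] at hc
    exact hp (hc.1.trans hc.2)
  · by_cases h : χ p ≤ ψ p
    · have h' : ¬ ψ p ≤ φ p := fun h' => hp (h.trans h')
      have := h₂.2 p h'
      intro e
      rw [e] at h
      exact this (top_le_iff.1 h)
    · exact h₁.2 p h

theorem TypeLE.inf {χ ψ φ : Nat.Primes → ℕ∞} (h₁ : TypeLE χ ψ) (h₂ : TypeLE χ φ) :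
    TypeLE χ (ψ ⊓ φ) := by
  have key : ∀ p, ¬ χ p ≤ (ψ ⊓ φ) p → ¬ χ p ≤ ψ p ∨ ¬ χ p ≤ φ p := by
    intro p hp
    rw [Pi.inf_apply, le_inf_iff] at hp
    tauto
  refine ⟨(h₁.1.union h₂.1).subset fun p hp => key p hp, fun p hp => ?_⟩
  rcases key p hp with h | h
  · exact h₁.2 p h
  · exact h₂.2 p h

theorem finset_sup_typeLE {ι : Type*} {T : Finset ι} {χ : ι → Nat.Primes → ℕ∞}
    {ψ : Nat.Primes → ℕ∞} (h : ∀ i ∈ T, TypeLE (χ i) ψ) : TypeLE (T.sup χ) ψ := by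
  classical
  induction T using Finset.induction_on with
  | empty => exact TypeLE.of_le (by simp)
  | insert a T ha ih =>
    rw [Finset.sup_insert, sup_typeLE_iff]
    exact ⟨h a (by simp), ih fun i hi => h i (by simp [hi])⟩

/-- The type of `χ` is bounded by a finite union of types of elements of `K`. -/
def TypeBounded {A : Type*} [AddCommGroup A] (χ : Nat.Primes → ℕ∞) (K : Set A) : Prop :=
  ∃ T : Finset A, (T : Set A) ⊆ K ∧ TypeLE χ (T.sup characteristic)

namespace TypeBounded

variable {A : Type*} [AddCommGroup A] {χ ψ : Nat.Primes → ℕ∞} {K K' : Set A}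

theorem mono_left (h : TypeLE χ ψ) (hψ : TypeBounded ψ K) : TypeBounded χ K := by
  obtain ⟨T, hT, h'⟩ := hψ
  exact ⟨T, hT, h.trans h'⟩

theorem of_mem {w : A} (h : TypeLE χ (characteristic w)) (hw : w ∈ K) : TypeBounded χ K :=
  ⟨{w}, by simpa using hw, by simpa using h⟩

theorem finset_sup {ι : Type*} (T : Finset ι) (f : ι → Nat.Primes → ℕ∞)
    (h : ∀ i ∈ T, TypeBounded (f i) K) : TypeBounded (T.sup f) K := by
  classical
  choose! S hS hS' using h
  refine ⟨T.biUnion S, ?_, finset_sup_typeLE fun i hi => (hS' i hi).trans (TypeLE.of_le ?_)⟩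
  · intro x hx
    simp only [Finset.coe_biUnion, Set.mem_iUnion] at hx
    obtain ⟨i, hi, hx⟩ := hx
    exact hS i hi hx
  · exact Finset.sup_mono (Finset.subset_biUnion_of_mem S hi)

/-- Distributivity of the lattice of types: a χ below a join of the t(w) is the join of the meets χ
∩ t(w). Each w can therefore be replaced separately, and the meet allows heights of sums and
differences to be estimated. -/
theorem trans_inf (h : TypeBounded χ K')
    (h' : ∀ w ∈ K', TypeBounded (χ ⊓ characteristic w) K) : TypeBounded χ K := by
  obtain ⟨T, hT, hχ⟩ := h
  have h1 : TypeLE χ (χ ⊓ T.sup characteristic) := (TypeLE.refl χ).inf hχ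
  rw [Finset.sup_inf_distrib_left] at h1
  exact mono_left h1 (finset_sup T _ fun i hi => h' i (hT hi))

end TypeBounded

/-- Every coset of `H` has, up to multiples, a countable set of elements whose types control the
types of all its elements. -/
def IsControlled {G : Type*} [AddCommGroup G] (H : AddSubgroup G) : Prop :=
  ∀ h : G, ∃ K : Set G, K.Countable ∧ (∀ k ∈ K, ∃ l : ℕ, l ≠ 0 ∧ l • h - k ∈ H) ∧
    ∀ x ∈ H, TypeBounded (characteristic (h - x)) K

/-! ### Finite sums of rank-one groups -/

/-- `z` is a sum of vectors on the lines spanned by the `c S`, each of which has coordinates that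
are integral multiples of the coordinates of `x`. -/
def IsConformalSum {k : ℕ} (c : Finset (Fin k) → Fin k → ℚ) (x z : Fin k → ℚ) : Prop :=
  ∃ y : Finset (Fin k) → Fin k → ℚ, z = ∑ S, y S ∧
    ∀ S, (∃ q : ℚ, y S = q • c S) ∧ ∀ i, ∃ m : ℤ, y S i = m * x i

namespace IsConformalSum

variable {k : ℕ} {c : Finset (Fin k) → Fin k → ℚ} {x x' z z' : Fin k → ℚ}

theorem zero : IsConformalSum c x 0 :=
  ⟨0, by simp, fun S => ⟨⟨0, by simp⟩, fun i => ⟨0, by simp⟩⟩⟩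

theorem add (h : IsConformalSum c x z) (h' : IsConformalSum c x z') :
    IsConformalSum c x (z + z') := by
  obtain ⟨y, rfl, hy⟩ := h
  obtain ⟨y', rfl, hy'⟩ := h'
  refine ⟨y + y', by simp [Finset.sum_add_distrib], fun S => ⟨?_, fun i => ?_⟩⟩
  · obtain ⟨q, hq⟩ := (hy S).1
    obtain ⟨q', hq'⟩ := (hy' S).1
    exact ⟨q + q', by rw [Pi.add_apply, hq, hq', add_smul]⟩
  · obtain ⟨m, hm⟩ := (hy S).2 i
    obtain ⟨m', hm'⟩ := (hy' S).2 i
    exact ⟨m + m', by rw [Pi.add_apply, Pi.add_apply, hm, hm']; push_cast; ring⟩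

theorem zsmul (h : IsConformalSum c x z) (n : ℤ) : IsConformalSum c x (n • z) := by
  obtain ⟨y, rfl, hy⟩ := h
  refine ⟨n • y, by simp [Finset.smul_sum], fun S => ⟨?_, fun i => ?_⟩⟩
  · obtain ⟨q, hq⟩ := (hy S).1
    refine ⟨n * q, ?_⟩
    rw [Pi.smul_apply, hq, mul_smul, Int.cast_smul_eq_zsmul]
  · obtain ⟨m, hm⟩ := (hy S).2 i
    refine ⟨n * m, ?_⟩
    rw [Pi.smul_apply, Pi.smul_apply, hm, zsmul_eq_mul]
    push_cast; ring

theorem of_line (S : Finset (Fin k)) (hz : ∃ q : ℚ, z = q • c S)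
    (hi : ∀ i, ∃ m : ℤ, z i = m * x i) : IsConformalSum c x z := by
  refine ⟨Pi.single S z, by simp, fun S' => ?_⟩
  by_cases h : S' = S
  · subst h
    simpa using ⟨hz, hi⟩
  · simp only [Pi.single_eq_of_ne h]
    exact ⟨⟨0, by simp⟩, fun i => ⟨0, by simp⟩⟩

theorem of_dvd (h : IsConformalSum c x' z) (d : ℤ) (hd : ∀ i, ∃ m : ℤ, d * x' i = m * x i) :
    IsConformalSum c x (d • z) := by
  obtain ⟨y, rfl, hy⟩ := h
  refine ⟨d • y, by simp [Finset.smul_sum], fun S => ⟨?_, fun i => ?_⟩⟩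
  · obtain ⟨q, hq⟩ := (hy S).1
    refine ⟨d * q, ?_⟩
    rw [Pi.smul_apply, hq, mul_smul, Int.cast_smul_eq_zsmul]
  · obtain ⟨m, hm⟩ := (hy S).2 i
    obtain ⟨m', hm'⟩ := hd i
    refine ⟨m * m', ?_⟩
    rw [Pi.smul_apply, Pi.smul_apply, hm, zsmul_eq_mul, mul_left_comm, hm']
    push_cast; ring

end IsConformalSum

theorem exists_int_mul_of_padicValRat {p : ℕ} [hp : Fact p.Prime] {k : ℕ} (r : Fin k → ℚ)
    (hr : ∀ i, 0 ≤ padicValRat p (r i)) : ∃ d : ℤ, ¬ (p : ℤ) ∣ d ∧ ∀ i, ∃ m : ℤ, d * r i = m := by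
  refine ⟨∏ i, ((r i).den : ℤ), ?_, fun i => ?_⟩
  · rw [Prime.dvd_finsetProd_iff (Nat.prime_iff_prime_int.1 hp.out)]
    rintro ⟨i, -, hi⟩
    rw [Int.natCast_dvd_natCast] at hi
    have h1 : ¬ (p : ℤ) ∣ (r i).num := by
      intro h
      have hc := (r i).reduced
      have : p ∣ Nat.gcd (r i).num.natAbs (r i).den := Nat.dvd_gcd (Int.natCast_dvd.1 h) hi
      rw [hc] at this
      exact hp.out.one_lt.ne' (Nat.dvd_one.1 this)
    have h2 := hr i
    rw [padicValRat_def, padicValInt.eq_zero_of_not_dvd h1] at h2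
    have h3 : 1 ≤ padicValNat p (r i).den :=
      one_le_padicValNat_of_dvd (r i).den_nz hi
    omega
  · refine ⟨(∏ j ∈ Finset.univ.erase i, ((r j).den : ℤ)) * (r i).num, ?_⟩
    rw [← Finset.prod_erase_mul _ _ (Finset.mem_univ i)]
    push_cast
    rw [mul_assoc, Rat.den_mul_eq_num]

/-- Local form of the decomposition at p: subtracting a suitable multiple of `c S`, for S the
support of x, removes a coordinate at the cost of a factor prime to p. Induction is on the size of
the support. -/
theorem exists_conformalSum_not_dvd {k : ℕ} {U : Submodule ℚ (Fin k → ℚ)}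
    {c : Finset (Fin k) → Fin k → ℚ} (hcU : ∀ S, c S ∈ U)
    (hc : ∀ S, ∀ u ∈ U, u ≠ 0 → (∀ i, u i ≠ 0 → i ∈ S) →
      c S ≠ 0 ∧ ∀ i, c S i ≠ 0 → i ∈ S)
    (p : ℕ) [hp : Fact p.Prime] (N : ℕ) :
    ∀ x ∈ U, (Finset.univ.filter fun i => x i ≠ 0).card ≤ N →
      ∃ n : ℤ, ¬ (p : ℤ) ∣ n ∧ IsConformalSum c x (n • x) := by
  have hp1 : ¬ (p : ℤ) ∣ 1 := by
    rw [← Int.natCast_one, Int.natCast_dvd_natCast]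
    exact hp.out.one_lt.ne' ∘ Nat.dvd_one.1
  have hpp := Nat.prime_iff_prime_int.1 hp.out
  induction N with
  | zero =>
    intro x _ hx
    have : x = 0 := by
      funext i
      by_contra h
      have hi : i ∈ Finset.univ.filter fun i => x i ≠ 0 := by simpa using h
      rw [Finset.card_eq_zero.1 (Nat.le_zero.1 hx)] at hi
      simp at hi
    subst this
    exact ⟨1, hp1, by simpa using IsConformalSum.zero⟩
  | succ N ih =>
    intro x hxU hx
    by_cases hx0 : x = 0
    · subst hx0
      exact ⟨1, hp1, by simpa using IsConformalSum.zero⟩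
    set S := Finset.univ.filter fun i => x i ≠ 0 with hS
    obtain ⟨hc0, hcS⟩ := hc S x hxU hx0 (fun i hi => by simpa [hS] using hi)
    have hcS' : ∀ i, c S i ≠ 0 → x i ≠ 0 := fun i hi => by simpa [hS] using hcS i hi
    have hne : (Finset.univ.filter fun i => c S i ≠ 0).Nonempty := by
      obtain ⟨i, hi⟩ := Function.ne_iff.1 hc0
      exact ⟨i, by simpa using hi⟩
    -- Choosing i of least p-adic valuation makes every ratio `r j` below p-integral with `r i = 1`,
    -- so the correction cancels coordinate i and stays p-integrally proportional to x.
    obtain ⟨i, hi, hmin⟩ := Finset.exists_min_image _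
      (fun j => padicValRat p (c S j / x j)) hne
    replace hi : c S i ≠ 0 := by simpa using hi
    replace hmin : ∀ j, c S j ≠ 0 → padicValRat p (c S i / x i) ≤ padicValRat p (c S j / x j) :=
      fun j hj => hmin j (by simpa using hj)
    have hxi := hcS' i hi
    let r : Fin k → ℚ := fun j => (c S j / x j) / (c S i / x i)
    have hr : ∀ j, 0 ≤ padicValRat p (r j) := by
      intro j
      by_cases hj : c S j = 0
      · simp [r, hj]
      · have := hmin j hj
        have h1 : c S j / x j ≠ 0 := div_ne_zero hj (hcS' j hj)
        have h2 : c S i / x i ≠ 0 := div_ne_zero hi hxi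
        simp only [r]
        rw [padicValRat.div h1 h2]
        omega
    have hrx : ∀ j, ((x i / c S i) • c S) j = r j * x j := by
      intro j
      by_cases hj : c S j = 0
      · simp [r, hj]
      · have := hcS' j hj
        simp only [r, Pi.smul_apply, _root_.smul_eq_mul]
        field_simp
    obtain ⟨d, hd, hdr⟩ := exists_int_mul_of_padicValRat r hr
    let x' := x - (x i / c S i) • c S
    have hx'U : x' ∈ U := U.sub_mem hxU (U.smul_mem _ (hcU S))
    have hx' : ∀ j, x' j = (1 - r j) * x j := by
      intro j
      simp only [x', Pi.sub_apply, hrx]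
      ring
    have hri : r i = 1 := div_self (div_ne_zero hi hxi)
    have hcard : (Finset.univ.filter fun i => x' i ≠ 0).card ≤ N := by
      have hlt : (Finset.univ.filter fun i => x' i ≠ 0).card < S.card := by
        refine Finset.card_lt_card (Finset.ssubset_iff_of_subset ?_ |>.2 ⟨i, ?_, ?_⟩)
        · intro j hj
          have hj' : x' j ≠ 0 := by simpa using hj
          rw [hx'] at hj'
          simpa [hS] using right_ne_zero_of_mul hj'
        · simpa [hS] using hxi
        · simp [hx', hri]
      omega
    obtain ⟨n, hn, hn'⟩ := ih x' hx'U hcard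
    refine ⟨d * n, fun h => (hpp.dvd_or_dvd h).elim hd hn, ?_⟩
    have h1 : IsConformalSum c x (d • n • x') := by
      refine hn'.of_dvd d fun j => ?_
      obtain ⟨m, hm⟩ := hdr j
      refine ⟨d - m, ?_⟩
      rw [hx', ← mul_assoc, _root_.mul_sub, mul_one, hm]
      push_cast; ring
    have h2 : IsConformalSum c x (d • (x i / c S i) • c S) := by
      refine IsConformalSum.of_line S ⟨d * (x i / c S i), ?_⟩ fun j => ?_
      · rw [mul_smul, Int.cast_smul_eq_zsmul]
      · obtain ⟨m, hm⟩ := hdr j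
        refine ⟨m, ?_⟩
        rw [Pi.smul_apply, hrx, zsmul_eq_mul, ← mul_assoc, hm]
    have h3 : (d * n) • x = d • n • x' + n • d • (x i / c S i) • c S := by
      simp only [x', smul_sub, mul_smul]
      rw [smul_comm n d, sub_add_cancel]
    rw [h3]
    exact h1.add (h2.zsmul n)

/-- The family c is finite and independent of x. This uniformity is what later bounds the number of
rank-one summands. -/
theorem exists_conformalSum {k : ℕ} (U : Submodule ℚ (Fin k → ℚ)) :
    ∃ c : Finset (Fin k) → Fin k → ℚ, (∀ S, c S ∈ U) ∧ ∀ x ∈ U, IsConformalSum c x x := by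
  classical
  let P : Finset (Fin k) → (Fin k → ℚ) → Prop := fun S u =>
    u ∈ U ∧ u ≠ 0 ∧ ∀ i, u i ≠ 0 → i ∈ S
  let c : Finset (Fin k) → Fin k → ℚ := fun S => if h : ∃ u, P S u then h.choose else 0
  have hcU : ∀ S, c S ∈ U := by
    intro S
    by_cases h : ∃ u, P S u
    · simp only [c, dif_pos h]
      exact h.choose_spec.1
    · simp [c, dif_neg h]
  have hc : ∀ S, ∀ u ∈ U, u ≠ 0 → (∀ i, u i ≠ 0 → i ∈ S) →
      c S ≠ 0 ∧ ∀ i, c S i ≠ 0 → i ∈ S := by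
    intro S u hu hu0 huS
    have h : ∃ u, P S u := ⟨u, hu, hu0, huS⟩
    simp only [c, dif_pos h]
    exact h.choose_spec.2
  refine ⟨c, hcU, fun x hx => ?_⟩
  -- Local-to-global: the integers n for which n x decomposes form an ideal, and the local form
  -- shows that it lies in no prime ideal (p).
  let I : Ideal ℤ :=
    { carrier := {n | IsConformalSum c x (n • x)}
      add_mem' := fun {a b} ha hb => by
        change IsConformalSum c x ((a + b) • x)
        rw [add_smul]
        exact IsConformalSum.add ha hb
      zero_mem' := by
        change IsConformalSum c x ((0 : ℤ) • x)
        simpa using IsConformalSum.zero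
      smul_mem' := fun a b hb => by
        change IsConformalSum c x ((a * b) • x)
        rw [mul_smul]
        exact IsConformalSum.zsmul hb a }
  have hI : I = ⊤ := by
    by_contra hne
    have hunit : ¬ IsUnit (Submodule.IsPrincipal.generator I) := by
      intro h
      refine hne (Ideal.eq_top_of_isUnit_mem _ (Submodule.IsPrincipal.generator_mem I) h)
    rw [Int.isUnit_iff_natAbs_eq] at hunit
    obtain ⟨p, hp, hdvd⟩ := Nat.exists_prime_and_dvd hunit
    have : Fact p.Prime := ⟨hp⟩
    obtain ⟨n, hn, hn'⟩ := exists_conformalSum_not_dvd hcU hc p _ x hx le_rfl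
    have hnI : n ∈ I := hn'
    rw [Submodule.IsPrincipal.mem_iff_eq_smul_generator I] at hnI
    obtain ⟨a, ha⟩ := hnI
    refine hn ?_
    rw [ha, _root_.smul_eq_mul]
    exact Dvd.dvd.mul_left (Int.natCast_dvd.2 hdvd) a
  have h1 : (1 : ℤ) ∈ I := by rw [hI]; trivial
  simpa using (show IsConformalSum c x ((1 : ℤ) • x) from h1)

/-- The subgroup `L` is the sum of finitely many subgroups of rank at most one. -/
def IsFiniteSumRankOne {A : Type*} [AddCommGroup A] (L : AddSubgroup A) : Prop :=
  ∃ (ι : Type) (_ : Fintype ι) (b : ι → A), (∀ j, b j ∈ L) ∧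
    ∀ x ∈ L, ∃ t : ι → A, x = ∑ j, t j ∧
      ∀ j, t j ∈ L ∧ ∃ s r : ℤ, s ≠ 0 ∧ s • t j = r • b j

theorem exists_int_clear_denom {ι : Type*} [Fintype ι] (q : ι → ℚ) :
    ∃ n : ℤ, n ≠ 0 ∧ ∃ z : ι → ℤ, ∀ j, n * q j = z j := by
  classical
  refine ⟨∏ j, ((q j).den : ℤ), ?_, fun i => (∏ j ∈ Finset.univ.erase i, ((q j).den : ℤ)) *
    (q i).num, fun i => ?_⟩
  · exact Finset.prod_ne_zero_iff.2 fun j _ => by exact_mod_cast (q j).den_nz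
  · rw [← Finset.prod_erase_mul _ _ (Finset.mem_univ i)]
    push_cast
    rw [mul_assoc, Rat.den_mul_eq_num]

theorem zsmul_eq_of_ratio {A : Type*} [AddCommGroup A] [IsAddTorsionFree A] {s r n z : ℤ}
    {t b : A} {q : ℚ} (hs : s ≠ 0) (h : s • t = r • b) (hq : s * q = r) (hn : n * q = z) :
    n • t = z • b := by
  have h1 : n * r = s * z := by
    have : (n * r : ℚ) = s * z := by rw [← hq, ← hn]; ring
    exact_mod_cast this
  apply zsmul_right_injective hs
  change s • n • t = s • z • b
  rw [smul_comm, h, ← mul_smul, ← mul_smul, h1]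

/-- Butler's theorem in internal form. The rational coordinate vectors of elements of P form a
subspace U. A conformal decomposition within U multiplies each rank-one component by integers, so
its pieces stay in L, and purity returns them to P. -/
theorem IsFiniteSumRankOne.inf {A : Type*} [AddCommGroup A] [IsAddTorsionFree A]
    {L P : AddSubgroup A} (hL : IsFiniteSumRankOne L)
    (hP : ∀ (n : ℤ) (x : A), n ≠ 0 → x ∈ L → n • x ∈ P → x ∈ P) :
    IsFiniteSumRankOne (L ⊓ P) := by
  classical
  obtain ⟨ι, _, b₀, hb₀, ht₀⟩ := hL
  obtain ⟨k, ⟨e⟩⟩ : ∃ k, Nonempty (Fin k ≃ ι) := ⟨_, ⟨(Fintype.equivFin ι).symm⟩⟩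
  obtain ⟨b, hb, hdec⟩ : ∃ b : Fin k → A, (∀ j, b j ∈ L) ∧ ∀ x ∈ L, ∃ t : Fin k → A,
      x = ∑ j, t j ∧ ∀ j, t j ∈ L ∧ ∃ s r : ℤ, s ≠ 0 ∧ s • t j = r • b j := by
    refine ⟨b₀ ∘ e, fun j => hb₀ _, fun x hx => ?_⟩
    obtain ⟨t, h1, h2⟩ := ht₀ x hx
    exact ⟨t ∘ e, by rw [h1, ← e.sum_comp]; rfl, fun j => h2 _⟩
  let U : Submodule ℚ (Fin k → ℚ) :=
    { carrier := {q | ∃ n : ℤ, n ≠ 0 ∧ ∃ z : Fin k → ℤ, (∀ j, n * q j = z j) ∧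
        ∑ j, z j • b j ∈ P}
      add_mem' := by
        rintro q q' ⟨n, hn, z, hz, hzP⟩ ⟨n', hn', z', hz', hzP'⟩
        refine ⟨n * n', mul_ne_zero hn hn', fun j => n' * z j + n * z' j, fun j => ?_, ?_⟩
        · push_cast
          rw [← hz, ← hz', Pi.add_apply]
          ring
        · have : ∑ j, (n' * z j + n * z' j) • b j =
              n' • ∑ j, z j • b j + n • ∑ j, z' j • b j := by
            simp only [add_smul, mul_smul, Finset.sum_add_distrib, Finset.smul_sum]
          rw [this]
          exact P.add_mem (P.zsmul_mem hzP _) (P.zsmul_mem hzP' _)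
      zero_mem' := ⟨1, one_ne_zero, 0, by simp, by simp⟩
      smul_mem' := by
        rintro a q ⟨n, hn, z, hz, hzP⟩
        refine ⟨n * a.den, mul_ne_zero hn (by exact_mod_cast a.den_nz), fun j => a.num * z j,
          fun j => ?_, ?_⟩
        · push_cast
          rw [← hz, Pi.smul_apply, _root_.smul_eq_mul, ← Rat.den_mul_eq_num a]
          ring
        · simp only [mul_smul]
          rw [← Finset.smul_sum]
          exact P.zsmul_mem hzP _ }
  obtain ⟨c, hcU, hc⟩ := exists_conformalSum U
  choose nc hnc zc hzc hzcP using hcU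
  refine ⟨Finset (Fin k), inferInstance, fun S => ∑ j, zc S j • b j,
    fun S => ⟨L.sum_mem fun j _ => L.zsmul_mem (hb j) _, hzcP S⟩, ?_⟩
  rintro x ⟨hxL, hxP⟩
  obtain ⟨t, hxt, ht⟩ := hdec x hxL
  have htL := fun j => (ht j).1
  choose s r hs hsr using fun j => (ht j).2
  let q : Fin k → ℚ := fun j => r j / s j
  have hq : ∀ j, s j * q j = r j := fun j => by
    have : (s j : ℚ) ≠ 0 := by exact_mod_cast hs j
    simp only [q]; field_simp
  have hqU : q ∈ U := by
    obtain ⟨n, hn, z, hz⟩ := exists_int_clear_denom q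
    refine ⟨n, hn, z, hz, ?_⟩
    have : ∑ j, z j • b j = n • x := by
      rw [hxt, Finset.smul_sum]
      exact Finset.sum_congr rfl fun j _ =>
        (zsmul_eq_of_ratio (hs j) (hsr j) (hq j) (hz j)).symm
    rw [this]
    exact P.zsmul_mem hxP n
  obtain ⟨y, hqy, hy⟩ := hc q hqU
  choose a ha using fun S => (hy S).1
  choose m hm using fun S => (hy S).2
  have key : ∀ S, ∃ n : ℤ, n ≠ 0 ∧ ∃ z : Fin k → ℤ, (∀ j, n * y S j = z j) ∧
      ∑ j, z j • b j ∈ P ∧ n • ∑ j, m S j • t j = ∑ j, z j • b j := by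
    intro S
    have hyU : y S ∈ U := by rw [ha S]; exact U.smul_mem _ ⟨nc S, hnc S, zc S, hzc S, hzcP S⟩
    obtain ⟨n, hn, z, hz, hzP⟩ := hyU
    refine ⟨n, hn, z, hz, hzP, ?_⟩
    rw [Finset.smul_sum]
    refine Finset.sum_congr rfl fun j _ => ?_
    rw [← mul_smul]
    refine zsmul_eq_of_ratio (hs j) (hsr j) (hq j) ?_
    rw [← hz j, hm S j]
    push_cast; ring
  refine ⟨fun S => ∑ j, m S j • t j, ?_, fun S => ⟨⟨?_, ?_⟩, ?_⟩⟩
  · rw [Finset.sum_comm, hxt]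
    refine Finset.sum_congr rfl fun j _ => ?_
    rw [← Finset.sum_smul]
    -- The integers `m S j` sum to 1 over S only where the coordinate is nonzero; where it vanishes,
    -- `t j` is zero and any multipliers do.
    by_cases hqj : q j = 0
    · have : t j = 0 := by
        have h := zsmul_eq_of_ratio (n := 1) (z := 0) (hs j) (hsr j) (hq j) (by simp [hqj])
        simpa using h
      simp [this]
    · have h1 : (∑ S, (m S j : ℚ)) * q j = 1 * q j := by
        rw [Finset.sum_mul, one_mul]
        conv_rhs => rw [hqy, Finset.sum_apply]
        exact Finset.sum_congr rfl fun S _ => (hm S j).symm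
      have h2 : ∑ S, m S j = 1 := by exact_mod_cast mul_right_cancel₀ hqj h1
      rw [h2, one_smul]
  · exact L.sum_mem fun j _ => L.zsmul_mem (htL j) _
  · obtain ⟨n, hn, z, hz, hzP, hnz⟩ := key S
    refine hP n _ hn (L.sum_mem fun j _ => L.zsmul_mem (htL j) _) ?_
    rw [hnz]
    exact hzP
  · obtain ⟨n, hn, z, hz, hzP, hnz⟩ := key S
    refine ⟨nc S * (a S).den * n, n * (a S).num, mul_ne_zero (mul_ne_zero (hnc S)
      (by exact_mod_cast (a S).den_nz)) hn, ?_⟩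
    rw [mul_smul, hnz, Finset.smul_sum, Finset.smul_sum]
    refine Finset.sum_congr rfl fun j _ => ?_
    rw [← mul_smul, ← mul_smul]
    congr 1
    have : ((nc S * (a S).den * z j : ℤ) : ℚ) = ((n * (a S).num * zc S j : ℤ) : ℚ) := by
      push_cast
      rw [← hz j, ← hzc S j, ha S, ← Rat.den_mul_eq_num (a S), Pi.smul_apply,
        _root_.smul_eq_mul]
      ring
    exact_mod_cast this

theorem IsFiniteSumRankOne.sup {A : Type*} [AddCommGroup A] {L L' : AddSubgroup A}
    (hL : IsFiniteSumRankOne L) (hL' : IsFiniteSumRankOne L') :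
    IsFiniteSumRankOne (L ⊔ L') := by
  obtain ⟨ι, _, b, hb, hd⟩ := hL
  obtain ⟨ι', _, b', hb', hd'⟩ := hL'
  refine ⟨ι ⊕ ι', inferInstance, Sum.elim b b', ?_, fun x hx => ?_⟩
  · rintro (j | j)
    · exact AddSubgroup.mem_sup_left (hb j)
    · exact AddSubgroup.mem_sup_right (hb' j)
  · obtain ⟨y, hy, z, hz, rfl⟩ := AddSubgroup.mem_sup.1 hx
    obtain ⟨t, rfl, ht⟩ := hd y hy
    obtain ⟨t', rfl, ht'⟩ := hd' z hz
    refine ⟨Sum.elim t t', by simp, ?_⟩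
    rintro (j | j)
    · exact ⟨AddSubgroup.mem_sup_left (ht j).1, (ht j).2⟩
    · exact ⟨AddSubgroup.mem_sup_right (ht' j).1, (ht' j).2⟩

theorem IsFiniteSumRankOne.bot {A : Type*} [AddCommGroup A] :
    IsFiniteSumRankOne (⊥ : AddSubgroup A) :=
  ⟨PEmpty, inferInstance, PEmpty.elim, fun j => j.elim, fun x hx =>
    ⟨PEmpty.elim, by simpa using hx, fun j => j.elim⟩⟩

theorem IsFiniteSumRankOne.countable {A : Type*} [AddCommGroup A] [IsAddTorsionFree A]
    {L : AddSubgroup A} (hL : IsFiniteSumRankOne L) : (L : Set A).Countable := by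
  obtain ⟨ι, _, b, hb, hd⟩ := hL
  choose! t ht ht' using hd
  choose! s r hs hsr using fun x hx j => (ht' x hx j).2
  have hinj : Set.InjOn (fun x => (s x, r x)) (L : Set A) := by
    intro x hx y hy hxy
    simp only [Prod.mk.injEq] at hxy
    have hx' : x ∈ L := hx
    have hy' : y ∈ L := hy
    rw [ht x hx', ht y hy']
    refine Finset.sum_congr rfl fun j _ => ?_
    apply zsmul_right_injective (hs x hx' j)
    change s x j • t x j = s x j • t y j
    rw [hsr x hx' j, hxy.1, hxy.2, hsr y hy' j]
  exact Set.MapsTo.countable_of_injOn (Set.mapsTo_univ _ _) hinj Set.countable_univ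

theorem IsFiniteSumRankOne.map {A B : Type*} [AddCommGroup A] [AddCommGroup B]
    {L : AddSubgroup A} (hL : IsFiniteSumRankOne L) (f : A →+ B) :
    IsFiniteSumRankOne (L.map f) := by
  obtain ⟨ι, _, b, hb, hd⟩ := hL
  refine ⟨ι, inferInstance, fun j => f (b j), fun j => AddSubgroup.mem_map_of_mem f (hb j), ?_⟩
  rintro _ ⟨x, hx, rfl⟩
  obtain ⟨t, rfl, ht⟩ := hd x hx
  refine ⟨fun j => f (t j), map_sum _ _ _, fun j => ⟨AddSubgroup.mem_map_of_mem f (ht j).1, ?_⟩⟩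
  obtain ⟨s, r, hs, h⟩ := (ht j).2
  exact ⟨s, r, hs, by rw [← map_zsmul, h, map_zsmul]⟩

theorem IsFiniteSumRankOne.of_map {A B : Type*} [AddCommGroup A] [AddCommGroup B]
    {L : AddSubgroup A} {f : A →+ B} (hf : Function.Injective f)
    (hL : IsFiniteSumRankOne (L.map f)) : IsFiniteSumRankOne L := by
  obtain ⟨ι, _, b, hb, hd⟩ := hL
  choose b' hb' hbb' using hb
  refine ⟨ι, inferInstance, b', hb', fun x hx => ?_⟩
  obtain ⟨t, hxt, ht⟩ := hd (f x) (AddSubgroup.mem_map_of_mem f hx)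
  choose t' ht' htt' using fun j => (ht j).1
  refine ⟨t', hf ?_, fun j => ⟨ht' j, ?_⟩⟩
  · rw [hxt, map_sum]
    exact Finset.sum_congr rfl fun j _ => (htt' j).symm
  · obtain ⟨s, r, hs, h⟩ := (ht j).2
    refine ⟨s, r, hs, hf ?_⟩
    rw [map_zsmul, map_zsmul, htt', hbb', h]

theorem IsRankOne.exists_zsmul_eq {R : Type*} [AddCommGroup R] (hR : IsRankOne R) {a : R}
    (ha : a ≠ 0) (x : R) : ∃ s r : ℤ, s ≠ 0 ∧ s • x = r • a := by
  have := hR.1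
  by_contra! hcon
  have hli : LinearIndependent ℤ ![a, x] := by
    rw [LinearIndependent.pair_iff]
    intro r s h
    have hs : s = 0 := by
      by_contra hs
      refine hcon s (-r) hs ?_
      rw [neg_smul, eq_neg_iff_add_eq_zero, add_comm, h]
    subst hs
    simp only [zero_smul, add_zero] at h
    exact ⟨(smul_eq_zero.1 h).resolve_right ha, rfl⟩
  have h2 := hli.cardinal_lift_le_rank
  rw [hR.2] at h2
  simp at h2

open Classical in
theorem IsFiniteRankButler.isFiniteSumRankOne {L : Type*} [AddCommGroup L]
    (hL : IsFiniteRankButler L) : IsFiniteSumRankOne (⊤ : AddSubgroup L) := by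
  obtain ⟨D, _, φ, ⟨ι, R, hR, hint⟩, hrank, hφ, hpure⟩ := hL
  let e := DirectSum.coeAddMonoidHom R
  have he : Function.Bijective e := hint
  have hRtf := fun i => (hR i).1
  have htf : IsAddTorsionFree D := by
    refine ⟨fun n hn x y hxy => ?_⟩
    obtain ⟨x, rfl⟩ := he.2 x
    obtain ⟨y, rfl⟩ := he.2 y
    congr 1
    have hxy' : e (n • x) = e (n • y) := by rw [map_nsmul, map_nsmul]; exact hxy
    have h := he.1 hxy'
    ext i : 1
    apply nsmul_right_injective hn
    exact DFunLike.congr_fun h i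
  have hnt : ∀ i, ∃ v : R i, v ≠ 0 := by
    intro i
    by_contra! h
    have : Subsingleton (R i) := ⟨fun a b => by rw [h a, h b]⟩
    have h2 := (hR i).2
    rw [rank_subsingleton'] at h2
    exact zero_ne_one h2
  choose v hv using hnt
  have hli : LinearIndependent ℤ fun i => (v i : D) := by
    rw [linearIndependent_iff']
    intro s g hg i hi
    have h1 : e (∑ i ∈ s, g i • DirectSum.of (fun i => R i) i (v i)) = 0 := by
      rw [map_sum, ← hg]
      refine Finset.sum_congr rfl fun j _ => ?_
      rw [map_zsmul]
      congr 1
      exact DirectSum.coeAddMonoidHom_of R j (v j)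
    have h2 := he.1 (h1.trans (map_zero e).symm)
    have h3 := DFunLike.congr_fun h2 i
    rw [DFinsupp.finsetSum_apply, Finset.sum_eq_single i] at h3
    · have h4 : g i • v i = 0 := by
        refine Eq.trans ?_ h3
        change g i • v i = g i • (DirectSum.of (fun i => R i) i (v i)) i
        rw [DirectSum.of_eq_same]
      exact (smul_eq_zero.1 h4).resolve_right (hv i)
    · intro j _ hji
      change g j • (DirectSum.of (fun i => R i) j (v j)) i = 0
      rw [DirectSum.of_eq_of_ne _ _ _ hji.symm, smul_zero]
    · exact fun h => absurd hi h
  -- One nonzero vector from each summand gives an independent family, so finite rank forces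
  -- finitely many summands.
  have hfin : Finite ι := by
    have h := hli.cardinal_lift_le_rank
    have h' := h.trans_lt (Cardinal.lift_lt.2 hrank)
    rw [Cardinal.lift_aleph0, Cardinal.lift_lt_aleph0] at h'
    exact Cardinal.lt_aleph0_iff_finite.1 h'
  have htop : IsFiniteSumRankOne (⊤ : AddSubgroup D) := by
    obtain ⟨k, ⟨eq⟩⟩ := Finite.exists_equiv_fin ι
    refine ⟨Fin k, inferInstance, fun j => (v (eq.symm j) : D), fun _ => trivial, fun x _ => ?_⟩
    obtain ⟨y, rfl⟩ := he.2 x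
    have := Fintype.ofEquiv _ eq.symm
    refine ⟨fun j => (y (eq.symm j) : D), ?_, fun j => ⟨trivial, ?_⟩⟩
    · conv_lhs => rw [← DirectSum.sum_univ_of y, map_sum, ← eq.symm.sum_comp]
      exact Finset.sum_congr rfl fun j _ => DirectSum.coeAddMonoidHom_of R _ _
    · obtain ⟨s, r, hs, h⟩ := (hR (eq.symm j)).exists_zsmul_eq (hv _) (y (eq.symm j))
      refine ⟨s, r, hs, ?_⟩
      have := congrArg (Subtype.val) h
      simpa using this
  have hrange : IsFiniteSumRankOne ((⊤ : AddSubgroup L).map φ) := by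
    rw [← AddMonoidHom.range_eq_map, ← top_inf_eq φ.range]
    refine htop.inf fun n x hn _ hx => ?_
    have hx' : n.natAbs • x ∈ φ.range := by
      rcases Int.natAbs_eq n with h | h
      · rw [← natCast_zsmul, ← h]; exact hx
      · rw [← natCast_zsmul, ← neg_mem_iff, ← neg_zsmul, ← h]; exact hx
    obtain ⟨b, hb, hbx⟩ := hpure _ x hx'
    rwa [← nsmul_right_injective (Int.natAbs_ne_zero.2 hn) hbx]
  exact hrange.of_map hφ

/-! ### Continuous chains -/

namespace IsContinuousChain

variable {G : Type*} [AddCommGroup G] {τ : Ordinal} {A : Ordinal → AddSubgroup G}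

theorem exists_mem_of_isSuccLimit (hA : IsContinuousChain τ A) {α : Ordinal}
    (hα : Order.IsSuccLimit α) (hατ : α ≤ τ) {x : G} (hx : x ∈ A α) : ∃ β < α, x ∈ A β := by
  rw [hA.limit α hα hατ] at hx
  have hne : Nonempty (Set.Iio α) := ⟨⟨0, hα.bot_lt⟩⟩
  rw [AddSubgroup.mem_iSup_of_directed] at hx
  · obtain ⟨β, hβ⟩ := hx
    exact ⟨β, β.2, hβ⟩
  · intro β γ
    rcases le_total β γ with h | h
    · exact ⟨γ, hA.mono _ _ h (γ.2.le.trans hατ), le_rfl⟩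
    · exact ⟨β, le_rfl, hA.mono _ _ h (β.2.le.trans hατ)⟩

/-- By continuity nothing new enters at a limit, so every nonzero element has a level α at which it
first appears; `eq_of_mem_succ` shows that the level is unique. Most later inductions run on this
level. -/
theorem exists_mem_succ (hA : IsContinuousChain τ A) {β : Ordinal} (hβ : β ≤ τ) {x : G}
    (hx : x ∈ A β) (hx0 : x ≠ 0) : ∃ α < β, x ∈ A (α + 1) ∧ x ∉ A α := by
  induction β using Ordinal.limitRecOn with
  | zero =>
    rw [hA.zero] at hx
    exact absurd hx hx0
  | add_one α ih =>
    have hα : α < τ := (Order.lt_succ α).trans_le hβ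
    by_cases h : x ∈ A α
    · obtain ⟨γ, hγ, h'⟩ := ih hα.le h
      exact ⟨γ, hγ.trans (Order.lt_succ α), h'⟩
    · exact ⟨α, Order.lt_succ α, hx, h⟩
  | limit β hlim ih =>
    obtain ⟨γ, hγ, h⟩ := hA.exists_mem_of_isSuccLimit hlim hβ hx
    obtain ⟨α, hα, h'⟩ := ih γ hγ (hγ.le.trans hβ) h
    exact ⟨α, hα.trans hγ, h'⟩

theorem eq_of_mem_succ (hA : IsContinuousChain τ A) {α β : Ordinal} (hα : α < τ) (hβ : β < τ)
    {x : G} (hxα : x ∈ A (α + 1)) (hxα' : x ∉ A α) (hxβ : x ∈ A (β + 1)) (hxβ' : x ∉ A β) :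
    α = β := by
  rcases lt_trichotomy α β with h | h | h
  · exact absurd (hA.mono _ _ (Order.succ_le_of_lt h) hβ.le hxα) hxβ'
  · exact h
  · exact absurd (hA.mono _ _ (Order.succ_le_of_lt h) hα.le hxβ) hxα'

end IsContinuousChain

theorem IsPureSubgroup.mem_of_zsmul_mem {A : Type*} [AddCommGroup A] [IsAddTorsionFree A]
    {P : AddSubgroup A} (hP : IsPureSubgroup P) {n : ℤ} (hn : n ≠ 0) {x : A} (hx : n • x ∈ P) :
    x ∈ P := by
  have hx' : n.natAbs • x ∈ P := by
    rcases Int.natAbs_eq n with h | h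
    · rw [← natCast_zsmul, ← h]; exact hx
    · rw [← natCast_zsmul, ← neg_mem_iff, ← neg_zsmul, ← h]; exact hx
  obtain ⟨b, hb, hbx⟩ := hP _ x hx'
  rwa [← nsmul_right_injective (Int.natAbs_ne_zero.2 hn) hbx]

/-! ### Prebalanced chains yield controlled subgroups -/

theorem exists_nsmul_sub_mem_of_isRankOne {G : Type*} [AddCommGroup G] {P Q : AddSubgroup G}
    (h : IsRankOne (Q ⧸ P.addSubgroupOf Q)) {a x : G} (ha : a ∈ Q) (haP : a ∉ P) (hx : x ∈ Q) :
    ∃ (n : ℕ) (r : ℤ), n ≠ 0 ∧ n • x - r • a ∈ P := by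
  have ha0 : (QuotientAddGroup.mk ⟨a, ha⟩ : Q ⧸ P.addSubgroupOf Q) ≠ 0 := by
    rw [Ne, QuotientAddGroup.eq_zero_iff]
    exact fun h => haP h
  obtain ⟨s, r, hs, h⟩ := h.exists_zsmul_eq ha0 (QuotientAddGroup.mk ⟨x, hx⟩)
  rw [← QuotientAddGroup.mk_zsmul, ← QuotientAddGroup.mk_zsmul, ← sub_eq_zero,
    ← QuotientAddGroup.mk_sub, QuotientAddGroup.eq_zero_iff] at h
  have h' : s • x - r • a ∈ P := h
  rcases Int.natAbs_eq s with hs' | hs'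
  · refine ⟨s.natAbs, r, Int.natAbs_ne_zero.2 hs, ?_⟩
    rwa [← natCast_zsmul, ← hs']
  · refine ⟨s.natAbs, -r, Int.natAbs_ne_zero.2 hs, ?_⟩
    rw [← natCast_zsmul, ← neg_mem_iff]
    have : -((s.natAbs : ℤ) • x - -r • a) = s • x - r • a := by
      conv_rhs => rw [hs']
      rw [neg_zsmul, neg_zsmul]; abel
    rwa [this]

/-- A strengthening of the defining property of `IsControlled` for a single element, in which
all multiples are controlled simultaneously. -/
def IsControlledAt {G : Type*} [AddCommGroup G] (H : AddSubgroup G) (g : G) : Prop :=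
  ∃ K : Set G, K.Countable ∧ (∀ k ∈ K, ∃ l : ℕ, l ≠ 0 ∧ l • g - k ∈ H) ∧
    ∀ m : ℕ, m ≠ 0 → ∀ y ∈ H, TypeBounded (characteristic (m • g - y)) K

theorem IsControlledAt.of_nsmul_sub {G : Type*} [AddCommGroup G] {H : AddSubgroup G} {g a : G}
    {n : ℕ} (hn : n ≠ 0) (ha : a ∈ H) (h : IsControlledAt H (n • g - a)) :
    IsControlledAt H g := by
  obtain ⟨K, hK, hKH, hKb⟩ := h
  refine ⟨K, hK, fun k hk => ?_, fun m hm y hy => ?_⟩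
  · obtain ⟨l, hl, hlk⟩ := hKH k hk
    refine ⟨l * n, mul_ne_zero hl hn, ?_⟩
    have : (l * n) • g - k = (l • (n • g - a) - k) + l • a := by
      rw [smul_sub, ← mul_nsmul']; abel
    rw [this]
    exact H.add_mem hlk (H.nsmul_mem ha l)
  · have h1 := hKb m hm (n • y - m • a) (H.sub_mem (H.nsmul_mem hy n) (H.nsmul_mem ha m))
    refine TypeBounded.mono_left (TypeLE.of_le ?_) h1
    have : m • (n • g - a) - (n • y - m • a) = n • (m • g - y) := by
      rw [smul_sub, smul_sub, smul_comm m n]; abel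
    rw [this]
    exact characteristic_le_nsmul n _

/-- Induction on the level of g. The set `w x` witnesses prebalancedness at the level of x; H need
only be closed under w. Controlling all multiples m g at once keeps the induction going when a bound
replaces g by a multiple. -/
theorem isControlledAt_of_chain {G : Type*} [AddCommGroup G] [IsAddTorsionFree G] {τ : Ordinal}
    {A : Ordinal → AddSubgroup G} (hA : IsContinuousChain τ A)
    (hpure : ∀ α ≤ τ, IsPureSubgroup (A α))
    (hrank : ∀ α < τ, IsRankOne (A (α + 1) ⧸ (A α).addSubgroupOf (A (α + 1))))
    (w : G → Set G) (hwc : ∀ x, (w x).Countable)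
    (hwA : ∀ α < τ, ∀ x ∈ A (α + 1), x ∉ A α → w x ⊆ A α)
    (hw : ∀ α < τ, ∀ x ∈ A (α + 1), x ∉ A α → ∀ z ∈ A α,
      TypeBounded (characteristic (x - z)) {y | ∃ g ∈ w x, ∃ l : ℕ, l ≠ 0 ∧ y = l • x - g})
    {H : AddSubgroup G}
    (hH : ∀ x ∈ H, w x ⊆ H) :
    ∀ β ≤ τ, ∀ g ∈ A β, IsControlledAt H g := by
  intro β
  induction β using WellFoundedLT.induction with
  | ind β ih =>
  intro hβ g hg
  by_cases hg0 : g ∈ H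
  · refine ⟨{0}, Set.countable_singleton _, ?_, fun m hm y hy => ?_⟩
    · rintro k rfl
      exact ⟨1, one_ne_zero, by simpa using hg0⟩
    · exact TypeBounded.of_mem (TypeLE.of_le (by simp)) rfl
  have hgne : g ≠ 0 := fun h => hg0 (h ▸ H.zero_mem)
  obtain ⟨α, hαβ, hgα, hgα'⟩ := hA.exists_mem_succ hβ hg hgne
  have hατ : α < τ := hαβ.trans_le hβ
  have ihα : ∀ g ∈ A α, IsControlledAt H g := ih α hαβ hατ.le
  -- If H meets the level of g, the rank-one factor lets a multiple of g be moved by an element of H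
  -- into the previous subgroup.
  by_cases hex : ∃ a ∈ H, a ∈ A (α + 1) ∧ a ∉ A α
  · obtain ⟨a, haH, ha, ha'⟩ := hex
    obtain ⟨n, r, hn, hnr⟩ := exists_nsmul_sub_mem_of_isRankOne (hrank α hατ) ha ha' hgα
    exact IsControlledAt.of_nsmul_sub hn (H.zsmul_mem haH r) (ihα _ hnr)
  push Not at hex
  have hmg : ∀ m : ℕ, m ≠ 0 → m • g ∈ A (α + 1) ∧ m • g ∉ A α := by
    refine fun m hm => ⟨(A (α + 1)).nsmul_mem hgα m, fun h => hgα' ?_⟩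
    refine (hpure α hατ.le).mem_of_zsmul_mem (n := m) (by exact_mod_cast hm) ?_
    rwa [natCast_zsmul]
  have hctrl : ∀ m : ℕ, m ≠ 0 → ∀ u ∈ w (m • g), IsControlledAt H u := fun m hm u hu =>
    ihα u (hwA α hατ _ (hmg m hm).1 (hmg m hm).2 hu)
  choose! Q hQc hQH hQb using hctrl
  -- Elements u witness the bound for m g below level α, and q ranges over a set controlling u
  -- modulo H. Since l' u - q lies in H, the combination l'(l m g - u) + q is congruent to a
  -- multiple of g.
  let K : Set G := ⋃ m : {m : ℕ // m ≠ 0}, ⋃ u ∈ w (m.1 • g), ⋃ q ∈ Q m u, ⋃ l : ℕ, ⋃ l' : ℕ,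
    {k | k = (l' * l * m.1) • g - (l' • u - q) ∧ l ≠ 0 ∧ l' ≠ 0 ∧ l' • u - q ∈ H}
  have hK : ∀ k, k ∈ K ↔ ∃ m : ℕ, m ≠ 0 ∧ ∃ u ∈ w (m • g), ∃ q ∈ Q m u, ∃ l l' : ℕ,
      k = (l' * l * m) • g - (l' • u - q) ∧ l ≠ 0 ∧ l' ≠ 0 ∧ l' • u - q ∈ H := by
    intro k
    simp only [K, Set.mem_iUnion, Set.mem_ofPred_eq, exists_prop, Subtype.exists]
  have hlow : ∀ m : ℕ, m ≠ 0 → ∀ y ∈ H, y ∈ A α →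
      TypeBounded (characteristic (m • g - y)) K := by
    intro m hm y hy hyα
    refine (hw α hατ _ (hmg m hm).1 (hmg m hm).2 y hyα).trans_inf ?_
    rintro _ ⟨u, hu, l, hl, rfl⟩
    have h1 := hQb m hm u hu 1 one_ne_zero (l • y) (H.nsmul_mem hy l)
    have h2 : characteristic (m • g - y) ⊓ characteristic (l • m • g - u) ≤
        characteristic (1 • u - l • y) := by
      have e : 1 • u - l • y = l • (m • g - y) - (l • m • g - u) := by
        rw [one_smul, smul_sub]; abel
      rw [e]
      exact (inf_le_inf_right _ (characteristic_le_nsmul l _)).trans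
        (inf_characteristic_le_sub _ _)
    -- The meet of t(m g - y) with t(l m g - u) is below t(u - l y), a type controlled by the
    -- induction hypothesis for u. Adding l'(l m g - u) back to q lands in K.
    refine (TypeBounded.mono_left (TypeLE.of_le h2) h1).trans_inf fun q hq => ?_
    obtain ⟨l', hl', hlq⟩ := hQH m hm u hu q hq
    refine TypeBounded.of_mem (w := (l' * l * m) • g - (l' • u - q)) (TypeLE.of_le ?_)
      ((hK _).2 ⟨m, hm, u, hu, q, hq, l, l', rfl, hl, hl', hlq⟩)
    have e : (l' * l * m) • g - (l' • u - q) = l' • (l • m • g - u) + q := by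
      rw [smul_sub, mul_nsmul', mul_nsmul']; abel
    rw [e]
    refine le_trans (inf_le_inf_right _ (inf_le_right.trans (characteristic_le_nsmul l' _))) ?_
    exact inf_characteristic_le_add _ _
  refine ⟨K, ?_, fun k hk => ?_, fun m hm y hy => ?_⟩
  · refine Set.countable_iUnion fun m => ((hwc _).biUnion fun u hu =>
      ((hQc m.1 m.2 u hu).biUnion fun q _ => Set.countable_iUnion fun l =>
        Set.countable_iUnion fun l' => ?_))
    exact (Set.countable_singleton _).mono fun k hk => hk.1
  · obtain ⟨m, hm, u, hu, q, hq, l, l', rfl, hl, hl', h⟩ := (hK k).1 hk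
    exact ⟨l' * l * m, mul_ne_zero (mul_ne_zero hl' hl) hm, by rwa [sub_sub_cancel]⟩
  · have key : ∀ γ ≤ τ, ∀ y ∈ H, y ∈ A γ → ∀ m : ℕ, m ≠ 0 →
        TypeBounded (characteristic (m • g - y)) K := by
      intro γ
      induction γ using WellFoundedLT.induction with
      | ind γ ihγ =>
      intro hγ y hy hyγ m hm
      by_cases hyα : y ∈ A α
      · exact hlow m hm y hy hyα
      have hy0 : y ≠ 0 := fun h => hyα (h ▸ (A α).zero_mem)
      obtain ⟨σ, hσγ, hyσ, hyσ'⟩ := hA.exists_mem_succ hγ hyγ hy0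
      have hστ : σ < τ := hσγ.trans_le hγ
      have hασ : α < σ := by
        rcases lt_trichotomy α σ with h | h | h
        · exact h
        · subst h
          exact absurd (hex y hy hyσ) hyσ'
        · exact absurd (hA.mono _ _ (Order.succ_le_of_lt h) hατ.le hyσ) hyα
      have hgσ : g ∈ A σ := hA.mono _ _ (Order.succ_le_of_lt hασ) hστ.le hgα
      -- When y lies above g the roles are exchanged: m g belongs to the subgroup preceding y, and
      -- the bounding elements l y - u have u ∈ H. Adding l(m g - y) replaces y by u, which has
      -- lower level.
      have h1 := hw σ hστ y hyσ hyσ' (m • g) ((A σ).nsmul_mem hgσ m)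
      rw [← characteristic_neg, neg_sub] at h1
      refine h1.trans_inf ?_
      rintro _ ⟨u, hu, l, hl, rfl⟩
      refine TypeBounded.mono_left (TypeLE.of_le ?_)
        (ihγ σ hσγ hστ.le u (hH y hy hu) (hwA σ hστ y hyσ hyσ' hu) (l * m) (mul_ne_zero hl hm))
      have e : (l * m) • g - u = l • (m • g - y) + (l • y - u) := by
        rw [smul_sub, mul_nsmul']; abel
      rw [e]
      exact (inf_le_inf_right _ (characteristic_le_nsmul l _)).trans
        (inf_characteristic_le_add _ _)
    exact key τ le_rfl y hy (by rw [hA.top]; trivial) m hm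

theorem AdmitsAleph0PrebalancedChain.exists_closure {G : Type*} [AddCommGroup G]
    [IsAddTorsionFree G] (h : AdmitsAleph0PrebalancedChain G) :
    ∃ Φ : Finset G → Set G, (∀ s, (Φ s).Countable) ∧ ∀ H : AddSubgroup G,
      (∀ s : Finset G, (s : Set G) ⊆ H → Φ s ⊆ H) → IsControlled H := by
  obtain ⟨τ, A, hA, hpre, hrank⟩ := h
  have hex : ∀ x : G, ∃ W : Set G, W.Countable ∧ ∀ α < τ, x ∈ A (α + 1) → x ∉ A α →
      W ⊆ A α ∧ ∀ z ∈ A α,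
        TypeBounded (characteristic (x - z)) {y | ∃ g ∈ W, ∃ l : ℕ, l ≠ 0 ∧ y = l • x - g} := by
    intro x
    by_cases h : ∃ α < τ, x ∈ A (α + 1) ∧ x ∉ A α
    · obtain ⟨α, hα, hx, hx'⟩ := h
      obtain ⟨g, hgA, hg⟩ := (hpre α hα.le).2 x hx'
      refine ⟨Set.range g, Set.countable_range g, fun β hβ hxβ hxβ' => ?_⟩
      -- Uniqueness of the level lets the witness set depend on x alone.
      obtain rfl := hA.eq_of_mem_succ hα hβ hx hx' hxβ hxβ'
      refine ⟨by rintro _ ⟨i, rfl⟩; exact hgA i, fun z hz => ?_⟩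
      obtain ⟨n, l, hl, h⟩ := hg z hz
      refine TypeBounded.mono_left h (TypeBounded.finset_sup _ _ fun i _ =>
        TypeBounded.of_mem (TypeLE.refl _) ?_)
      exact ⟨g i, ⟨i, rfl⟩, l, by omega, rfl⟩
    · exact ⟨∅, Set.countable_empty, fun α hα hx hx' => absurd ⟨α, hα, hx, hx'⟩ h⟩
  choose w hwc hw using hex
  refine ⟨fun s => ⋃ x ∈ s, w x, fun s => s.countable_toSet.biUnion fun x _ => hwc x,
    fun H hH g => ?_⟩
  have hH' : ∀ x ∈ H, w x ⊆ H := by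
    intro x hx
    have := hH {x} (by simpa using hx)
    simpa using this
  obtain ⟨K, hKc, hKH, hKb⟩ := isControlledAt_of_chain hA (fun α hα => (hpre α hα).1) hrank w hwc
    (fun α hα x hx hx' => (hw x α hα hx hx').1) (fun α hα x hx hx' => (hw x α hα hx hx').2) hH'
    τ le_rfl g (by rw [hA.top]; trivial)
  refine ⟨K, hKc, hKH, fun x hx => ?_⟩
  simpa using hKb 1 one_ne_zero x hx

/-! ### Closed subgroups of `B₂`-groups -/

/-- A continuous chain of pure subgroups with `A (α + 1) = A α ⊔ L α`, where each `L α` is a finite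
sum of groups of rank one. -/
structure IsB₂Chain {B : Type*} [AddCommGroup B] (τ : Ordinal) (A L : Ordinal → AddSubgroup B) :
    Prop where
  chain : IsContinuousChain τ A
  pure : ∀ α ≤ τ, IsPureSubgroup (A α)
  finiteSum : ∀ α < τ, IsFiniteSumRankOne (L α)
  succ : ∀ α < τ, A (α + 1) = A α ⊔ L α

/-- `M` contains `L α` as soon as it has an element in `A (α + 1) \ A α`. -/
def IsChainClosed {B : Type*} [AddCommGroup B] (τ : Ordinal) (A L : Ordinal → AddSubgroup B)
    (M : AddSubgroup B) : Prop :=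
  ∀ α < τ, ∀ x ∈ M, x ∈ A (α + 1) → x ∉ A α → L α ≤ M

namespace IsB₂Chain

variable {B : Type*} [AddCommGroup B] [IsAddTorsionFree B] {τ : Ordinal}
  {A L : Ordinal → AddSubgroup B} {M : AddSubgroup B}

/-- If x and n x have the same level α, closure gives L α ≤ M, so the L α-component of x can be
discarded and the level drops. Thus chain-closed subgroups are pure. -/
theorem mem_of_zsmul_mem (hA : IsB₂Chain τ A L) (hM : IsChainClosed τ A L M) {n : ℤ} (hn : n ≠ 0)
    (β : Ordinal) : β ≤ τ → ∀ x ∈ A β, n • x ∈ M → x ∈ M := by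
  induction β using WellFoundedLT.induction with
  | ind β ih =>
  intro hβ x hx hnx
  by_cases hx0 : x = 0
  · exact hx0 ▸ M.zero_mem
  obtain ⟨α, hαβ, hxα, hxα'⟩ := hA.chain.exists_mem_succ hβ hx hx0
  have hατ := hαβ.trans_le hβ
  have hL : L α ≤ M := hM α hατ _ hnx ((A _).zsmul_mem hxα n)
    fun h => hxα' ((hA.pure α hατ.le).mem_of_zsmul_mem hn h)
  rw [hA.succ α hατ] at hxα
  obtain ⟨y, hy, l, hl, rfl⟩ := AddSubgroup.mem_sup.1 hxα
  refine M.add_mem (ih α hαβ hατ.le y hy ?_) (hL hl)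
  have : n • y = n • (y + l) - n • l := by rw [smul_add]; abel
  rw [this]
  exact M.sub_mem hnx (M.zsmul_mem (hL hl) n)

/-- Finitely many elements are absorbed by a pure subgroup M + N with N a finite sum of rank-one
groups. Keeping N inside A β makes the transfinite induction possible. -/
theorem exists_finiteSum (hA : IsB₂Chain τ A L) (hM : IsChainClosed τ A L M) (β : Ordinal) :
    β ≤ τ → ∀ F : Finset B, (∀ x ∈ F, x ∈ A β) → ∃ N : AddSubgroup B, N ≤ A β ∧
      IsFiniteSumRankOne N ∧ (∀ x ∈ F, x ∈ M ⊔ N) ∧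
      ∀ (n : ℤ) (x : B), n ≠ 0 → n • x ∈ M ⊔ N → x ∈ M ⊔ N := by
  classical
  induction β using Ordinal.limitRecOn with
  | zero =>
    intro _ F hF
    refine ⟨⊥, bot_le, .bot, fun x hx => ?_, fun n x hn hx => ?_⟩
    · have := hF x hx
      rw [hA.chain.zero, AddSubgroup.mem_bot] at this
      rw [this]
      exact zero_mem _
    · rw [sup_bot_eq] at hx ⊢
      exact hA.mem_of_zsmul_mem hM hn τ le_rfl x (by rw [hA.chain.top]; trivial) hx
  | limit β hlim ih =>
    intro hβ F hF
    have : ∃ γ < β, ∀ x ∈ F, x ∈ A γ := by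
      induction F using Finset.induction_on with
      | empty => exact ⟨0, hlim.bot_lt, by simp⟩
      | insert a F _ ihF =>
        obtain ⟨γ, hγ, h⟩ := ihF fun x hx => hF x (by simp [hx])
        obtain ⟨δ, hδ, hd⟩ := hA.chain.exists_mem_of_isSuccLimit hlim hβ (hF a (by simp))
        refine ⟨max γ δ, max_lt hγ hδ, fun x hx => ?_⟩
        have hm := (max_lt hγ hδ).le.trans hβ
        rcases Finset.mem_insert.1 hx with rfl | hx
        · exact hA.chain.mono _ _ (le_max_right _ _) hm hd
        · exact hA.chain.mono _ _ (le_max_left _ _) hm (h x hx)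
    obtain ⟨γ, hγ, hFγ⟩ := this
    obtain ⟨N, hN, h⟩ := ih γ hγ (hγ.le.trans hβ) F hFγ
    exact ⟨N, hN.trans (hA.chain.mono _ _ hγ.le hβ), h⟩
  | add_one α ih =>
    intro hβ F hF
    have hα : α < τ := (Order.lt_succ α).trans_le hβ
    have hle : A α ≤ A (α + 1) := hA.chain.mono _ _ (Order.le_succ α) hβ
    have hdec : ∀ x ∈ F, ∃ y ∈ A α, x - y ∈ L α := by
      intro x hx
      have h := hF x hx
      rw [hA.succ α hα] at h
      obtain ⟨y, hy, l, hl, rfl⟩ := AddSubgroup.mem_sup.1 h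
      exact ⟨y, hy, by simpa using hl⟩
    choose! y hyA hyL using hdec
    -- If M contains L α, the components in L α are already present. Otherwise closure says that M
    -- has no element of level α, and L α is added to N.
    by_cases hLM : L α ≤ M
    · obtain ⟨N, hN, hfs, hFN, hp⟩ := ih hα.le (F.image y) (by simpa using hyA)
      refine ⟨N, hN.trans hle, hfs, fun x hx => ?_, hp⟩
      have h1 := hFN (y x) (Finset.mem_image_of_mem y hx)
      have h2 := add_mem h1 (AddSubgroup.mem_sup_left (T := N) (hLM (hyL x hx)))
      simpa using h2
    · have hMα : ∀ x ∈ M, x ∈ A (α + 1) → x ∈ A α := by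
        intro x hx hxα
        by_contra hcon
        exact hLM (hM α hα x hx hxα hcon)
      -- Butler's theorem enters here: finitely many lines carry L α ∩ A α, so the earlier N can be
      -- chosen to absorb this intersection as well.
      have hK : IsFiniteSumRankOne (L α ⊓ A α) :=
        (hA.finiteSum α hα).inf fun n x hn _ hx => (hA.pure α hα.le).mem_of_zsmul_mem hn hx
      obtain ⟨ι, _, b, hb, hd⟩ := hK
      obtain ⟨N, hN, hfs, hFN, hp⟩ := ih hα.le (F.image y ∪ Finset.univ.image b) (by
        intro x hx
        rcases Finset.mem_union.1 hx with hx | hx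
        · obtain ⟨x', hx', rfl⟩ := Finset.mem_image.1 hx
          exact hyA x' hx'
        · obtain ⟨j, -, rfl⟩ := Finset.mem_image.1 hx
          exact (hb j).2)
      have hKN : L α ⊓ A α ≤ M ⊔ N := by
        intro x hx
        obtain ⟨t, rfl, ht⟩ := hd x hx
        refine sum_mem fun j _ => ?_
        obtain ⟨-, s, r, hs, hsr⟩ := ht j
        refine hp s _ hs ?_
        rw [hsr]
        exact zsmul_mem (hFN _ (Finset.mem_union_right _ (Finset.mem_image_of_mem b
          (Finset.mem_univ j)))) r
      have hLα : L α ≤ A (α + 1) := by rw [hA.succ α hα]; exact le_sup_right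
      have hle' : M ⊔ N ≤ M ⊔ (N ⊔ L α) := sup_le_sup_left le_sup_left M
      have hLle : L α ≤ M ⊔ (N ⊔ L α) := le_sup_right.trans le_sup_right
      refine ⟨N ⊔ L α, sup_le (hN.trans hle) hLα, hfs.sup (hA.finiteSum α hα), fun x hx => ?_,
        fun n x hn hx => ?_⟩
      · have h1 := hFN (y x) (Finset.mem_union_left _ (Finset.mem_image_of_mem y hx))
        have h2 := add_mem (hle' h1) (hLle (hyL x hx))
        simpa using h2
      · have key : ∀ γ ≤ τ, ∀ x ∈ A γ, n • x ∈ M ⊔ (N ⊔ L α) → x ∈ M ⊔ (N ⊔ L α) := by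
          intro γ
          induction γ using WellFoundedLT.induction with
          | ind γ ihγ =>
          intro hγ x hx hnx
          obtain ⟨m, hm, z, hz, hmz⟩ := AddSubgroup.mem_sup.1 hnx
          have hzα : z ∈ A (α + 1) := (sup_le (hN.trans hle) hLα) hz
          -- Up to level α the overlap L α ∩ A α ≤ M + N reduces the claim to the old purity. Above
          -- it, an element m of M has the level σ of x, so L σ ≤ M and the component of x in L σ
          -- can be removed.
          by_cases hxα : x ∈ A (α + 1)
          · have hmα : m ∈ A α := by
              refine hMα m hm ?_
              have : m = n • x - z := by rw [← hmz]; abel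
              rw [this]
              exact sub_mem (zsmul_mem hxα n) hzα
            rw [hA.succ α hα] at hxα
            obtain ⟨u, hu, l, hl, rfl⟩ := AddSubgroup.mem_sup.1 hxα
            obtain ⟨v, hv, l', hl', rfl⟩ := AddSubgroup.mem_sup.1 hz
            have h1 : l' - n • l = n • u - (m + v) := by
              rw [smul_add] at hmz
              have : l' = n • u + n • l - (m + v) := by rw [← hmz]; abel
              rw [this]; abel
            have h2 : l' - n • l ∈ L α ⊓ A α := by
              refine ⟨(L α).sub_mem hl' (zsmul_mem hl n), ?_⟩
              change l' - n • l ∈ A α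
              rw [h1]
              exact sub_mem (zsmul_mem hu n) (add_mem hmα (hN hv))
            have h3 : n • u ∈ M ⊔ N := by
              have : n • u = (l' - n • l) + (m + v) := by rw [h1]; abel
              rw [this]
              exact add_mem (hKN h2) (AddSubgroup.add_mem_sup hm hv)
            exact add_mem (hle' (hp n u hn h3)) (hLle hl)
          · have hx0 : x ≠ 0 := fun h => hxα (h ▸ zero_mem _)
            obtain ⟨σ, hσγ, hxσ, hxσ'⟩ := hA.chain.exists_mem_succ hγ hx hx0
            have hστ := hσγ.trans_le hγ
            have hασ : α < σ := by
              by_contra hcon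
              exact hxα (hA.chain.mono _ _ (add_le_add_left (not_lt.1 hcon) 1) hβ hxσ)
            have hzσ : z ∈ A σ := hA.chain.mono _ _ (Order.succ_le_of_lt hασ) hστ.le hzα
            have hmeq : m = n • x - z := by rw [← hmz]; abel
            have hLσ : L σ ≤ M := by
              refine hM σ hστ m hm ?_ ?_
              · rw [hmeq]
                exact sub_mem (zsmul_mem hxσ n)
                  (hA.chain.mono _ _ (Order.le_succ σ) (Order.succ_le_of_lt hστ) hzσ)
              · intro hmσ
                refine hxσ' ((hA.pure σ hστ.le).mem_of_zsmul_mem hn ?_)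
                rw [← hmz]
                exact add_mem hmσ hzσ
            have hxσ2 := hxσ
            rw [hA.succ σ hστ] at hxσ2
            obtain ⟨u, hu, l, hl, rfl⟩ := AddSubgroup.mem_sup.1 hxσ2
            have hlM : l ∈ M ⊔ (N ⊔ L α) := AddSubgroup.mem_sup_left (hLσ hl)
            refine add_mem (ihγ σ hσγ hστ.le u hu ?_) hlM
            have : n • u = n • (u + l) - n • l := by rw [smul_add]; abel
            rw [this]
            exact sub_mem hnx (zsmul_mem hlM n)
        exact key τ le_rfl x (by rw [hA.chain.top]; trivial) hx

/-- Intersecting the absorbing N with the pure hull P of M and b, and applying Butler's theorem once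
more, decomposes P modulo M. This is prebalancedness of M, with the `c j` chosen uniformly for all x
in P. -/
theorem exists_rankOne_decomposition (hA : IsB₂Chain τ A L) (hM : IsChainClosed τ A L M) (b : B) :
    ∃ (ι : Type) (_ : Fintype ι) (c : ι → B),
      (∀ j, ∃ n k : ℤ, n ≠ 0 ∧ n • c j - k • b ∈ M) ∧
      ∀ (x : B) (n k : ℤ), n ≠ 0 → n • x - k • b ∈ M →
        ∃ t : ι → B, x - ∑ j, t j ∈ M ∧ ∀ j, ∃ s r : ℤ, s ≠ 0 ∧ s • t j = r • c j := by
  obtain ⟨N, -, hfs, hbN, hp⟩ := hA.exists_finiteSum hM τ le_rfl {b}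
    (by intro x _; rw [hA.chain.top]; trivial)
  have hbN : b ∈ M ⊔ N := hbN b (by simp)
  let P : AddSubgroup B :=
    { carrier := {x | ∃ n k : ℤ, n ≠ 0 ∧ n • x - k • b ∈ M}
      zero_mem' := ⟨1, 0, one_ne_zero, by simp⟩
      add_mem' := by
        rintro x y ⟨n, k, hn, h⟩ ⟨n', k', hn', h'⟩
        refine ⟨n * n', n' * k + n * k', mul_ne_zero hn hn', ?_⟩
        have : (n * n') • (x + y) - (n' * k + n * k') • b =
            n' • (n • x - k • b) + n • (n' • y - k' • b) := by
          module
        rw [this]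
        exact add_mem (zsmul_mem h _) (zsmul_mem h' _)
      neg_mem' := by
        rintro x ⟨n, k, hn, h⟩
        refine ⟨n, -k, hn, ?_⟩
        have : n • -x - -k • b = -(n • x - k • b) := by module
        rw [this]
        exact neg_mem h }
  have hPle : P ≤ M ⊔ N := by
    rintro x ⟨n, k, hn, h⟩
    refine hp n x hn ?_
    have := add_mem (AddSubgroup.mem_sup_left (T := N) h) (zsmul_mem hbN k)
    simpa using this
  have hMP : M ≤ P := fun x hx => ⟨1, 0, one_ne_zero, by simpa using hx⟩
  obtain ⟨ι, _, c, hc, hd⟩ := hfs.inf (P := P) (by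
    rintro n x hn - ⟨n', k, hn', h⟩
    exact ⟨n' * n, k, mul_ne_zero hn' hn, by rwa [mul_smul]⟩)
  refine ⟨ι, inferInstance, c, fun j => (hc j).2, fun x n k hn hx => ?_⟩
  have hxP : x ∈ P := ⟨n, k, hn, hx⟩
  obtain ⟨m, hm, l, hl, rfl⟩ := AddSubgroup.mem_sup.1 (hPle hxP)
  have hlP : l ∈ P := by simpa using sub_mem hxP (hMP hm)
  obtain ⟨t, rfl, ht⟩ := hd l ⟨hl, hlP⟩
  exact ⟨t, by simpa using hm, fun j => (ht j).2⟩

end IsB₂Chain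

theorem IsB₂Group.exists_isB₂Chain {B : Type*} [AddCommGroup B] (hB : IsB₂Group B) :
    ∃ (τ : Ordinal) (A L : Ordinal → AddSubgroup B), IsB₂Chain τ A L := by
  obtain ⟨-, τ, A, hA, hp, hL⟩ := hB
  choose! L hL hsucc using hL
  refine ⟨τ, A, L, hA, hp, fun α hα => ?_, hsucc⟩
  have h := (hL α hα).isFiniteSumRankOne.map (L α).subtype
  rwa [← AddMonoidHom.range_eq_map, AddSubgroup.range_subtype] at h

/-! ### The standard balanced projective resolution -/

/-- The pure subgroup generated by `g` in a torsion-free group. -/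
def pureClosure {G : Type*} [AddCommGroup G] (g : G) : AddSubgroup G where
  carrier := {x | ∃ n k : ℤ, n ≠ 0 ∧ n • x = k • g}
  zero_mem' := ⟨1, 0, one_ne_zero, by simp⟩
  add_mem' := by
    rintro x y ⟨n, k, hn, h⟩ ⟨n', k', hn', h'⟩
    refine ⟨n * n', n' * k + n * k', mul_ne_zero hn hn', ?_⟩
    have : (n * n') • (x + y) = n' • (n • x) + n • (n' • y) := by module
    rw [this, h, h']
    module
  neg_mem' := by
    rintro x ⟨n, k, hn, h⟩
    exact ⟨n, -k, hn, by rw [smul_neg, h, neg_smul]⟩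

theorem self_mem_pureClosure {G : Type*} [AddCommGroup G] (g : G) : g ∈ pureClosure g :=
  ⟨1, 1, one_ne_zero, rfl⟩

theorem zsmul_mem_pureClosure {G : Type*} [AddCommGroup G] {n : ℤ} (hn : n ≠ 0) {g x : G}
    (h : n • x ∈ pureClosure g) : x ∈ pureClosure g := by
  obtain ⟨m, k, hm, h⟩ := h
  exact ⟨m * n, k, mul_ne_zero hm hn, by rw [mul_smul, h]⟩

theorem nsmul_mem_pureClosure {G : Type*} [AddCommGroup G] {n : ℕ} (hn : n ≠ 0) {g x : G}
    (h : n • x ∈ pureClosure g) : x ∈ pureClosure g :=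
  zsmul_mem_pureClosure (n := n) (by exact_mod_cast hn) (by rwa [natCast_zsmul])

theorem pureClosure_zero {G : Type*} [AddCommGroup G] [IsAddTorsionFree G] {x : G}
    (h : x ∈ pureClosure (0 : G)) : x = 0 := by
  obtain ⟨n, k, hn, h⟩ := h
  rw [smul_zero] at h
  exact (smul_eq_zero.1 h).resolve_left hn

theorem countable_pureClosure {G : Type*} [AddCommGroup G] [IsAddTorsionFree G] (g : G) :
    (pureClosure g : Set G).Countable := by
  have h : ∀ x : G, ∃ n k : ℤ, x ∈ pureClosure g → n ≠ 0 ∧ n • x = k • g := by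
    intro x
    by_cases hx : x ∈ pureClosure g
    · obtain ⟨n, k, h⟩ := hx
      exact ⟨n, k, fun _ => h⟩
    · exact ⟨0, 0, fun h => absurd h hx⟩
  choose n k hnk using h
  refine Set.MapsTo.countable_of_injOn (f := fun x => (n x, k x)) (Set.mapsTo_univ _ _) ?_
    Set.countable_univ
  intro x hx y hy hxy
  simp only [Prod.mk.injEq] at hxy
  apply zsmul_right_injective (hnk x hx).1
  change n x • x = n x • y
  rw [(hnk x hx).2, hxy.1, hxy.2, (hnk y hy).2]

/-- The direct sum of the pure subgroups generated by the elements of `G`. -/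
def rankOneSum (G : Type*) [AddCommGroup G] : AddSubgroup (G →₀ G) where
  carrier := {c | ∀ g, c g ∈ pureClosure g}
  zero_mem' := fun g => (pureClosure g).zero_mem
  add_mem' := fun ha hb g => (pureClosure g).add_mem (ha g) (hb g)
  neg_mem' := fun ha g => (pureClosure g).neg_mem (ha g)

namespace rankOneSum

variable {G : Type*} [AddCommGroup G]

/-- An element of one of the summands. -/
noncomputable def single (g z : G) (hz : z ∈ pureClosure g) : rankOneSum G :=
  ⟨Finsupp.single g z, fun g' => by
    classical
    rw [Finsupp.single_apply]
    split_ifs with h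
    · exact h ▸ hz
    · exact zero_mem _⟩

theorem coe_single (g z : G) (hz : z ∈ pureClosure g) :
    (single g z hz : G →₀ G) = Finsupp.single g z := rfl

/-- The canonical projection onto `G`. -/
noncomputable def proj (G : Type*) [AddCommGroup G] : rankOneSum G →+ G :=
  (Finsupp.liftAddHom fun _ : G => AddMonoidHom.id G).comp (rankOneSum G).subtype

theorem proj_apply (c : rankOneSum G) : proj G c = c.1.sum fun _ z => z := rfl

theorem proj_single (g z : G) (hz : z ∈ pureClosure g) : proj G (single g z hz) = z := by
  rw [proj_apply, coe_single, Finsupp.sum_single_index rfl]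

theorem proj_surjective : Function.Surjective (proj G) :=
  fun g => ⟨single g g (self_mem_pureClosure g), proj_single _ _ _⟩

instance [IsAddTorsionFree G] : IsAddTorsionFree (rankOneSum G) := by
  refine ⟨fun n hn x y hxy => ?_⟩
  ext g
  apply nsmul_right_injective hn
  have := congrArg (fun c : rankOneSum G => c.1 g) hxy
  simpa using this

end rankOneSum

theorem isRankOne_of_exists {R : Type*} [AddCommGroup R] [IsAddTorsionFree R] {a : R} (ha : a ≠ 0)
    (h : ∀ x : R, ∃ s r : ℤ, s ≠ 0 ∧ s • x = r • a) : IsRankOne R := by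
  refine ⟨inferInstance, le_antisymm ?_ ?_⟩
  · have h1 : Module.rank ℤ R ≤ ((1 : ℕ) : Cardinal) := by
      refine rank_le fun s hs => ?_
      by_contra! hcard
      obtain ⟨x, hx, y, hy, hxy⟩ := Finset.one_lt_card.1 hcard
      have hli : LinearIndependent ℤ ![x, y] := by
        have h2 := hs.comp ![⟨x, hx⟩, ⟨y, hy⟩] (by
          intro i j hij
          fin_cases i <;> fin_cases j <;> simp_all)
        convert h2 using 1
        funext i
        fin_cases i <;> rfl
      rw [LinearIndependent.pair_iff] at hli
      obtain ⟨s, r, hs0, hsr⟩ := h x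
      obtain ⟨s', r', hs0', hsr'⟩ := h y
      have h3 := hli (r' * s) (-(r * s')) (by
        rw [neg_smul, mul_smul, mul_smul, hsr, hsr']
        module)
      have h4 : r' = 0 := (mul_eq_zero.1 h3.1).resolve_right hs0
      rw [h4, zero_smul] at hsr'
      have h5 := hli 0 s' (by rw [hsr']; simp)
      exact hs0' h5.2
    simpa using h1
  · rw [Cardinal.one_le_iff_pos, rank_pos_iff_exists_ne_zero]
    exact ⟨a, ha⟩

namespace rankOneSum

open Classical in
theorem isCompletelyDecomposable (G : Type*) [AddCommGroup G] [IsAddTorsionFree G] :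
    IsCompletelyDecomposable (rankOneSum G) := by
  let _ : DecidableEq {g : G // g ≠ 0} := fun a b => Classical.propDecidable (a = b)
  -- The index 0 is omitted: its summand is zero and would not have rank one.
  let R : {g : G // g ≠ 0} → AddSubgroup (rankOneSum G) := fun i =>
    { carrier := {c | ∀ g, g ≠ i.1 → c.1 g = 0}
      zero_mem' := fun g _ => rfl
      add_mem' := fun {a b} ha hb g hg => by
        change a.1 g + b.1 g = 0
        rw [ha g hg, hb g hg, add_zero]
      neg_mem' := fun {a} ha g hg => by
        change -(a.1 g) = 0
        rw [ha g hg, neg_zero] }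
  have hsingle : ∀ (i : {g : G // g ≠ 0}) z hz, single i.1 z hz ∈ R i := by
    intro i z hz g hg
    rw [coe_single, Finsupp.single_eq_of_ne hg]
  refine ⟨{g : G // g ≠ 0}, R, fun i => ?_, ?_, ?_⟩
  · refine isRankOne_of_exists
      (a := ⟨single i.1 i.1 (self_mem_pureClosure _), hsingle _ _ _⟩) ?_ ?_
    · intro h
      have := congrArg (fun c : R i => c.1.1 i.1) h
      exact i.2 (by simpa [coe_single] using this)
    · rintro ⟨c, hc⟩
      obtain ⟨n, k, hn, h⟩ := c.2 i.1
      refine ⟨n, k, hn, ?_⟩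
      ext g
      change n • c.1 g = k • (Finsupp.single i.1 i.1 : G →₀ G) g
      by_cases hg : g = i.1
      · subst hg
        rw [h, Finsupp.single_eq_same]
      · rw [hc g hg, Finsupp.single_eq_of_ne hg, smul_zero, smul_zero]
  · rw [injective_iff_map_eq_zero]
    intro y hy
    ext i g
    let ev : rankOneSum G →+ G := (Finsupp.applyAddHom i.1).comp (rankOneSum G).subtype
    have key : ev.comp (DirectSum.coeAddMonoidHom R) =
        (ev.comp (R i).subtype).comp (DFinsupp.evalAddMonoidHom i) := by
      refine DirectSum.addHom_ext fun j c => ?_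
      change ev (DirectSum.coeAddMonoidHom R (DirectSum.of _ j c)) =
        ev ((DirectSum.of (fun i => R i) j c) i : R i).1
      rw [DirectSum.coeAddMonoidHom_of]
      by_cases hij : j = i
      · subst hij
        rw [DirectSum.of_eq_same]
      · rw [DirectSum.of_eq_of_ne _ _ _ (Ne.symm hij)]
        exact c.2 i.1 fun h => hij (Subtype.ext h.symm)
    have h1 := DFunLike.congr_fun key y
    have h2 : (y i).1.1 i.1 = 0 := by
      rw [AddMonoidHom.comp_apply, hy, map_zero] at h1
      exact h1.symm
    by_cases hg : g = i.1
    · subst hg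
      exact h2
    · exact (y i).2 g hg
  · intro c
    have hmem : ∀ g, single g (c.1 g) (c.2 g) ∈ (DirectSum.coeAddMonoidHom R).range := by
      intro g
      by_cases hg : g = 0
      · have h0 : c.1 g = 0 := by
          subst hg
          exact pureClosure_zero (c.2 0)
        have : single g (c.1 g) (c.2 g) = 0 := by
          ext g'
          simp [coe_single, h0]
        rw [this]
        exact zero_mem _
      · exact ⟨DirectSum.of (fun i => R i) ⟨g, hg⟩ ⟨_, hsingle ⟨g, hg⟩ _ (c.2 g)⟩,
          DirectSum.coeAddMonoidHom_of R _ _⟩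
    have hsum : c = ∑ g ∈ c.1.support, single g (c.1 g) (c.2 g) := by
      apply Subtype.ext
      rw [AddSubgroup.val_finsetSum]
      exact (Finsupp.sum_single c.1).symm
    have : c ∈ (DirectSum.coeAddMonoidHom R).range := by
      rw [hsum]
      exact sum_mem fun g _ => hmem g
    exact this

theorem isBalancedProjectiveResolution (G : Type*) [AddCommGroup G] [IsAddTorsionFree G] :
    IsBalancedProjectiveResolution (proj G) := by
  refine ⟨isCompletelyDecomposable G, proj_surjective, fun n c hc => ?_, fun c => ?_⟩
  · rw [AddMonoidHom.mem_ker, map_nsmul, smul_eq_zero] at hc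
    rcases hc with rfl | hc
    · exact ⟨0, zero_mem _, by simp⟩
    · exact ⟨c, hc, rfl⟩
  · let e := QuotientAddGroup.quotientKerEquivOfSurjective (proj G) proj_surjective
    have hchar : characteristic (QuotientAddGroup.mk c : rankOneSum G ⧸ (proj G).ker) =
        characteristic (proj G c) := (characteristic_equiv e _).symm
    rw [hchar]
    -- The lift of x to its own summand ⟨x⟩_* has the right heights, because any root of x in G
    -- already lies in ⟨x⟩_*.
    refine ⟨single (proj G c) (proj G c) (self_mem_pureClosure _) - c, ?_, ?_⟩
    · rw [AddMonoidHom.mem_ker, map_sub, proj_single, _root_.sub_self]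
    · rw [_root_.add_sub_cancel]
      refine le_antisymm ?_ fun p => ?_
      · have := characteristic_le_map (proj G)
          (single (proj G c) (proj G c) (self_mem_pureClosure _))
        rwa [proj_single] at this
      · refine characteristic_le_iff.2 fun k hk => natCast_le_characteristic_iff.2 ?_
        obtain ⟨b, hb⟩ := hk
        refine ⟨single (proj G c) b (nsmul_mem_pureClosure (pow_ne_zero k p.2.ne_zero)
          (hb ▸ self_mem_pureClosure _)), ?_⟩
        ext1
        change (p : ℕ) ^ k • Finsupp.single (proj G c) b = Finsupp.single (proj G c) (proj G c)
        rw [Finsupp.smul_single, hb]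

theorem mk_eq {G : Type} [AddCommGroup G] [Infinite G] : #(rankOneSum G) = #G := by
  refine le_antisymm ?_ (Cardinal.mk_le_of_surjective proj_surjective)
  calc #(rankOneSum G) ≤ #(G →₀ G) := Cardinal.mk_subtype_le _
    _ = #G := by simp

theorem mk_ker_eq {G : Type} [AddCommGroup G] [IsAddTorsionFree G] [Infinite G] :
    #(proj G).ker = #G := by
  refine le_antisymm ((Cardinal.mk_subtype_le _).trans mk_eq.le) ?_
  have h2 : ∀ x : G, (2 : ℤ) • x ∈ pureClosure x := fun x =>
    zsmul_mem (self_mem_pureClosure x) 2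
  -- The element 2x is placed at the coordinates 2x and x with opposite signs; torsion-freeness lets
  -- x be recovered from this kernel element.
  let f : G → (proj G).ker := fun x =>
    ⟨single ((2 : ℤ) • x) ((2 : ℤ) • x) (self_mem_pureClosure _) - single x ((2 : ℤ) • x) (h2 x), by
      rw [AddMonoidHom.mem_ker, map_sub, proj_single, proj_single, _root_.sub_self]⟩
  have hf : ∀ x, (f x).1.1 = Finsupp.single ((2 : ℤ) • x) ((2 : ℤ) • x) -
    Finsupp.single x ((2 : ℤ) • x) := fun x => rfl
  have h0 : ∀ (n : ℤ) (x : G), n ≠ 0 → n • x = 0 → x = 0 := fun n x hn h =>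
    (smul_eq_zero.1 h).resolve_left hn
  have hne : ∀ x : G, x ≠ 0 → x ≠ (2 : ℤ) • x := by
    intro x hx h
    refine hx (h0 1 x one_ne_zero ?_)
    have : (1 : ℤ) • x = (2 : ℤ) • x - x := by module
    rw [this, ← h, _root_.sub_self]
  have hval : ∀ x : G, x ≠ 0 → (f x).1.1 ((2 : ℤ) • x) = (2 : ℤ) • x := by
    intro x hx
    rw [hf, Finsupp.sub_apply, Finsupp.single_eq_same,
      Finsupp.single_eq_of_ne (hne x hx).symm, _root_.sub_zero]
  refine Cardinal.mk_le_of_injective (f := f) fun x y hxy => ?_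
  have hzero : f 0 = 0 := by
    apply Subtype.ext; apply Subtype.ext
    rw [hf]
    simp
  have hker : ∀ x, f x = 0 → x = 0 := by
    intro x hx
    by_contra hx0
    have := hval x hx0
    rw [hx] at this
    exact hx0 (h0 2 x two_ne_zero this.symm)
  by_cases hy0 : y = 0
  · subst hy0
    exact hker x (hxy.trans hzero)
  · have h1 := hval y hy0
    rw [← hxy, hf, Finsupp.sub_apply] at h1
    have h2y : (2 : ℤ) • y ≠ 0 := fun h => hy0 (h0 2 y two_ne_zero h)
    by_cases ha : (2 : ℤ) • y = (2 : ℤ) • x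
    · exact (zsmul_right_injective (two_ne_zero) ha).symm
    · by_cases hb : (2 : ℤ) • y = x
      · exfalso
        rw [Finsupp.single_eq_of_ne ha, hb, Finsupp.single_eq_same] at h1
        have h3 : (6 : ℤ) • y = 0 := by
          have h4 : (3 : ℤ) • x = 0 := by
            have : (3 : ℤ) • x = x - (0 - (2 : ℤ) • x) := by module
            rw [this, h1, _root_.sub_self]
          rw [← hb] at h4
          rw [← h4]; module
        exact hy0 (h0 6 y (by norm_num) h3)
      · rw [Finsupp.single_eq_of_ne ha, Finsupp.single_eq_of_ne hb, _root_.sub_zero] at h1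
        exact absurd h1.symm h2y

end rankOneSum

/-! ### Closing off under a countable-valued finitary operation -/

theorem countable_setOf_finset_subset {X : Type*} {W : Set X} (hW : W.Countable) :
    {t : Finset X | (t : Set X) ⊆ W}.Countable := by
  classical
  have := hW.to_subtype
  refine (Set.countable_range fun u : Finset W =>
    u.map (Function.Embedding.subtype _)).mono fun t ht => ?_
  exact ⟨t.subtype (· ∈ W), Finset.subtype_map_of_mem fun y hy => ht hy⟩

/-- A union of ω successive closure steps suffices because the operation has finite arguments; an
infinite κ absorbs both the finite subsets and their countable values. -/
theorem exists_closed_superset {X : Type} (Ψ : Finset X → Set X) (hΨ : ∀ s, (Ψ s).Countable)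
    {κ : Cardinal} (hκ : ℵ₀ ≤ κ) (N₀ : Set X) (hN₀ : #N₀ ≤ κ) :
    ∃ N : Set X, N₀ ⊆ N ∧ #N ≤ κ ∧ ∀ s : Finset X, (s : Set X) ⊆ N → Ψ s ⊆ N := by
  classical
  let step : Set X → Set X := fun Y => Y ∪ ⋃ s : Finset Y, Ψ (s.map (Function.Embedding.subtype _))
  have hstep : ∀ Y : Set X, #Y ≤ κ → #(step Y) ≤ κ := by
    intro Y hY
    refine (Cardinal.mk_union_le _ _).trans (Cardinal.add_le_of_le hκ hY ?_)
    refine (Cardinal.mk_iUnion_le _).trans ?_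
    have h1 : #(Finset Y) ≤ κ := by
      rcases finite_or_infinite Y with h | h
      · exact (Cardinal.mk_le_aleph0).trans hκ
      · rwa [Cardinal.mk_finset_of_infinite]
    refine (mul_le_mul' h1 ?_).trans (Cardinal.mul_eq_self hκ).le
    exact ciSup_le' fun s => ((hΨ _).le_aleph0).trans hκ
  let N : ℕ → Set X := fun n => step^[n] N₀
  have hN : ∀ n, #(N n) ≤ κ := by
    intro n
    induction n with
    | zero => exact hN₀
    | succ n ih =>
      simp only [N, Function.iterate_succ_apply']
      exact hstep _ ih
  have hmono : Monotone N := by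
    refine monotone_nat_of_le_succ fun n => ?_
    simp only [N, Function.iterate_succ_apply']
    exact Set.subset_union_left
  refine ⟨⋃ n, N n, Set.subset_iUnion N 0, ?_, fun s hs => ?_⟩
  · refine (Cardinal.mk_iUnion_le _).trans ?_
    refine (mul_le_mul' (Cardinal.mk_le_aleph0.trans hκ) ?_).trans (Cardinal.mul_eq_self hκ).le
    exact ciSup_le' hN
  · have : ∃ n, (s : Set X) ⊆ N n := by
      induction s using Finset.induction_on with
      | empty => exact ⟨0, by simp⟩
      | insert a s _ ih =>
        obtain ⟨n, hn⟩ := ih ((Finset.coe_subset.2 (Finset.subset_insert a s)).trans hs)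
        obtain ⟨m, hm⟩ := Set.mem_iUnion.1 (hs (Finset.mem_coe.2 (Finset.mem_insert_self a s)))
        refine ⟨max n m, fun x hx => ?_⟩
        rcases Finset.mem_insert.1 (Finset.mem_coe.1 hx) with rfl | hx
        · exact hmono (le_max_right _ _) hm
        · exact hmono (le_max_left _ _) (hn hx)
    obtain ⟨n, hn⟩ := this
    refine Set.Subset.trans (fun x hx => ?_) (Set.subset_iUnion N (n + 1))
    simp only [N, Function.iterate_succ_apply']
    refine Or.inr (Set.mem_iUnion.2 ⟨s.subtype (· ∈ N n), ?_⟩)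
    have : (s.subtype (· ∈ N n)).map (Function.Embedding.subtype _) = s :=
      Finset.subtype_map_of_mem fun y hy => hn hy
    exact this.symm ▸ hx

theorem exists_countable_closed_superset {X : Type} (Ψ : Finset X → Set X)
    (hΨ : ∀ s, (Ψ s).Countable) (N₀ : Set X) (hN₀ : N₀.Countable) :
    ∃ N : Set X, N₀ ⊆ N ∧ N.Countable ∧ ∀ s : Finset X, (s : Set X) ⊆ N → Ψ s ⊆ N := by
  obtain ⟨N, h1, h2, h3⟩ := exists_closed_superset Ψ hΨ le_rfl N₀ hN₀.le_aleph0
  exact ⟨N, h1, Cardinal.le_aleph0_iff_set_countable.1 h2, h3⟩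

/-! ### `B₂`-kernels yield controlled subgroups -/

namespace rankOneSum

variable {G : Type} [AddCommGroup G]

theorem countable_support_subset [IsAddTorsionFree G] {N : Set G} (hN : N.Countable) :
    {c : G →₀ G | c ∈ rankOneSum G ∧ (c.support : Set G) ⊆ N}.Countable := by
  have hW : (⋃ g ∈ N, (Prod.mk g '' (pureClosure g : Set G))).Countable :=
    hN.biUnion fun g _ => (countable_pureClosure g).image _
  refine Set.MapsTo.countable_of_injOn (f := Finsupp.graph) (fun c hc => ?_)
    (Finsupp.graph_injective G G).injOn (countable_setOf_finset_subset hW)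
  rintro ⟨g, z⟩ hz
  rw [Finset.mem_coe, Finsupp.mk_mem_graph_iff] at hz
  refine Set.mem_biUnion (hc.2 (Finset.mem_coe.2 (Finsupp.mem_support_iff.2 ?_))) ⟨z, ?_, rfl⟩
  · rw [hz.1]; exact hz.2
  · rw [← hz.1]; exact hc.1 g

/-- The elements of the kernel of the projection whose support lies in `X`. -/
def kerSupported (X : Set G) : AddSubgroup (proj G).ker where
  carrier := {b | ∀ g, g ∉ X → b.1.1 g = 0}
  zero_mem' := fun _ _ => rfl
  add_mem' := fun {a b} ha hb g hg => by
    change a.1.1 g + b.1.1 g = 0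
    rw [ha g hg, hb g hg, add_zero]
  neg_mem' := fun {a} ha g hg => by
    change -(a.1.1 g) = 0
    rw [ha g hg, neg_zero]

/-- The set of all coordinates at which some element of `N` does not vanish. -/
def coordinates (N : AddSubgroup (proj G).ker) : Set G := ⋃ x ∈ N, (x.1.1.support : Set G)

theorem le_kerSupported_of_coordinates {N : AddSubgroup (proj G).ker} {X : Set G}
    (h : coordinates N ⊆ X) : N ≤ kerSupported X := by
  intro x hx g hg
  by_contra hne
  exact hg (h (Set.mem_biUnion hx (Finset.mem_coe.2 (Finsupp.mem_support_iff.2 hne))))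

theorem coordinates_countable [IsAddTorsionFree G] {N : AddSubgroup (proj G).ker} (hN : IsFiniteSumRankOne N) :
    (coordinates N).Countable :=
  hN.countable.biUnion fun x _ => x.1.1.support.countable_toSet

variable [IsAddTorsionFree G] {τ : Ordinal} {A L : Ordinal → AddSubgroup (proj G).ker}

theorem exists_countable_coordinates (hA : IsB₂Chain τ A L) (b : (proj G).ker) :
    ∃ S : Set G, S.Countable ∧ ∀ α < τ, b ∈ A (α + 1) → b ∉ A α → coordinates (L α) ⊆ S := by
  by_cases h : ∃ α < τ, b ∈ A (α + 1) ∧ b ∉ A α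
  · obtain ⟨α, hα, hb, hb'⟩ := h
    refine ⟨_, coordinates_countable (hA.finiteSum α hα), fun β hβ hbβ hbβ' => ?_⟩
    rw [hA.chain.eq_of_mem_succ hα hβ hb hb' hbβ hbβ']
  · exact ⟨∅, Set.countable_empty, fun α hα hb hb' => absurd ⟨α, hα, hb, hb'⟩ h⟩

/-- Two kernel elements that agree outside H differ by an element supported in H. If their levels
differ, the difference has the larger one, so closure puts the corresponding L into `kerSupported
H`. Hence at most one level matters, although uncountably many b may agree with c. -/
theorem exists_countable_coordinates_of_agree (hA : IsB₂Chain τ A L) {H : Set G}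
    (hM : IsChainClosed τ A L (kerSupported H)) (c : G →₀ G) :
    ∃ S : Set G, S.Countable ∧ ∀ b : (proj G).ker, (∀ g, g ∉ H → b.1.1 g = c g) →
      ∀ α < τ, b ∈ A (α + 1) → b ∉ A α →
        L α ≤ kerSupported H ∨ coordinates (L α) ⊆ S := by
  by_cases h : ∃ b : (proj G).ker, (∀ g, g ∉ H → b.1.1 g = c g) ∧
      ∃ α < τ, b ∈ A (α + 1) ∧ b ∉ A α ∧ ¬ L α ≤ kerSupported H
  · obtain ⟨b, hb, α, hα, hbα, hbα', hL⟩ := h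
    refine ⟨_, coordinates_countable (hA.finiteSum α hα), fun b' hb' β hβ hbβ hbβ' => ?_⟩
    by_cases hL' : L β ≤ kerSupported H
    · exact Or.inl hL'
    right
    have hsub : b' - b ∈ kerSupported H := fun g hg => by
      change b'.1.1 g - b.1.1 g = 0
      rw [hb g hg, hb' g hg, _root_.sub_self]
    rcases lt_trichotomy α β with h | h | h
    · have hbA := hA.chain.mono _ _ (Order.succ_le_of_lt h) hβ.le hbα
      refine absurd (hM β hβ _ hsub ?_ fun hc => hbβ' ?_) hL'
      · exact sub_mem hbβ (hA.chain.mono _ _ (Order.le_succ β) (Order.succ_le_of_lt hβ) hbA)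
      · simpa using add_mem hc hbA
    · rw [h]
    · have hbA := hA.chain.mono _ _ (Order.succ_le_of_lt h) hα.le hbβ
      refine absurd (hM α hα _ (neg_mem hsub) ?_ fun hc => hbα' ?_) hL
      · rw [neg_sub]
        exact sub_mem hbα (hA.chain.mono _ _ (Order.le_succ α) (Order.succ_le_of_lt hα) hbA)
      · simpa using add_mem hc hbA
  · refine ⟨∅, Set.countable_empty, fun b hb α hα hbα hbα' => Or.inl ?_⟩
    by_contra hL
    exact h ⟨b, hb, α, hα, hbα, hbα', hL⟩

theorem isChainClosed_kerSupported (hA : IsB₂Chain τ A L) : ∃ Φ : Finset G → Set G,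
    (∀ s, (Φ s).Countable) ∧ ∀ X : Set G, (∀ s : Finset G, (s : Set G) ⊆ X → Φ s ⊆ X) →
      IsChainClosed τ A L (kerSupported X) := by
  choose S hSc hS using exists_countable_coordinates hA
  have hinj : Function.Injective fun b : (proj G).ker => b.1.1 :=
    Subtype.val_injective.comp Subtype.val_injective
  refine ⟨fun s => ⋃ b ∈ {b : (proj G).ker | (b.1.1.support : Set G) ⊆ s}, S b, fun s => ?_,
    fun X hX α hα b hb hbα hbα' => ?_⟩
  · refine Set.Countable.biUnion ?_ fun b _ => hSc b
    refine Set.MapsTo.countable_of_injOn (f := fun b : (proj G).ker => b.1.1)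
      (t := {c : G →₀ G | c ∈ rankOneSum G ∧ (c.support : Set G) ⊆ s})
      (fun b hb => ⟨b.1.2, hb⟩) hinj.injOn (countable_support_subset s.countable_toSet)
  · refine le_kerSupported_of_coordinates ((hS b α hα hbα hbα').trans ?_)
    refine Set.Subset.trans ?_ (hX b.1.1.support ?_)
    · exact Set.subset_biUnion_of_mem (u := fun b => S b) (Set.Subset.refl _)
    · intro g hg
      by_contra hgX
      exact (Finsupp.mem_support_iff.1 (Finset.mem_coe.1 hg)) (hb g hgX)

/-- Closing H ∪ N would seem to involve uncountably many kernel elements, but only their parts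
outside H matter by `exists_countable_coordinates_of_agree`, and these are supported in the
countable N. The last clause stores in N roots of h modulo H, for use in computing heights. -/
theorem exists_countable_extension (hA : IsB₂Chain τ A L) {H : AddSubgroup G}
    (hM : IsChainClosed τ A L (kerSupported (H : Set G))) (h : G) :
    ∃ N : AddSubgroup G, (N : Set G).Countable ∧ h ∈ N ∧
      IsChainClosed τ A L (kerSupported ((H : Set G) ∪ N)) ∧
      (∀ y ∈ N, pureClosure y ≤ N) ∧
      ∀ (n : ℕ), (∃ z, n • z - h ∈ H) → ∃ z ∈ N, n • z - h ∈ H := by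
  classical
  choose S hSc hS using exists_countable_coordinates_of_agree hA hM
  -- The default h is harmless, since h is put into N anyway.
  let z : ℕ → G := fun n => if h' : ∃ z, n • z - h ∈ H then h'.choose else h
  let Ψ : Finset G → Set G := fun s => (⋃ a ∈ s, ⋃ b ∈ s, {a - b}) ∪
    ((⋃ y ∈ s, (pureClosure y : Set G)) ∪
      ⋃ c ∈ {c : G →₀ G | c ∈ rankOneSum G ∧ (c.support : Set G) ⊆ s}, S c)
  have hΨ : ∀ s, (Ψ s).Countable := by
    intro s
    refine Set.Countable.union ?_ (Set.Countable.union ?_ ?_)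
    · exact s.countable_toSet.biUnion fun a _ => s.countable_toSet.biUnion fun b _ =>
        Set.countable_singleton _
    · exact s.countable_toSet.biUnion fun y _ => countable_pureClosure y
    · exact (countable_support_subset s.countable_toSet).biUnion fun c _ => hSc c
  obtain ⟨N, hN₀, hNc, hN⟩ := exists_countable_closed_superset Ψ hΨ (insert h (Set.range z))
    ((Set.countable_range z).insert h)
  have hhN : h ∈ N := hN₀ (Set.mem_insert _ _)
  have hsub : ∀ a ∈ N, ∀ b ∈ N, a - b ∈ N := by
    intro a ha b hb
    refine hN {a, b} (by rw [Finset.coe_pair]; exact Set.pair_subset ha hb) (Or.inl ?_)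
    simp only [Set.mem_iUnion]
    exact ⟨a, by simp, b, by simp, rfl⟩
  have h0 : (0 : G) ∈ N := by simpa using hsub h hhN h hhN
  have hneg : ∀ a ∈ N, -a ∈ N := fun a ha => by simpa using hsub 0 h0 a ha
  refine ⟨{ carrier := N, zero_mem' := h0, neg_mem' := fun {a} ha => hneg a ha,
            add_mem' := fun {a b} ha hb => by simpa using hsub a ha _ (hneg b hb) },
    hNc, hhN, ?_, ?_, ?_⟩
  · intro α hα b hb hbα hbα'
    let c : G →₀ G := b.1.1.filter fun g => g ∉ H
    have hcN : (c.support : Set G) ⊆ N := by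
      intro g hg
      rw [Finset.mem_coe, Finsupp.support_filter, Finset.mem_filter, Finsupp.mem_support_iff] at hg
      by_contra hgN
      refine hg.1 (hb g ?_)
      rintro (h | h)
      · exact hg.2 h
      · exact hgN h
    have hcR : c ∈ rankOneSum G := by
      intro g
      by_cases hg : g ∉ H
      · rw [show c g = b.1.1 g from Finsupp.filter_apply_pos (fun g => g ∉ H) b.1.1 hg]
        exact b.1.2 g
      · rw [show c g = 0 from Finsupp.filter_apply_neg (fun g => g ∉ H) b.1.1 hg]
        exact zero_mem _
    rcases hS c b (fun g hg => (Finsupp.filter_apply_pos (fun g => g ∉ H) b.1.1 hg).symm) α hα hbα hbα' with h | h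
    · exact h.trans fun x hx g hg => hx g fun hgH => hg (Or.inl hgH)
    · refine le_kerSupported_of_coordinates (h.trans ?_)
      refine Set.Subset.trans ?_ (Set.subset_union_right)
      refine Set.Subset.trans ?_ (hN c.support hcN)
      refine Set.Subset.trans ?_ (Set.subset_union_right.trans Set.subset_union_right)
      exact Set.subset_biUnion_of_mem (u := fun c => S c)
        (show c ∈ {d : G →₀ G | d ∈ rankOneSum G ∧ (d.support : Set G) ⊆ c.support} from
          ⟨hcR, Set.Subset.refl _⟩)
  · intro y hy x hx
    refine hN {y} (by simpa using hy) (Or.inr (Or.inl ?_))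
    simpa using hx
  · intro n hn
    refine ⟨z n, hN₀ (Set.mem_insert_of_mem _ ⟨n, rfl⟩), ?_⟩
    simp only [z, dif_pos hn]
    exact hn.choose_spec

/-- Writing f(t j) as (r j / s j) k j g, the hypothesis reads p^e ∑ (r j / s j) k j = 1. Some term
is then not divisible by p, so r j / s j has valuation at most -e for some j with k j ≠ 0, and `c j`
is divisible by p^e. -/
theorem exists_pow_dvd_of_sum {A : Type*} [AddCommGroup A] [IsAddTorsionFree A]
    {B : Type*} [AddCommGroup B] [IsAddTorsionFree B] {ι : Type*} [Fintype ι]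
    (p : ℕ) [hp : Fact p.Prime] {e : ℕ} {g : A} (hg : g ≠ 0) (f : B →+ A)
    (c t : ι → B) (k s r : ι → ℤ) (hc : ∀ j, f (c j) = k j • g) (hs : ∀ j, s j ≠ 0)
    (ht : ∀ j, s j • t j = r j • c j) (hsum : p ^ e • ∑ j, f (t j) = g) :
    ∃ j, k j ≠ 0 ∧ ∃ b, p ^ e • b = c j := by
  have hpp := Nat.prime_iff_prime_int.1 hp.out
  obtain ⟨n, hn, z, hz⟩ := exists_int_clear_denom fun j => (r j / s j : ℚ)
  have hnt : ∀ j, n • t j = z j • c j := fun j =>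
    zsmul_eq_of_ratio (hs j) (ht j) (by
      have : (s j : ℚ) ≠ 0 := by exact_mod_cast hs j
      field_simp) (hz j)
  have hnsum : n = (p : ℤ) ^ e * ∑ j, z j * k j := by
    have h1 : n • g = ((p : ℤ) ^ e * ∑ j, z j * k j) • g := by
      conv_lhs => rw [← hsum]
      rw [smul_comm, Finset.smul_sum, mul_smul, Finset.sum_smul, ← natCast_zsmul, Nat.cast_pow]
      congr 1
      refine Finset.sum_congr rfl fun j _ => ?_
      rw [← map_zsmul, hnt, map_zsmul, hc, mul_smul]
    have h2 : (n - (p : ℤ) ^ e * ∑ j, z j * k j) • g = 0 := by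
      rw [sub_smul, ← h1, _root_.sub_self]
    exact sub_eq_zero.1 ((smul_eq_zero.1 h2).resolve_right hg)
  have hfin : ∀ m : ℤ, m ≠ 0 → FiniteMultiplicity (p : ℤ) m := fun m hm =>
    FiniteMultiplicity.of_prime_left hpp hm
  obtain ⟨n', hn', hpn'⟩ := (hfin n hn).exists_eq_pow_mul_and_not_dvd
  set v := multiplicity (p : ℤ) n
  have hndvd : ¬ (p : ℤ) ^ (v + 1) ∣ n := (hfin n hn).not_pow_dvd_of_multiplicity_lt
    (Nat.lt_succ_self v)
  -- The denominators are cleared by n, so v, the valuation of n, takes the place of 0 in comparing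
  -- valuations.
  obtain ⟨j, hj⟩ : ∃ j, ¬ (p : ℤ) ^ (v + 1) ∣ (p : ℤ) ^ e * (z j * k j) := by
    by_contra! hcon
    refine hndvd ?_
    rw [hnsum, Finset.mul_sum]
    exact Finset.dvd_sum fun j _ => hcon j
  have hzk : z j * k j ≠ 0 := fun h => hj (by rw [h, mul_zero]; exact dvd_zero _)
  obtain ⟨z', hz', hpz'⟩ := (hfin (z j) (left_ne_zero_of_mul hzk)).exists_eq_pow_mul_and_not_dvd
  set a := multiplicity (p : ℤ) (z j)
  have hae : a + e ≤ v := by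
    by_contra hcon
    refine hj (dvd_trans (pow_dvd_pow _ (show v + 1 ≤ e + a by omega)) ?_)
    rw [hz', pow_add, mul_assoc]
    exact mul_dvd_mul_left _ (dvd_mul_right _ _)
  refine ⟨j, right_ne_zero_of_mul hzk, ?_⟩
  have h1 : ((p : ℤ) ^ e * ((p : ℤ) ^ (v - a - e) * n')) • t j = z' • c j := by
    apply zsmul_right_injective (pow_ne_zero a hpp.ne_zero)
    change (p : ℤ) ^ a • _ = (p : ℤ) ^ a • _
    rw [← mul_smul, ← mul_smul, ← hz', ← hnt j]
    congr 1
    conv_rhs => rw [hn']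
    rw [← mul_assoc, ← mul_assoc, ← pow_add, ← pow_add]
    congr 2
    omega
  have hcop : IsCoprime ((p : ℤ) ^ e) z' :=
    ((Prime.coprime_iff_not_dvd hpp).2 hpz').pow_left
  obtain ⟨x, y, hxy⟩ := hcop
  refine ⟨x • c j + y • ((p : ℤ) ^ (v - a - e) * n') • t j, ?_⟩
  have h2 : c j = (x * (p : ℤ) ^ e + y * z') • c j := by rw [hxy, one_smul]
  conv_rhs => rw [h2, add_smul, mul_smul y, ← h1]
  rw [← natCast_zsmul, Nat.cast_pow]
  module

/-- Roots of g = h - x lift to kernel elements, and their rank-one decomposition modulo the part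
supported in X transfers divisibility to finitely many `c j`. The sum of the coordinates of `c j`
outside H and g is congruent modulo H to an integer multiple of h, with heights no smaller than
those of `c j`. -/
theorem isControlled_of_isB₂Chain (hA : IsB₂Chain τ A L) {H : AddSubgroup G}
    (hHp : ∀ (n : ℤ) (x : G), n ≠ 0 → n • x ∈ H → x ∈ H)
    (hM : IsChainClosed τ A L (kerSupported (H : Set G))) : IsControlled H := by
  classical
  intro h
  obtain ⟨N, hNc, hhN, hM', hNp, hNz⟩ := exists_countable_extension hA hM h
  set X : Set G := (H : Set G) ∪ N with hX
  have hHpc : ∀ y ∈ H, pureClosure y ≤ H := by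
    rintro y hy x ⟨n, k, hn, hx⟩
    exact hHp n x hn (hx ▸ zsmul_mem hy k)
  refine ⟨{k | k ∈ N ∧ ∃ l : ℕ, l ≠ 0 ∧ l • h - k ∈ H}, hNc.mono fun k hk => hk.1,
    fun k hk => hk.2, fun x hx => ?_⟩
  set g := h - x with hg
  by_cases hgN : g ∈ N
  · exact TypeBounded.of_mem (TypeLE.refl _) ⟨hgN, 1, one_ne_zero, by simpa [hg] using hx⟩
  -- Here h itself lies in H, so 0 is an admissible bounding element.
  by_cases hgH : g ∈ H
  · refine TypeBounded.of_mem (w := (0 : G)) (TypeLE.of_le (by simp))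
      ⟨zero_mem _, 1, one_ne_zero, ?_⟩
    simpa [hg] using add_mem hgH hx
  have hg0 : g ≠ 0 := fun h => hgH (h ▸ zero_mem _)
  have hgX : g ∉ X := fun h => h.elim hgH hgN
  -- elements of the kernel with one prescribed coordinate outside `X`
  have hker : ∀ u ∈ pureClosure g, ∀ z ∈ N, ∀ y ∈ H, u = z + y → ∃ b : (proj G).ker,
      b.1.1 g = u ∧ ∀ g', g' ≠ g → g' ∉ X → b.1.1 g' = 0 := by
    intro u hu z hz y hy huz
    refine ⟨⟨single g u hu - single z z (self_mem_pureClosure z) -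
      single y y (self_mem_pureClosure y), ?_⟩, ?_, fun g' hg' hg'X => ?_⟩
    · rw [AddMonoidHom.mem_ker, map_sub, map_sub, proj_single, proj_single, proj_single, huz]
      abel
    · change (Finsupp.single g u - Finsupp.single z z - Finsupp.single y y : G →₀ G) g = u
      rw [Finsupp.sub_apply, Finsupp.sub_apply, Finsupp.single_eq_same,
        Finsupp.single_eq_of_ne (fun h : g = z => hgN (h ▸ hz)),
        Finsupp.single_eq_of_ne (fun h : g = y => hgH (h ▸ hy)), _root_.sub_zero, _root_.sub_zero]
    · change (Finsupp.single g u - Finsupp.single z z - Finsupp.single y y : G →₀ G) g' = 0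
      rw [Finsupp.sub_apply, Finsupp.sub_apply, Finsupp.single_eq_of_ne hg',
        Finsupp.single_eq_of_ne (fun h : g' = z => hg'X (Or.inr (h.symm ▸ hz))),
        Finsupp.single_eq_of_ne (fun h : g' = y => hg'X (Or.inl (h.symm ▸ hy))), _root_.sub_zero,
        _root_.sub_zero]
  -- This is the relation g - h - (-x) = 0; outside X it has only the coordinate g.
  obtain ⟨b, hbg, hbX⟩ := hker g (self_mem_pureClosure g) h hhN (-x) (neg_mem hx)
    (by rw [hg]; abel)
  obtain ⟨ι, _, c₀, hc₀, hdec⟩ := hA.exists_rankOne_decomposition hM' b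
  choose n k hn hnk using hc₀
  let ev : (proj G).ker →+ G :=
    (Finsupp.applyAddHom g).comp ((rankOneSum G).subtype.comp (proj G).ker.subtype)
  have hev : ∀ b : (proj G).ker, ev b = b.1.1 g := fun b => rfl
  have hevM : ∀ m ∈ kerSupported X, ev m = 0 := fun m hm => hm g hgX
  let c : ι → (proj G).ker := fun j => n j • c₀ j
  have hcg : ∀ j, ev (c j) = k j • g := by
    intro j
    have h1 := hevM _ (hnk j)
    rw [map_sub, map_zsmul ev (k j), hev b, hbg, sub_eq_zero] at h1
    exact h1
  have hcX : ∀ j g', g' ≠ g → g' ∉ X → (c j).1.1 g' = 0 := by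
    intro j g' hg' hg'X
    have h1 : (c j).1.1 g' - k j • b.1.1 g' = 0 := hnk j g' hg'X
    rwa [hbX g' hg' hg'X, smul_zero, _root_.sub_zero] at h1
  -- the part of an element of the kernel that is supported outside `H` and `g`
  let F : (proj G).ker →+ G := (Finsupp.liftAddHom fun y : G =>
    if y ∈ H ∨ y = g then (0 : G →+ G) else AddMonoidHom.id G).comp
      ((rankOneSum G).subtype.comp (proj G).ker.subtype)
  have hF : ∀ b, F b = ∑ y ∈ b.1.1.support, if y ∈ H ∨ y = g then 0 else b.1.1 y := by
    intro b
    change (b.1.1.sum fun y z =>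
      (if y ∈ H ∨ y = g then (0 : G →+ G) else AddMonoidHom.id G) z) = _
    refine Finset.sum_congr rfl fun y _ => ?_
    change (if y ∈ H ∨ y = g then (0 : G →+ G) else AddMonoidHom.id G) (b.1.1 y) = _
    split_ifs <;> rfl
  have hFN : ∀ j, F (c j) ∈ N := by
    intro j
    rw [hF]
    refine sum_mem fun y _ => ?_
    split_ifs with hy
    · exact zero_mem _
    · push Not at hy
      by_cases hyX : y ∈ X
      · exact hNp y (hyX.resolve_left hy.1) ((c j).1.2 y)
      · rw [hcX j y hy.2 hyX]
        exact zero_mem _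
  have hFsum : ∀ b : (proj G).ker, F b + ev b ∈ H := by
    intro b
    have h1 : proj G b.1 = 0 := b.2
    rw [proj_apply, Finsupp.sum] at h1
    have h2 : ev b = ∑ y ∈ b.1.1.support, if y = g then b.1.1 y else 0 := by
      rw [Finset.sum_ite_eq', hev]
      split_ifs with hs
      · rfl
      · exact Finsupp.notMem_support_iff.1 hs
    have h3 : F b + ev b = -∑ y ∈ b.1.1.support, if y ∈ H then b.1.1 y else 0 := by
      rw [eq_neg_iff_add_eq_zero, hF, h2, ← Finset.sum_add_distrib, ← Finset.sum_add_distrib]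
      refine Eq.trans (Finset.sum_congr rfl fun y _ => ?_) h1
      by_cases hyH : y ∈ H
      · have : y ≠ g := fun h => hgH (h ▸ hyH)
        simp [hyH, this]
      · by_cases hyg : y = g
        · subst hyg
          simp [hgH]
        · simp [hyH, hyg]
    rw [h3]
    refine neg_mem (sum_mem fun y _ => ?_)
    split_ifs with hy
    · exact hHpc y hy (b.1.2 y)
    · exact zero_mem _
  -- The sign makes the multiplier of h the natural number |k j|, as `IsControlled` requires.
  let w : ι → G := fun j => if 0 < k j then -F (c j) else F (c j)
  have hwchar : ∀ j, characteristic (c j) ≤ characteristic (w j) := by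
    intro j
    simp only [w]
    split_ifs
    · rw [characteristic_neg]
      exact characteristic_le_map F _
    · exact characteristic_le_map F _
  have hwK : ∀ j, k j ≠ 0 → w j ∈ {k | k ∈ N ∧ ∃ l : ℕ, l ≠ 0 ∧ l • h - k ∈ H} := by
    intro j hkj
    have h1 : F (c j) + k j • h ∈ H := by
      have h2 := add_mem (hFsum (c j)) (zsmul_mem hx (k j))
      rw [hcg j] at h2
      have h3 : F (c j) + k j • h = F (c j) + k j • g + k j • x := by
        rw [hg, smul_sub]; abel
      rwa [h3]
    refine ⟨?_, (k j).natAbs, Int.natAbs_ne_zero.2 hkj, ?_⟩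
    · simp only [w]
      split_ifs
      · exact neg_mem (hFN j)
      · exact hFN j
    · simp only [w]
      rw [← natCast_zsmul]
      split_ifs with hpos
      · rw [Int.natAbs_of_nonneg hpos.le]
        have : k j • h - -F (c j) = F (c j) + k j • h := by abel
        rwa [this]
      · rw [Int.ofNat_natAbs_of_nonpos (not_lt.1 hpos)]
        have : -k j • h - F (c j) = -(F (c j) + k j • h) := by rw [neg_smul]; abel
        rw [this]
        exact neg_mem h1
  refine ⟨(Finset.univ.filter fun j => k j ≠ 0).image w, ?_, TypeLE.of_le fun p => ?_⟩
  · intro y hy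
    obtain ⟨j, hj, rfl⟩ := Finset.mem_image.1 (Finset.mem_coe.1 hy)
    exact hwK j (Finset.mem_filter.1 hj).2
  refine characteristic_le_iff.2 fun e he => ?_
  obtain ⟨g', hg'⟩ := he
  have hpe : (p : ℕ) ^ e ≠ 0 := pow_ne_zero e p.2.ne_zero
  -- A root g' of g gives a root of h modulo H, so some z ∈ N serves too, and purity puts g' - z in
  -- H. The resulting relation b' satisfies p^e b' ≡ b modulo elements supported in X.
  obtain ⟨z, hzN, hz⟩ := hNz ((p : ℕ) ^ e) ⟨g', by rw [hg', hg]; simpa using hx⟩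
  have hgz : g' - z ∈ H := by
    refine hHp ((p : ℕ) ^ e : ℕ) _ (by exact_mod_cast hpe) ?_
    have : (((p : ℕ) ^ e : ℕ) : ℤ) • (g' - z) = -x - ((p : ℕ) ^ e • z - h) := by
      rw [natCast_zsmul, smul_sub, hg', hg]; abel
    rw [this]
    exact sub_mem (neg_mem hx) hz
  obtain ⟨b', hb'g, hb'X⟩ := hker g' (nsmul_mem_pureClosure hpe (hg' ▸ self_mem_pureClosure g))
    z hzN (g' - z) hgz (by abel)
  obtain ⟨t, ht, htc⟩ := hdec b' ((p : ℕ) ^ e : ℕ) 1 (by exact_mod_cast hpe) (by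
    intro y hy
    change (((p : ℕ) ^ e : ℕ) : ℤ) • b'.1.1 y - (1 : ℤ) • b.1.1 y = 0
    by_cases hyg : y = g
    · subst hyg
      rw [hb'g, hbg, natCast_zsmul, hg', one_smul, _root_.sub_self]
    · rw [hb'X y hyg hy, hbX y hyg hy, smul_zero, smul_zero, _root_.sub_zero])
  choose s r hs hsr using htc
  have : Fact (p : ℕ).Prime := ⟨p.2⟩
  obtain ⟨j, hkj, d, hd⟩ := exists_pow_dvd_of_sum (p : ℕ) hg0 ev c t k
    (fun j => s j * n j) r hcg (fun j => mul_ne_zero (hs j) (hn j))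
    (fun j => by
      simp only [c]
      rw [mul_comm, mul_smul, hsr, smul_comm]) (by
      have h1 := hevM _ ht
      rw [map_sub, sub_eq_zero, map_sum] at h1
      rw [← h1, hev, hb'g, hg'])
  have h1 : (e : ℕ∞) ≤ characteristic (w j) p :=
    (natCast_le_characteristic_iff.2 ⟨d, hd⟩).trans (hwchar j p)
  refine h1.trans ?_
  have h2 : characteristic (w j) ≤
      ((Finset.univ.filter fun j => k j ≠ 0).image w).sup characteristic :=
    Finset.le_sup (f := characteristic) (Finset.mem_image_of_mem w (by simpa using hkj))
  exact h2 p

theorem exists_closure_of_isB₂Group_ker (h : IsB₂Group (proj G).ker) :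
    ∃ Φ : Finset G → Set G, (∀ s, (Φ s).Countable) ∧ ∀ H : AddSubgroup G,
      (∀ (n : ℤ) (x : G), n ≠ 0 → n • x ∈ H → x ∈ H) →
      (∀ s : Finset G, (s : Set G) ⊆ H → Φ s ⊆ H) → IsControlled H := by
  obtain ⟨τ, A, L, hA⟩ := h.exists_isB₂Chain
  obtain ⟨Φ, hΦ, hcl⟩ := isChainClosed_kerSupported hA
  exact ⟨Φ, hΦ, fun H hHp hH => isControlled_of_isB₂Chain hA hHp (hcl H hH)⟩

end rankOneSum

/-! ### The group attached to a labelling of vertices by functions on the primes -/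

/-- The additive group of the integers localized at `p`. -/
def integralAt (p : Nat.Primes) : AddSubgroup ℚ where
  carrier := {q | ∃ n : ℤ, ¬ ((p : ℕ) : ℤ) ∣ n ∧ ∃ m : ℤ, n * q = m}
  zero_mem' := ⟨1, fun h => (Nat.prime_iff_prime_int.1 p.2).not_dvd_one h, 0, by simp⟩
  add_mem' := by
    rintro a b ⟨n, hn, m, h⟩ ⟨n', hn', m', h'⟩
    refine ⟨n * n', fun hd => ((Nat.prime_iff_prime_int.1 p.2).dvd_or_dvd hd).elim hn hn',
      n' * m + n * m', ?_⟩
    push_cast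
    rw [← h, ← h']
    ring
  neg_mem' := by
    rintro a ⟨n, hn, m, h⟩
    exact ⟨n, hn, -m, by push_cast; rw [← h]; ring⟩

theorem intCast_mem_integralAt (p : Nat.Primes) (m : ℤ) : (m : ℚ) ∈ integralAt p :=
  ⟨1, fun h => (Nat.prime_iff_prime_int.1 p.2).not_dvd_one h, m, by simp⟩

theorem one_mem_integralAt (p : Nat.Primes) : (1 : ℚ) ∈ integralAt p := by
  simpa using intCast_mem_integralAt p 1

theorem inv_mem_integralAt {p q : Nat.Primes} (h : p ≠ q) : ((p : ℕ) : ℚ)⁻¹ ∈ integralAt q := by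
  refine ⟨(p : ℕ), fun hd => h ?_, 1, ?_⟩
  · rw [Int.natCast_dvd_natCast] at hd
    exact (Subtype.ext ((Nat.prime_dvd_prime_iff_eq q.2 p.2).1 hd)).symm
  · have : ((p : ℕ) : ℚ) ≠ 0 := by exact_mod_cast p.2.ne_zero
    rw [Int.cast_natCast, mul_inv_cancel₀ this, Int.cast_one]

theorem dvd_of_mem_integralAt {p : Nat.Primes} {l : ℤ} {q : ℚ} (hq : q ∈ integralAt p)
    (h : ((p : ℕ) : ℚ) * q = l) : ((p : ℕ) : ℤ) ∣ l := by
  obtain ⟨n, hn, m, hm⟩ := hq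
  have h1 : n * l = ((p : ℕ) : ℤ) * m := by
    have : (n * l : ℚ) = ((p : ℕ) : ℚ) * m := by rw [← h, ← hm]; ring
    exact_mod_cast this
  exact ((Nat.prime_iff_prime_int.1 p.2).dvd_or_dvd ⟨m, h1⟩).resolve_left hn

section LabelledGroup

variable {V Λ : Type} (lab : V → Nat.Primes → Option Λ)

open Classical in
/-- The sum of the coordinates of `w` at the vertices that have label `ν` at the prime `p`. -/
noncomputable def classSum (p : Nat.Primes) (ν : Λ) : (V →₀ ℚ) →+ ℚ :=
  Finsupp.liftAddHom fun v => if lab v p = some ν then AddMonoidHom.id ℚ else 0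

open Classical in
theorem classSum_apply (p : Nat.Primes) (ν : Λ) (w : V →₀ ℚ) :
    classSum lab p ν w = ∑ v ∈ w.support, if lab v p = some ν then w v else 0 := by
  change (w.sum fun v q => (if lab v p = some ν then AddMonoidHom.id ℚ else 0) q) = _
  refine Finset.sum_congr rfl fun v _ => ?_
  change (if lab v p = some ν then AddMonoidHom.id ℚ else 0) (w v) = _
  split_ifs <;> rfl

open Classical in
theorem classSum_single (p : Nat.Primes) (ν : Λ) (v : V) (q : ℚ) :
    classSum lab p ν (Finsupp.single v q) = if lab v p = some ν then q else 0 := by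
  rw [classSum, Finsupp.liftAddHom_apply_single]
  split_ifs <;> rfl

/-- The group of rational combinations of vertices which, locally at each prime `p`, are integral
at unlabelled vertices and have integral sum over each set of equally labelled vertices. -/
noncomputable def labelledGroup : AddSubgroup (V →₀ ℚ) where
  carrier := {w | ∀ p, (∀ v, lab v p = none → w v ∈ integralAt p) ∧
    ∀ ν, classSum lab p ν w ∈ integralAt p}
  zero_mem' := fun p => ⟨fun v _ => zero_mem _, fun ν => by rw [map_zero]; exact zero_mem _⟩
  add_mem' := fun ha hb p => ⟨fun v hv => add_mem ((ha p).1 v hv) ((hb p).1 v hv),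
    fun ν => by rw [map_add]; exact add_mem ((ha p).2 ν) ((hb p).2 ν)⟩
  neg_mem' := fun ha p => ⟨fun v hv => neg_mem ((ha p).1 v hv),
    fun ν => by rw [map_neg]; exact neg_mem ((ha p).2 ν)⟩

/-- The primes at which `u` and `v` carry the same label. -/
def agreement (u v : V) : Set Nat.Primes := {p | lab u p = lab v p ∧ lab v p ≠ none}

namespace labelledGroup

/-- A vertex as an element of the group. -/
noncomputable def vertex (v : V) : labelledGroup lab :=
  ⟨Finsupp.single v 1, fun p => ⟨fun u _ => by
    classical
    rw [Finsupp.single_apply]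
    split_ifs
    · exact one_mem_integralAt p
    · exact zero_mem _, fun ν => by
    rw [classSum_single]
    split_ifs
    · exact one_mem_integralAt p
    · exact zero_mem _⟩⟩

theorem coe_vertex (v : V) : (vertex lab v : V →₀ ℚ) = Finsupp.single v 1 := rfl

/-- The quotient (v - u)/p is integral: at p its two coordinates cancel in their common label class,
and at other primes 1/p is integral. -/
theorem one_le_characteristic_vertex_sub {u v : V} {p : Nat.Primes} (h : p ∈ agreement lab u v) :
    1 ≤ characteristic (vertex lab v - vertex lab u) p := by
  have hp : ((p : ℕ) : ℚ) ≠ 0 := by exact_mod_cast p.2.ne_zero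
  rw [← Nat.cast_one, natCast_le_characteristic_iff]
  refine ⟨⟨Finsupp.single v ((p : ℕ) : ℚ)⁻¹ - Finsupp.single u ((p : ℕ) : ℚ)⁻¹, fun q =>
    ⟨fun x hx => ?_, fun ν => ?_⟩⟩, ?_⟩
  · classical
    rw [Finsupp.sub_apply, Finsupp.single_apply, Finsupp.single_apply]
    by_cases hpq : p = q
    · subst hpq
      rw [if_neg, if_neg, _root_.sub_zero]
      · exact zero_mem _
      · rintro rfl
        exact h.2 (h.1 ▸ hx)
      · rintro rfl
        exact h.2 hx
    · refine sub_mem ?_ ?_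
      all_goals
        split_ifs
        · exact inv_mem_integralAt hpq
        · exact zero_mem _
  · rw [map_sub, classSum_single, classSum_single]
    by_cases hpq : p = q
    · subst hpq
      rw [h.1, _root_.sub_self]
      exact zero_mem _
    · refine sub_mem ?_ ?_
      all_goals
        split_ifs
        · exact inv_mem_integralAt hpq
        · exact zero_mem _
  · ext1
    change (p : ℕ) ^ 1 • (Finsupp.single v ((p : ℕ) : ℚ)⁻¹ - Finsupp.single u ((p : ℕ) : ℚ)⁻¹) =
      Finsupp.single v 1 - Finsupp.single u 1
    rw [pow_one, smul_sub, Finsupp.smul_single, Finsupp.smul_single, _root_.nsmul_eq_mul,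
      mul_inv_cancel₀ hp]

/-- If no other support vertex shared the label of v at p, the class sum of w/p would be the single
coordinate l/p, which is not p-integral. -/
theorem exists_mem_agreement {w : labelledGroup lab} {v : V} {l : ℤ} (hl : w.1 v = l)
    {p : Nat.Primes} (hpl : ¬ ((p : ℕ) : ℤ) ∣ l) (hp : 1 ≤ characteristic w p) :
    ∃ u, u ≠ v ∧ w.1 u ≠ 0 ∧ p ∈ agreement lab u v := by
  classical
  rw [← Nat.cast_one, natCast_le_characteristic_iff] at hp
  obtain ⟨w', hw'⟩ := hp
  rw [pow_one] at hw'
  have hcoord : ∀ u, ((p : ℕ) : ℚ) * w'.1 u = w.1 u := by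
    intro u
    rw [← hw', ← _root_.nsmul_eq_mul]
    rfl
  have hnot : w'.1 v ∉ integralAt p := fun h =>
    hpl (dvd_of_mem_integralAt h ((hcoord v).trans hl))
  obtain ⟨ν, hν⟩ : ∃ ν, lab v p = some ν := by
    rw [← Option.ne_none_iff_exists']
    exact fun h => hnot ((w'.2 p).1 v h)
  by_contra! hcon
  have h1 : classSum lab p ν w'.1 = w'.1 v := by
    rw [classSum_apply]
    refine (Finset.sum_eq_single v ?_ ?_).trans (if_pos hν)
    · intro u _ huv
      split_ifs with hu
      · have hu0 : w.1 u = 0 := by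
          by_contra hne
          exact hcon u huv hne ⟨hu.trans hν.symm, by simp [hν]⟩
        have := hcoord u
        rw [hu0] at this
        exact (mul_eq_zero.1 this).resolve_left (by exact_mod_cast p.2.ne_zero)
      · rfl
    · intro hv
      rw [if_pos hν]
      exact Finsupp.notMem_support_iff.1 hv
  exact hnot (h1 ▸ (w'.2 p).2 ν)

/-- The elements of the group whose support lies in `X`. -/
def supported (X : Set V) : AddSubgroup (labelledGroup lab) where
  carrier := {w | ∀ v, v ∉ X → w.1 v = 0}
  zero_mem' := fun _ _ => rfl
  add_mem' := fun {a b} ha hb v hv => by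
    change a.1 v + b.1 v = 0
    rw [ha v hv, hb v hv, add_zero]
  neg_mem' := fun {a} ha v hv => by
    change -(a.1 v) = 0
    rw [ha v hv, neg_zero]

theorem mem_supported_of_zsmul {X : Set V} (n : ℤ) (w : labelledGroup lab) (hn : n ≠ 0)
    (h : n • w ∈ supported lab X) : w ∈ supported lab X := by
  intro v hv
  have h1 : n • w.1 v = 0 := h v hv
  exact (smul_eq_zero.1 h1).resolve_left hn

theorem vertex_mem_supported {X : Set V} {v : V} (hv : v ∈ X) : vertex lab v ∈ supported lab X := by
  intro u hu
  rw [coe_vertex]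
  exact Finsupp.single_eq_of_ne fun h : u = v => hu (h ▸ hv)

theorem mk_eq [Infinite V] : #(labelledGroup lab) = #V := by
  refine le_antisymm ?_ ?_
  · calc #(labelledGroup lab) ≤ #(V →₀ ℚ) := Cardinal.mk_subtype_le _
      _ = #V := by simp
  · refine Cardinal.mk_le_of_injective (f := vertex lab) fun u v huv => ?_
    have := congrArg Subtype.val huv
    rw [coe_vertex, coe_vertex] at this
    exact (Finsupp.single_left_inj one_ne_zero).1 this

instance : IsAddTorsionFree (labelledGroup lab) := by
  refine ⟨fun n hn x y hxy => ?_⟩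
  ext v
  apply nsmul_right_injective hn
  have := congrArg (fun c : labelledGroup lab => c.1 v) hxy
  simpa using this

end labelledGroup

/-- There are arbitrarily closed sets `X` of vertices with a vertex `v ∉ X` whose agreement sets
with the elements of `X` are not covered by those from a countable subset of `X`. -/
def HasUncoveredVertices : Prop :=
  ∀ Ψ : Finset V → Set V, (∀ s, (Ψ s).Countable) →
    ∃ X : Set V, (∀ s : Finset V, (s : Set V) ⊆ X → Ψ s ⊆ X) ∧ ∃ v ∉ X,
      ∀ K ⊆ X, K.Countable → ∃ u ∈ X, ∀ T : Finset V, (T : Set V) ⊆ K →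
        (agreement lab u v \ ⋃ w ∈ T, agreement lab w v).Infinite

namespace labelledGroup

/-- A bounding element k has support in X apart from its coordinate l_k at v. Outside finitely many
primes, divisibility of v - u forces divisibility of some k in a finite T, hence an agreement of v
with a vertex of X in the support of k. These supports give a countable set that would cover too
much. -/
theorem not_isControlled_supported {X : Set V} {v : V} (hv : v ∉ X)
    (h : ∀ K ⊆ X, K.Countable → ∃ u ∈ X, ∀ T : Finset V, (T : Set V) ⊆ K →
        (agreement lab u v \ ⋃ w ∈ T, agreement lab w v).Infinite) :
    ¬ IsControlled (supported lab X) := by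
  classical
  intro hctrl
  obtain ⟨K, hKc, hKX, hK⟩ := hctrl (vertex lab v)
  obtain ⟨u, huX, hu⟩ := h ((⋃ k ∈ K, (k.1.support : Set V)) ∩ X) Set.inter_subset_right
    ((hKc.biUnion fun k _ => k.1.support.countable_toSet).mono Set.inter_subset_left)
  obtain ⟨T, hTK, hT⟩ := hK _ (vertex_mem_supported lab huX)
  choose! l hl hlk using hKX
  have hcoord : ∀ k ∈ K, ∀ x, x ∉ X → k.1 x = if x = v then ((l k : ℤ) : ℚ) else 0 := by
    intro k hk x hx
    have h1 : l k • (Finsupp.single v (1 : ℚ) : V →₀ ℚ) x - k.1 x = 0 := hlk k hk x hx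
    rw [← sub_eq_zero.1 h1, Finsupp.single_apply, _root_.nsmul_eq_mul]
    by_cases hxv : x = v
    · simp [hxv]
    · simp [hxv, Ne.symm hxv]
  refine (hu ((T.biUnion fun k => k.1.support).filter (· ∈ X)) ?_) ?_
  · intro x hx
    rw [Finset.mem_coe, Finset.mem_filter, Finset.mem_biUnion] at hx
    obtain ⟨⟨k, hk, hxk⟩, hxX⟩ := hx
    exact ⟨Set.mem_biUnion (hTK hk) hxk, hxX⟩
  -- The excluded primes are those where the comparison of types fails and those dividing some l_k.
  · have hfin : ∀ k ∈ T, {p : Nat.Primes | ((p : ℕ) : ℤ) ∣ l k}.Finite := by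
      intro k hk
      refine Set.Finite.subset (Set.Finite.preimage Subtype.val_injective.injOn
        (l k).primeFactors.finite_toSet) fun p hp => ?_
      exact Nat.mem_primeFactors.2 ⟨p.2, Int.natCast_dvd_natCast.1 hp, hl k (hTK hk)⟩
    refine (hT.1.union (T.finite_toSet.biUnion hfin)).subset fun p hp => ?_
    by_contra hcon
    rw [Set.mem_union, not_or, Set.mem_ofPred_eq, not_not] at hcon
    have h1 := (one_le_characteristic_vertex_sub lab hp.1).trans hcon.1
    rw [Finset.sup_apply, Finset.le_sup_iff (by simp)] at h1
    obtain ⟨k, hkT, hk⟩ := h1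
    have hkv := hcoord k (hTK hkT) v hv
    rw [if_pos rfl] at hkv
    obtain ⟨x, hxv, hx0, hx⟩ := exists_mem_agreement lab hkv
      (fun hd => hcon.2 (Set.mem_biUnion (Finset.mem_coe.2 hkT) hd)) hk
    have hxX : x ∈ X := by
      by_contra hxX
      have := hcoord k (hTK hkT) x hxX
      rw [if_neg hxv] at this
      exact hx0 this
    refine hp.2 (Set.mem_biUnion (Finset.mem_coe.2 (Finset.mem_filter.2
      ⟨Finset.mem_biUnion.2 ⟨k, hkT, Finsupp.mem_support_iff.2 hx0⟩, hxX⟩)) hx)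

/-- An operation on group elements becomes one on vertices by passing to supports; only countably
many group elements are supported on a given finite set. -/
theorem exists_not_isControlled (hlab : HasUncoveredVertices lab)
    (Φ : Finset (labelledGroup lab) → Set (labelledGroup lab)) (hΦ : ∀ s, (Φ s).Countable) :
    ∃ H : AddSubgroup (labelledGroup lab),
      (∀ (n : ℤ) (x : labelledGroup lab), n ≠ 0 → n • x ∈ H → x ∈ H) ∧
      (∀ s : Finset (labelledGroup lab), (s : Set (labelledGroup lab)) ⊆ H → Φ s ⊆ H) ∧
      ¬ IsControlled H := by
  classical
  let W : Finset V → Set (labelledGroup lab) := fun s => {w | (w.1.support : Set V) ⊆ s}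
  have hW : ∀ s, (W s).Countable := by
    intro s
    refine Set.MapsTo.countable_of_injOn (f := fun w (v : s) => w.1 v) (Set.mapsTo_univ _ _) ?_
      Set.countable_univ
    intro w hw w' hw' h
    ext v
    by_cases hv : v ∈ s
    · exact congrFun h ⟨v, hv⟩
    · rw [Finsupp.notMem_support_iff.1 fun h => hv (hw h),
        Finsupp.notMem_support_iff.1 fun h => hv (hw' h)]
  obtain ⟨X, hX, v, hv, h⟩ := hlab (fun s => ⋃ F ∈ {F : Finset (labelledGroup lab) |
      (F : Set (labelledGroup lab)) ⊆ W s}, ⋃ g ∈ Φ F, (g.1.support : Set V)) (fun s =>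
    (countable_setOf_finset_subset (hW s)).biUnion fun F _ =>
      (hΦ F).biUnion fun g _ => g.1.support.countable_toSet)
  refine ⟨supported lab X, mem_supported_of_zsmul lab, fun s hs g hg x hx => ?_,
    not_isControlled_supported lab hv h⟩
  by_contra hne
  refine hx (hX (s.biUnion fun w => w.1.support) ?_ ?_)
  · intro y hy
    rw [Finset.mem_coe, Finset.mem_biUnion] at hy
    obtain ⟨w, hw, hyw⟩ := hy
    by_contra hyX
    exact (Finsupp.mem_support_iff.1 hyw) (hs hw y hyX)
  · refine Set.mem_biUnion (x := s) ?_ (Set.mem_biUnion hg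
      (Finset.mem_coe.2 (Finsupp.mem_support_iff.2 hne)))
    intro w hw y hy
    exact Finset.mem_coe.2 (Finset.mem_biUnion.2 ⟨w, hw, hy⟩)

end labelledGroup

theorem exists_group_of_hasUncoveredVertices [Infinite V] (hlab : HasUncoveredVertices lab) :
    ∃ (G C : Type) (_ : AddCommGroup G) (_ : AddCommGroup C) (π : C →+ G),
      IsAddTorsionFree G ∧ #G = #V ∧ ¬ AdmitsAleph0PrebalancedChain G ∧
      IsBalancedProjectiveResolution π ∧ #C = #V ∧ #π.ker = #V ∧ ¬ IsB₂Group π.ker := by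
  have hcard := labelledGroup.mk_eq lab
  have : Infinite (labelledGroup lab) := by
    rw [Cardinal.infinite_iff, hcard, ← Cardinal.infinite_iff]
    infer_instance
  refine ⟨labelledGroup lab, rankOneSum (labelledGroup lab), inferInstance, inferInstance,
    rankOneSum.proj _, inferInstance, hcard, fun hchain => ?_,
    rankOneSum.isBalancedProjectiveResolution _, rankOneSum.mk_eq.trans hcard,
    rankOneSum.mk_ker_eq.trans hcard, fun hB₂ => ?_⟩
  · obtain ⟨Φ, hΦ, h⟩ := hchain.exists_closure
    obtain ⟨H, -, hH, hnot⟩ := labelledGroup.exists_not_isControlled lab hlab Φ hΦ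
    exact hnot (h H hH)
  · obtain ⟨Φ, hΦ, h⟩ := rankOneSum.exists_closure_of_isB₂Group_ker hB₂
    obtain ⟨H, hHp, hH, hnot⟩ := labelledGroup.exists_not_isControlled lab hlab Φ hΦ
    exact hnot (h H hHp hH)

end LabelledGroup

/-! ### Order types of finite unions of subsets of a well-order. -/

section OrderType

variable {α : Type*} [LinearOrder α] [WellFoundedLT α]

theorem typeLT_mono {A B : Set α} (h : A ⊆ B) : typeLT A ≤ typeLT B :=
  type_le_iff'.2 ⟨⟨⟨Set.inclusion h, Set.inclusion_injective h⟩, Iff.rfl⟩⟩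

theorem typeLT_inter_Iio_add (X : Set α) (x : α) :
    typeLT (X ∩ Set.Iio x : Set α) + typeLT (X ∩ Set.Ici x : Set α) = typeLT X := by
  classical
  rw [← type_sum_lex]
  refine Ordinal.type_eq.2 ⟨⟨⟨Sum.elim (fun y => ⟨y.1, y.2.1⟩) fun y => ⟨y.1, y.2.1⟩,
    fun y => if h : y.1 < x then .inl ⟨y.1, y.2, h⟩ else .inr ⟨y.1, y.2, not_lt.1 h⟩, ?_, ?_⟩, ?_⟩⟩
  · rintro (⟨y, hy, h⟩ | ⟨y, hy, h⟩)
    · have h' : y < x := h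
      simp [h']
    · have h' : ¬ y < x := not_lt.2 h
      simp [h']
  · rintro ⟨y, hy⟩
    by_cases h : y < x <;> simp [h]
  · rintro (⟨y, hy, h⟩ | ⟨y, hy, h⟩) (⟨z, hz, k⟩ | ⟨z, hz, k⟩)
    · exact Iff.symm (Sum.lex_inl_inl.trans Iff.rfl)
    · simpa using! lt_of_lt_of_le (show y < x from h) (show x ≤ z from k)
    · simpa using! (lt_of_lt_of_le (show z < x from k) (show x ≤ y from h)).le
    · exact Iff.symm (Sum.lex_inr_inr.trans Iff.rfl)

theorem exists_typeLT_inter_Iio {X : Set α} {o : Ordinal} (ho : o < typeLT X) :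
    ∃ x, typeLT (X ∩ Set.Iio x : Set α) = o := by
  obtain ⟨x, hx⟩ := typein_surj (α := X) (· < ·) ho
  refine ⟨x.1, ?_⟩
  rw [← hx, ← type_Iio_lt]
  exact Ordinal.type_eq.2 ⟨⟨⟨fun y => ⟨⟨y.1, y.2.1⟩, y.2.2⟩, fun y => ⟨y.1.1, y.1.2, y.2⟩,
    fun _ => rfl, fun _ => rfl⟩, Iff.rfl⟩⟩

theorem typeLT_union_le_mul {δ : Ordinal} (hδ : δ ≠ 0)
    (h : ∀ A B : Set α, typeLT A < δ → typeLT B < δ → typeLT (A ∪ B : Set α) < δ) (n m : ℕ) :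
    ∀ A B : Set α, typeLT A ≤ δ * n → typeLT B ≤ δ * m →
      typeLT (A ∪ B : Set α) ≤ δ * (n + m : ℕ) := by
  induction hk : n + m generalizing n m with
  | zero =>
    obtain ⟨rfl, rfl⟩ : n = 0 ∧ m = 0 := by omega
    intro A B hA hB
    simp only [Nat.cast_zero, mul_zero, nonpos_iff_eq_zero, type_eq_zero_iff_isEmpty,
      Set.isEmpty_coe_sort] at hA hB ⊢
    simp [hA, hB]
  | succ k ih =>
    -- Cut at the x below which A ∪ B has type exactly δ. One of A, B must have type at least δ
    -- there, so its bound loses one factor δ on the remaining final segment.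
    have key : ∀ (n m : ℕ) (A B : Set α) (x : α), n + m = k + 1 → typeLT A ≤ δ * n →
        typeLT B ≤ δ * m → typeLT ((A ∪ B) ∩ Set.Iio x : Set α) = δ →
        δ ≤ typeLT (A ∩ Set.Iio x : Set α) → typeLT (A ∪ B : Set α) ≤ δ * (k + 1 : ℕ) := by
      intro n m A B x hk hA hB hx hAx
      rcases n with _ | n
      · rw [Nat.cast_zero, mul_zero] at hA
        exact absurd ((hAx.trans (typeLT_mono Set.inter_subset_left)).trans hA)
          (by simpa using hδ)
      · rw [← typeLT_inter_Iio_add A x, Nat.add_comm, Nat.cast_add, Nat.cast_one, mul_one_add]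
          at hA
        have hA' : typeLT (A ∩ Set.Ici x : Set α) ≤ δ * n :=
          le_of_add_le_add_left ((add_le_add_left hAx _).trans hA)
        have := ih n m (by omega) (A ∩ Set.Ici x) (B ∩ Set.Ici x) hA'
          ((typeLT_mono Set.inter_subset_left).trans hB)
        rw [← typeLT_inter_Iio_add (A ∪ B) x, hx, Set.union_inter_distrib_right, Nat.add_comm,
          Nat.cast_add, Nat.cast_one, mul_one_add]
        exact add_le_add_right this _
    intro A B hA hB
    rcases le_or_gt (typeLT (A ∪ B : Set α)) δ with hle | hlt
    · exact hle.trans (Ordinal.le_mul_left _ (by positivity))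
    obtain ⟨x, hx⟩ := exists_typeLT_inter_Iio hlt
    by_cases hAx : δ ≤ typeLT (A ∩ Set.Iio x : Set α)
    · exact key n m A B x hk hA hB hx hAx
    · have hBx : δ ≤ typeLT (B ∩ Set.Iio x : Set α) := by
        by_contra hBx
        have := h _ _ (not_le.1 hAx) (not_le.1 hBx)
        rw [← Set.union_inter_distrib_right, hx] at this
        exact this.false
      rw [Set.union_comm] at hx ⊢
      exact key m n B A x (by omega) hB hA hx hBx

/-- Indecomposability concerns ordinal sums, whereas a union may interleave its parts. Induction on
ρ bridges this, the successor step being the count of blocks of type ω^ρ. -/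
theorem typeLT_union_lt_omega0_opow (ρ : Ordinal) :
    ∀ A B : Set α, typeLT A < ω ^ ρ → typeLT B < ω ^ ρ → typeLT (A ∪ B : Set α) < ω ^ ρ := by
  induction ρ using Ordinal.limitRecOn with
  | zero =>
    intro A B hA hB
    simp only [opow_zero, Order.lt_one_iff, type_eq_zero_iff_isEmpty,
      Set.isEmpty_coe_sort] at hA hB ⊢
    simp [hA, hB]
  | add_one ρ ih =>
    intro A B hA hB
    have hω : Order.IsSuccLimit ω := isSuccLimit_omega0
    rw [opow_add_one, lt_mul_iff_of_isSuccLimit hω] at hA hB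
    obtain ⟨a, ha, hA⟩ := hA
    obtain ⟨b, hb, hB⟩ := hB
    obtain ⟨n, rfl⟩ := lt_omega0.1 ha
    obtain ⟨m, rfl⟩ := lt_omega0.1 hb
    have hpos : 0 < ω ^ ρ := opow_pos _ omega0_pos
    refine (typeLT_union_le_mul hpos.ne' ih n m A B hA.le hB.le).trans_lt ?_
    rw [opow_add_one]
    exact mul_lt_mul_of_pos_left (natCast_lt_omega0 _) hpos
  | limit ρ hρ ih =>
    intro A B hA hB
    rw [lt_opow_of_isSuccLimit omega0_ne_zero hρ] at hA hB
    obtain ⟨a, ha, hA⟩ := hA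
    obtain ⟨b, hb, hB⟩ := hB
    refine (ih (max a b) (max_lt ha hb) A B
      (hA.trans_le (opow_le_opow_right omega0_pos (le_max_left _ _)))
      (hB.trans_le (opow_le_opow_right omega0_pos (le_max_right _ _)))).trans_le
      (opow_le_opow_right omega0_pos (max_lt ha hb).le)

theorem typeLT_union_lt {δ : Ordinal} (hδ : IsPrincipal (· + ·) δ) {A B : Set α}
    (hA : typeLT A < δ) (hB : typeLT B < δ) : typeLT (A ∪ B : Set α) < δ := by
  rcases isPrincipal_add_iff_zero_or_omega0_opow.1 hδ with rfl | ⟨ρ, rfl⟩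
  · exact absurd hA (by simp)
  · exact typeLT_union_lt_omega0_opow ρ A B hA hB

theorem typeLT_biUnion_finset_lt {δ : Ordinal} (hδ : IsPrincipal (· + ·) δ) (h0 : δ ≠ 0)
    {ι : Type*} (T : Finset ι) (A : ι → Set α) (hA : ∀ i ∈ T, typeLT (A i) < δ) :
    typeLT (⋃ i ∈ T, A i : Set α) < δ := by
  classical
  induction T using Finset.induction with
  | empty =>
    refine lt_of_eq_of_lt ?_ (pos_iff_ne_zero.2 h0)
    rw [type_eq_zero_iff_isEmpty]
    simp
  | insert i T hi ih =>
    rw [Finset.set_biUnion_insert]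
    exact typeLT_union_lt hδ (hA i (Finset.mem_insert_self _ _))
      (ih fun j hj => hA j (Finset.mem_insert_of_mem hj))

theorem typeLT_lt_of_finite {δ : Ordinal} (hδ : IsPrincipal (· + ·) δ) (h1 : 1 < δ)
    {A : Set α} (hA : A.Finite) : typeLT A < δ := by
  have : A = ⋃ a ∈ hA.toFinset, {a} := by simp
  rw [this]
  exact typeLT_biUnion_finset_lt hδ (zero_lt_one.trans h1).ne' _ _ fun a _ => by simpa using h1

end OrderType

/-! ### The labelling when the continuum is at least ℵ₂. -/

section IndependentFamily

open Classical in
/-- The trace of a set of natural numbers on `{0, …, n - 1}`. -/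
noncomputable def initialTrace (X : Set ℕ) (n : ℕ) : Finset ℕ :=
  (Finset.range n).filter (· ∈ X)

theorem eventually_initialTrace_ne {X Y : Set ℕ} (h : X ≠ Y) :
    ∀ᶠ n in Filter.atTop, initialTrace X n ≠ initialTrace Y n := by
  obtain ⟨k, hk⟩ : ∃ k, ¬ (k ∈ X ↔ k ∈ Y) := by
    by_contra! hne
    exact h (Set.ext hne)
  filter_upwards [Filter.eventually_gt_atTop k] with n hn heq
  have := Finset.ext_iff.1 heq k
  simp only [initialTrace, Finset.mem_filter, Finset.mem_range, hn, true_and] at this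
  exact hk this

theorem infinite_setOf_initialTrace_mem (X Y : Set ℕ) (T : Finset (Set ℕ)) (hX : X ∉ T)
    (hY : Y ∉ T) :
    {i : ℕ × Finset (Finset ℕ) | initialTrace X i.1 ∈ i.2 ∧ initialTrace Y i.1 ∈ i.2 ∧
      ∀ Z ∈ T, initialTrace Z i.1 ∉ i.2}.Infinite := by
  have h : ∀ᶠ n in Filter.atTop, ∀ Z ∈ T, initialTrace Z n ≠ initialTrace X n ∧
      initialTrace Z n ≠ initialTrace Y n := by
    rw [Filter.eventually_all_finset]
    intro Z hZ
    exact (eventually_initialTrace_ne fun h : Z = X => hX (h ▸ hZ)).and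
      (eventually_initialTrace_ne fun h : Z = Y => hY (h ▸ hZ))
  obtain ⟨N, hN⟩ := Filter.eventually_atTop.1 h
  refine Set.infinite_of_injOn_mapsTo
    (f := fun n => (n, {initialTrace X n, initialTrace Y n})) (s := Set.Ici N)
    (fun a _ b _ hab => (Prod.ext_iff.1 hab).1) (fun n hn => ?_) (Set.Ici_infinite N)
  refine ⟨by simp, by simp, fun Z hZ => ?_⟩
  simpa using hN n hn Z hZ

theorem exists_hasUncoveredVertices_of_aleph_two_le {V : Type} (h2 : ℵ_ 2 ≤ (𝔠 : Cardinal.{0}))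
    (hV : ℵ_ 2 ≤ #V) : ∃ lab : V → Nat.Primes → Option Unit, HasUncoveredVertices lab := by
  classical
  obtain ⟨J, hJ⟩ := le_mk_iff_exists_set.1 hV
  obtain ⟨c⟩ : #J ≤ #(Set ℕ) := by rw [hJ]; simpa using h2
  let d : V → Set ℕ := fun v => if h : v ∈ J then c ⟨v, h⟩ else ∅
  have hd : Set.InjOn d J := by
    intro v hv w hw h
    simp only [d, dif_pos hv, dif_pos hw] at h
    exact congrArg Subtype.val (c.injective h)
  -- Primes encode pairs (n, 𝓕), and a vertex is labelled where its trace on n belongs to 𝓕, so the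
  -- labelled sets of primes form an independent family.
  obtain ⟨e⟩ : Nonempty (ℕ × Finset (Finset ℕ) ≃ Nat.Primes) := nonempty_equiv_of_countable
  refine ⟨fun v p => if v ∈ J ∧ initialTrace (d v) (e.symm p).1 ∈ (e.symm p).2 then some ()
    else none, fun Ψ hΨ => ?_⟩
  have h12 : ℵ₁ < ℵ_ 2 := aleph_lt_aleph.2 one_lt_two
  obtain ⟨Γ, hΓJ, hΓ⟩ := le_mk_iff_exists_subset.1 (h12.le.trans hJ.ge)
  -- N has size ℵ₁: too small to contain the ℵ₂ vertices of J, yet containing Γ, which no countable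
  -- K exhausts.
  obtain ⟨N, hΓN, hN, hclosed⟩ := exists_closed_superset Ψ hΨ (aleph0_le_aleph 1) Γ hΓ.le
  obtain ⟨v, hvJ, hvN⟩ : ∃ v ∈ J, v ∉ N := by
    by_contra! h
    exact (h12.trans_le (hJ.ge.trans ((mk_le_mk_of_subset h).trans hN))).false
  refine ⟨N, hclosed, v, hvN, fun K hKN hK => ?_⟩
  obtain ⟨u, huΓ, huK⟩ : ∃ u ∈ Γ, u ∉ K := by
    by_contra! h
    exact (aleph0_lt_aleph_one.trans_le (hΓ.ge.trans
      ((mk_le_mk_of_subset h).trans (le_aleph0_iff_set_countable.2 hK)))).false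
  refine ⟨u, hΓN huΓ, fun T hTK => ?_⟩
  have hne : ∀ x ∈ J, x ∉ K → d x ∉ (T.filter (· ∈ J)).image d := by
    intro x hx hxK h
    obtain ⟨w, hw, hwx⟩ := Finset.mem_image.1 h
    rw [Finset.mem_filter] at hw
    exact hxK (hd hw.2 hx hwx ▸ hTK (Finset.mem_coe.2 hw.1))
  have hinf := infinite_setOf_initialTrace_mem (d u) (d v) _ (hne u (hΓJ huΓ) huK)
    (hne v hvJ fun h => hvN (hKN h))
  refine (hinf.image e.injective.injOn).mono ?_
  rintro _ ⟨i, ⟨hu, hv, hT⟩, rfl⟩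
  refine ⟨by simp [agreement, hΓJ huΓ, hvJ, hu, hv], fun h => ?_⟩
  simp only [Set.mem_iUnion, exists_prop] at h
  obtain ⟨w, hwT, hw⟩ := h
  have hw' : w ∈ J ∧ initialTrace (d w) i.1 ∈ i.2 := by
    by_contra hcon
    simp [agreement, hvJ, hv, hcon] at hw
  exact hT (d w) (Finset.mem_image_of_mem d (Finset.mem_filter.2 ⟨hwT, hw'.1⟩)) hw'.2

end IndependentFamily

/-- In a well-order of uncountable cofinality, the initial segments of a ranked set closed under
countably-valued operations on finite sets form a club. -/
theorem isClub_setOf_closed {V O : Type} [LinearOrder O] [WellFoundedLT O] [NoMaxOrder O]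
    (r : V → O) (hO : ℵ₀ < Order.cof O) (hr : ∀ a, #{v | r v < a} < Order.cof O)
    (Ψ : Finset V → Set V) (hΨ : ∀ s, (Ψ s).Countable) :
    IsClub {b | ∀ s : Finset V, (∀ v ∈ s, r v < b) → ∀ v ∈ Ψ s, r v < b} := by
  classical
  refine ⟨fun t ht hne _ x hx s hs v hv => ?_, fun a => ?_⟩
  · obtain ⟨b, hb, hsb⟩ : ∃ b ∈ t, ∀ v ∈ s, r v < b := by
      clear hv
      induction s using Finset.induction with
      | empty =>
        obtain ⟨b, hb⟩ := hne
        exact ⟨b, hb, by simp⟩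
      | insert w s _ ih =>
        obtain ⟨b, hb, hsb⟩ := ih fun v hv => hs v (Finset.mem_insert_of_mem hv)
        obtain ⟨c, hc, hwc⟩ := (lt_isLUB_iff hx).1 (hs w (Finset.mem_insert_self _ _))
        rcases le_total b c with h | h
        · refine ⟨c, hc, ?_⟩
          rw [Finset.forall_mem_insert]
          exact ⟨hwc, fun v hv => (hsb v hv).trans_le h⟩
        · refine ⟨b, hb, ?_⟩
          rw [Finset.forall_mem_insert]
          exact ⟨hwc.trans_le h, hsb⟩
    exact (ht hb s hsb v hv).trans_le (hx.1 hb)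
  · have hbdd : ∀ A : Set O, #A < Order.cof O → BddAbove A := fun A hA =>
      .of_not_isCofinal fun h => (Order.cof_le h).not_gt hA
    have step : ∀ a, ∃ b, a < b ∧
        ∀ s : Finset V, (∀ v ∈ s, r v < a) → ∀ v ∈ Ψ s, r v < b := by
      intro a
      -- The maximum with ℵ₀ covers segments with finitely many elements; both terms are below the
      -- cofinality, so the ranks in N are bounded.
      obtain ⟨N, haN, hN, hcl⟩ := exists_closed_superset Ψ hΨ
        (le_max_left ℵ₀ #{v | r v < a}) {v | r v < a} (le_max_right _ _)
      obtain ⟨b, hb⟩ := hbdd (r '' N) (mk_image_le.trans_lt (hN.trans_lt (max_lt hO (hr a))))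
      obtain ⟨c, hc⟩ := exists_gt (max a b)
      refine ⟨c, (le_max_left _ _).trans_lt hc, fun s hs v hv => ?_⟩
      exact (hb ⟨v, hcl s (fun w hw => haN (hs w hw)) hv, rfl⟩).trans_lt
        ((le_max_right _ _).trans_lt hc)
    choose g hg hgΨ using step
    have hB : BddAbove (Set.range fun n : ℕ => g^[n] a) :=
      hbdd _ ((le_aleph0_iff_set_countable.2 (Set.countable_range _)).trans_lt hO)
    obtain ⟨x, hx, hmin⟩ := WellFounded.has_min (wellFounded_lt (α := O)) _ hB
    have hx : IsLUB (Set.range fun n : ℕ => g^[n] a) x :=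
      ⟨hx, fun y hy => not_lt.1 (hmin y hy)⟩
    have hmono : Monotone fun n : ℕ => g^[n] a := monotone_nat_of_le_succ fun n => by
      rw [Function.iterate_succ_apply']
      exact (hg _).le
    refine ⟨x, fun s hs v hv => ?_, hx.1 ⟨0, rfl⟩⟩
    obtain ⟨n, hn⟩ : ∃ n : ℕ, ∀ v ∈ s, r v < g^[n] a := by
      clear hv
      induction s using Finset.induction with
      | empty => exact ⟨0, by simp⟩
      | insert w s _ ih =>
        obtain ⟨n, hn⟩ := ih fun v hv => hs v (Finset.mem_insert_of_mem hv)
        obtain ⟨_, ⟨m, rfl⟩, hm⟩ := (lt_isLUB_iff hx).1 (hs w (Finset.mem_insert_self _ _))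
        refine ⟨max n m, ?_⟩
        rw [Finset.forall_mem_insert]
        exact ⟨hm.trans_le (hmono (le_max_right _ _)),
          fun v hv => (hn v hv).trans_le (hmono (le_max_left _ _))⟩
    refine (hgΨ _ s hn v hv).trans_le ?_
    rw [← Function.iterate_succ_apply' g]
    exact hx.1 ⟨n + 1, rfl⟩

/-! ### Cardinality and cofinality of the index orders. -/

namespace BelowAlephOmegaSucc

theorem mk_eq : #BelowAlephOmegaSucc = ℵ_ (ω + 1) := by
  rw [mk_toType, card_omega]

theorem cof_eq : Order.cof BelowAlephOmegaSucc = ℵ_ (ω + 1) := by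
  rw [Ordinal.cof_toType, ← ord_aleph]
  exact (isRegular_aleph_add_one _).cof_ord

theorem mk_Iio_le (a : BelowAlephOmegaSucc) : #(Set.Iio a) ≤ ℵ_ ω := by
  have h := mk_Iio_lt a (by rw [mk_eq, ord_aleph, type_toType])
  rwa [mk_eq, ← succ_aleph, Order.lt_succ_iff] at h

instance : NoMaxOrder BelowAlephOmegaSucc := by
  have h := noMaxOrder (aleph0_le_aleph (ω + 1))
  rwa [ord_aleph] at h

end BelowAlephOmegaSucc

/-- A countable union of subsets cofinal below a point of uncountable cofinality has a cofinal
member. -/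
theorem IsCofinalBelow.exists_of_subset_iUnion {ι : Type} [Countable ι]
    {β : BelowAlephOmegaSucc} (hβ : ℵ₀ < Order.cof (Set.Iio β)) {D : Set BelowAlephOmegaSucc}
    (hD : IsCofinalBelow D β) (A : ι → Set BelowAlephOmegaSucc) (hA : D ⊆ ⋃ i, A i) :
    ∃ i, IsCofinalBelow (D ∩ A i) β := by
  obtain ⟨i, hi⟩ := isCofinal_of_isCofinal_iUnion (α := Set.Iio β)
    (s := fun i => {x | x.1 ∈ D ∩ A i}) (fun x => by
      obtain ⟨α, hα, hxα⟩ := hD.2 x.1 x.2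
      obtain ⟨i, hi⟩ := Set.mem_iUnion.1 (hA hα)
      exact ⟨⟨α, hD.1 hα⟩, Set.mem_iUnion.2 ⟨i, hα, hi⟩, hxα⟩) ((mk_le_aleph0).trans_lt hβ)
  refine ⟨i, fun α hα => hD.1 hα.1, fun γ hγ => ?_⟩
  obtain ⟨α, hα, h⟩ := hi ⟨γ, hγ⟩
  exact ⟨α.1, hα, h⟩

/-! ### The labelling obtained from the ladder system when the continuum is at most ℵ₁. -/

section StarLabel

/-- The vertices: points `β` and pairs `(α, s)` of a point and a sequence of primes. -/
abbrev StarVertex : Type := BelowAlephOmegaSucc ⊕ (BelowAlephOmegaSucc × (ℕ → Nat.Primes))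

theorem mk_primes_sequences : #(ℕ → Nat.Primes) = 𝔠 := by
  simp

namespace StarVertex

/-- The point of a vertex. -/
def rank : StarVertex → BelowAlephOmegaSucc :=
  Sum.elim id Prod.fst

theorem mk_eq (hc : (𝔠 : Cardinal.{0}) ≤ ℵ₁) : #StarVertex = ℵ_ (ω + 1) := by
  have h1 : (ℵ₁ : Cardinal.{0}) ≤ ℵ_ (ω + 1) := aleph_le_aleph.2 le_add_self
  have h0 : (ℵ₀ : Cardinal.{0}) ≤ ℵ_ (ω + 1) := aleph0_le_aleph _
  rw [mk_sum, mk_prod, Cardinal.lift_id, Cardinal.lift_id, Cardinal.lift_id, mk_primes_sequences,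
    BelowAlephOmegaSucc.mk_eq, mul_eq_left h0 (hc.trans h1) continuum_ne_zero, add_eq_self h0]

/-- Every sequence of primes occurs with every α, so that (α, s) is present below β whatever coding
s comes from e β. The bound 𝔠 ≤ ℵ₁ keeps these segments below the cofinality. -/
theorem mk_setOf_rank_lt (hc : (𝔠 : Cardinal.{0}) ≤ ℵ₁) (a : BelowAlephOmegaSucc) :
    #{v : StarVertex | v.rank < a} ≤ ℵ_ ω := by
  have h0 : (ℵ₀ : Cardinal.{0}) ≤ ℵ_ ω := aleph0_le_aleph _
  have h1 : (ℵ₁ : Cardinal.{0}) ≤ ℵ_ ω := aleph_le_aleph.2 one_lt_omega0.le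
  have ha := BelowAlephOmegaSucc.mk_Iio_le a
  have hsub : {v : StarVertex | v.rank < a} ⊆
      Sum.inl '' Set.Iio a ∪ Sum.inr '' (Set.Iio a ×ˢ Set.univ) := by
    rintro (γ | ⟨α, s⟩) h
    · exact .inl ⟨γ, h, rfl⟩
    · exact .inr ⟨(α, s), ⟨h, trivial⟩, rfl⟩
  refine (mk_le_mk_of_subset hsub).trans ((mk_union_le _ _).trans (add_le_of_le h0
    (mk_image_le.trans ha) (mk_image_le.trans ?_)))
  rw [mk_setProd, mk_univ, mk_primes_sequences]
  exact mul_le_of_le h0 ha (hc.trans h1)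

end StarVertex

variable (f : BelowAlephOmegaSucc → ℕ → BelowAlephOmega) (S : Set BelowAlephOmegaSucc)
  (C : BelowAlephOmegaSucc → Set BelowAlephOmegaSucc)
  (e : BelowAlephOmegaSucc → BelowAlephOmega → Nat.Primes)

open Classical in
/-- The labelling attached to a ladder system `C` on `S` and codings `e β` of the sets
`unionRanges f (C β)` by primes: the vertex `β` carries the inverse of `e β`, and the vertex
`(α, s)` carries the label `f α k` at the prime `s k`. -/
noncomputable def starLabel :
    StarVertex → Nat.Primes → Option BelowAlephOmega
  | .inl β, p => if h : β ∈ S ∧ ∃ ν ∈ unionRanges f (C β), e β ν = p then some h.2.choose else none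
  | .inr (α, s), p =>
    if h : (∃ γ ∈ S, α ∈ C γ) ∧ ∃ k, s k = p then some (f α h.2.choose) else none

variable {f S C e}

theorem exists_of_starLabel_inl {β : BelowAlephOmegaSucc} {p : Nat.Primes} {ν : BelowAlephOmega}
    (h : starLabel f S C e (.inl β) p = some ν) :
    β ∈ S ∧ ν ∈ unionRanges f (C β) ∧ e β ν = p := by
  rw [starLabel] at h
  split_ifs at h with hc
  obtain rfl := Option.some_injective _ h
  exact ⟨hc.1, hc.2.choose_spec⟩

theorem starLabel_inl {β : BelowAlephOmegaSucc} (hβ : β ∈ S)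
    (he : Set.InjOn (e β) (unionRanges f (C β))) {ν : BelowAlephOmega}
    (hν : ν ∈ unionRanges f (C β)) : starLabel f S C e (.inl β) (e β ν) = some ν := by
  have hc : β ∈ S ∧ ∃ ν' ∈ unionRanges f (C β), e β ν' = e β ν := ⟨hβ, ν, hν, rfl⟩
  rw [starLabel, dif_pos hc]
  exact congrArg some (he hc.2.choose_spec.1 hν hc.2.choose_spec.2)

theorem exists_of_starLabel_inr {α : BelowAlephOmegaSucc} {s : ℕ → Nat.Primes} {p : Nat.Primes}
    {ν : BelowAlephOmega} (h : starLabel f S C e (.inr (α, s)) p = some ν) :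
    (∃ γ ∈ S, α ∈ C γ) ∧ ν ∈ Set.range (f α) := by
  rw [starLabel] at h
  split_ifs at h with hc
  obtain rfl := Option.some_injective _ h
  exact ⟨hc.1, _, rfl⟩

theorem range_subset_unionRanges {D : Set BelowAlephOmegaSucc} {α : BelowAlephOmegaSucc}
    (hα : α ∈ D) : Set.range (f α) ⊆ unionRanges f D :=
  Set.subset_biUnion_of_mem (u := fun α => Set.range (f α)) hα

theorem starLabel_inr {α β : BelowAlephOmegaSucc} (hβ : β ∈ S) (hα : α ∈ C β)
    (he : Set.InjOn (e β) (unionRanges f (C β))) (k : ℕ) :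
    starLabel f S C e (.inr (α, e β ∘ f α)) (e β (f α k)) = some (f α k) := by
  have hc : (∃ γ ∈ S, α ∈ C γ) ∧ ∃ j, (e β ∘ f α) j = e β (f α k) := ⟨⟨β, hβ, hα⟩, k, rfl⟩
  rw [starLabel, dif_pos hc]
  exact congrArg some (he (range_subset_unionRanges hα ⟨_, rfl⟩)
    (range_subset_unionRanges hα ⟨_, rfl⟩) hc.2.choose_spec)

variable {δ : Ordinal.{0}}

/-- F_α lies in E_β; if it had full type δ, a second ladder C_γ containing α would make E_γ ∩ E_β
have type at least δ. -/
theorem typeLT_range_lt (hδ : ∀ β ∈ S, typeLT (unionRanges f (C β)) = δ)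
    (hinter : ∀ β ∈ S, ∀ γ ∈ S, β ≠ γ →
      typeLT (unionRanges f (C β) ∩ unionRanges f (C γ) : Set BelowAlephOmega) < δ)
    {α β : BelowAlephOmegaSucc} (hβ : β ∈ S) (hα : α ∈ C β)
    (hg : typeLT (Set.range (f α)) = δ → ∃ γ ∈ S, α ∈ C γ ∧ γ ≠ β) :
    typeLT (Set.range (f α)) < δ := by
  refine lt_of_le_of_ne ((typeLT_mono (range_subset_unionRanges hα)).trans_eq (hδ β hβ))
    fun h => ?_
  obtain ⟨γ, hγ, hαγ, hne⟩ := hg h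
  exact (h.ge.trans (typeLT_mono (Set.subset_inter (range_subset_unionRanges hαγ)
    (range_subset_unionRanges hα)))).not_gt (hinter γ hγ β hβ hne)

/-- The labels on which a vertex agrees with the vertex `β` form a set of small order type. -/
theorem typeLT_agreement_starLabel_lt
    (hinter : ∀ β ∈ S, ∀ γ ∈ S, β ≠ γ →
      typeLT (unionRanges f (C β) ∩ unionRanges f (C γ) : Set BelowAlephOmega) < δ)
    (h0 : δ ≠ 0) {β : BelowAlephOmegaSucc} (hβ : β ∈ S)
    (he : Set.InjOn (e β) (unionRanges f (C β)))
    (hβC : ∀ α ∈ C β, typeLT (Set.range (f α)) < δ)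
    (w : StarVertex)
    (hw : w ≠ .inl β) :
    typeLT {ν ∈ unionRanges f (C β) | e β ν ∈ agreement (starLabel f S C e) w (.inl β)} < δ := by
  have hagr : ∀ ν ∈ {ν ∈ unionRanges f (C β) |
      e β ν ∈ agreement (starLabel f S C e) w (.inl β)},
      starLabel f S C e w (e β ν) = some ν := by
    rintro ν ⟨hν, h, -⟩
    rw [h, starLabel_inl hβ he hν]
  rcases w with γ | ⟨α, s⟩
  · have hne : γ ≠ β := fun h => hw (congrArg _ h)
    rcases Set.eq_empty_or_nonempty {ν ∈ unionRanges f (C β) |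
      e β ν ∈ agreement (starLabel f S C e) (.inl γ) (.inl β)} with hempty | ⟨ν, hν⟩
    · rw [hempty]
      simpa [pos_iff_ne_zero] using! h0
    · exact (typeLT_mono
          (B := unionRanges f (C γ) ∩ unionRanges f (C β))
          fun ν hν => ⟨(exists_of_starLabel_inl (hagr ν hν)).2.1, hν.1⟩).trans_lt
        (hinter γ (exists_of_starLabel_inl (hagr ν hν)).1 β hβ hne)
  · rcases Set.eq_empty_or_nonempty {ν ∈ unionRanges f (C β) |
      e β ν ∈ agreement (starLabel f S C e) (.inr (α, s)) (.inl β)} with hempty | ⟨ν, hν⟩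
    · rw [hempty]
      simpa [pos_iff_ne_zero] using! h0
    -- Labels on the ladder of β are bounded by F_α. Off it, α lies on some other ladder C_γ and the
    -- agreement falls into E_γ ∩ E_β.
    · by_cases hα : α ∈ C β
      · exact (typeLT_mono fun ν hν => (exists_of_starLabel_inr (hagr ν hν)).2).trans_lt
          (hβC α hα)
      · obtain ⟨⟨γ, hγ, hαγ⟩, -⟩ := exists_of_starLabel_inr (hagr ν hν)
        exact (typeLT_mono
          (B := unionRanges f (C γ) ∩ unionRanges f (C β))
          fun ν hν => ⟨range_subset_unionRanges hαγ
          (exists_of_starLabel_inr (hagr ν hν)).2, hν.1⟩).trans_lt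
          (hinter γ hγ β hβ fun h => hα (h ▸ hαγ))

/-- Countably many vertices other than `β` cannot cover the agreements of `β` with all vertices
`(α, e β ∘ f α)`. -/
theorem exists_infinite_agreement_starLabel
    (hδ : ∀ β ∈ S, ∀ D ⊆ C β, IsCofinalBelow D β → typeLT (unionRanges f D) = δ)
    (hprin : IsPrincipal (· + ·) δ) (h1 : 1 < δ) {β : BelowAlephOmegaSucc} (hβ : β ∈ S)
    (hcof : ℵ₀ < Order.cof (Set.Iio β)) (hC : IsCofinalBelow (C β) β)
    (he : Set.InjOn (e β) (unionRanges f (C β)))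
    (K : Set StarVertex) (hK : K.Countable)
    (hKδ : ∀ w ∈ K, typeLT {ν ∈ unionRanges f (C β) |
      e β ν ∈ agreement (starLabel f S C e) w (.inl β)} < δ) :
    ∃ α ∈ C β, ∀ T : Finset StarVertex,
      (T : Set _) ⊆ K →
      (agreement (starLabel f S C e) (.inr (α, e β ∘ f α)) (.inl β) \
        ⋃ w ∈ T, agreement (starLabel f S C e) w (.inl β)).Infinite := by
  by_contra! hcon
  have := (countable_setOf_finset_subset hK).to_subtype
  -- There are only countably many pairs of a finite T ⊆ K and a finite exceptional set Q, so
  -- uncountable cofinality makes one pair serve a cofinal part of C_β. The union of its F_α then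
  -- has type below δ, a contradiction.
  obtain ⟨⟨⟨T, hT⟩, Q⟩, hD⟩ := hC.exists_of_subset_iUnion
    (ι := {T : Finset _ // T ∈ {T : Finset _ | (T : Set _) ⊆ K}} × Finset Nat.Primes) hcof
    (fun i => {α | agreement (starLabel f S C e) (.inr (α, e β ∘ f α)) (.inl β) \
        ⋃ w ∈ i.1.1, agreement (starLabel f S C e) w (.inl β) ⊆ i.2}) (fun α hα => by
      obtain ⟨T, hT, hfin⟩ := hcon α hα
      exact Set.mem_iUnion.2 ⟨⟨⟨T, hT⟩, hfin.toFinset⟩, by simp⟩)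
  refine (hδ β hβ _ Set.inter_subset_left hD).not_lt ?_
  have hQ : {ν ∈ unionRanges f (C β) | e β ν ∈ Q}.Finite :=
    Set.Finite.of_finite_image (Q.finite_toSet.subset (by
      rintro _ ⟨ν, hν, rfl⟩
      exact hν.2)) (he.mono fun ν hν => hν.1)
  refine lt_of_le_of_lt (typeLT_mono ?_) (typeLT_union_lt hprin
    (typeLT_biUnion_finset_lt hprin (zero_lt_one.trans h1).ne' T _ fun w hw => hKδ w (hT hw))
    (typeLT_lt_of_finite hprin h1 hQ))
  intro ν hν
  simp only [unionRanges, Set.mem_iUnion, exists_prop] at hν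
  obtain ⟨α, ⟨hα, hαi⟩, k, rfl⟩ := hν
  have hν : f α k ∈ unionRanges f (C β) := range_subset_unionRanges hα ⟨k, rfl⟩
  by_cases hcov : e β (f α k) ∈ ⋃ w ∈ T, agreement (starLabel f S C e) w (.inl β)
  · left
    simp only [Set.mem_iUnion, exists_prop] at hcov ⊢
    obtain ⟨w, hw, h⟩ := hcov
    exact ⟨w, hw, hν, h⟩
  · right
    refine ⟨hν, hαi ⟨?_, hcov⟩⟩
    rw [agreement]
    simp [starLabel_inl hβ he hν, starLabel_inr hβ hα he k]

end StarLabel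

/-! ### Uncovered vertices from the principle, and the case distinction on the continuum. -/

theorem StarPrinciple.exists_hasUncoveredVertices (star : StarPrinciple)
    (hc : (𝔠 : Cardinal.{0}) ≤ ℵ₁) :
    ∃ lab : StarVertex → Nat.Primes → Option BelowAlephOmega, HasUncoveredVertices lab := by
  classical
  obtain ⟨f, -, S, C, δ, hS, hcof, hC, hδcard, hδ, hinter, h0, hprin⟩ := star
  have hδ' : ∀ β ∈ S, typeLT (unionRanges f (C β)) = δ := fun β hβ =>
    hδ β hβ _ subset_rfl (hC β hβ).1
  have he : ∀ β, ∃ e : BelowAlephOmega → Nat.Primes,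
      β ∈ S → Set.InjOn e (unionRanges f (C β)) := by
    intro β
    by_cases hβ : β ∈ S
    · have hcount : (unionRanges f (C β)).Countable := by
        rw [← le_aleph0_iff_set_countable, ← card_type (· < ·), hδ' β hβ]
        exact hδcard
      obtain ⟨e, he⟩ := Set.countable_iff_exists_injOn.1 hcount
      obtain ⟨i⟩ : Nonempty (ℕ ≃ Nat.Primes) := nonempty_equiv_of_countable
      exact ⟨i ∘ e, fun _ => i.injective.comp_injOn he⟩
    · exact ⟨fun _ => ⟨2, Nat.prime_two⟩, fun h => absurd h hβ⟩
  choose e he using he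
  -- The function g picks one ladder through α. When β is closed under g, a point α of C_β has g α <
  -- β and so lies on a second ladder; this forces F_α to have type below δ.
  have hg : ∀ α, ∃ γ, (∃ γ ∈ S, α ∈ C γ) → γ ∈ S ∧ α ∈ C γ := by
    intro α
    by_cases h : ∃ γ ∈ S, α ∈ C γ
    · obtain ⟨γ, h⟩ := h
      exact ⟨γ, fun _ => h⟩
    · exact ⟨α, fun h' => absurd h' h⟩
  choose g hg using hg
  refine ⟨starLabel f S C e, fun Ψ hΨ => ?_⟩
  have hω : ℵ_ ω < Order.cof BelowAlephOmegaSucc := by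
    rw [BelowAlephOmegaSucc.cof_eq, aleph_lt_aleph]
    exact lt_add_one _
  have hclub := isClub_setOf_closed StarVertex.rank ((aleph0_le_aleph ω).trans_lt hω)
    (fun a => (StarVertex.mk_setOf_rank_lt hc a).trans_lt hω)
    (fun s => Ψ s ∪ (s.image fun v => Sum.inl (g v.rank) : Finset StarVertex))
    (fun s => (hΨ s).union (Finset.countable_toSet _))
  obtain ⟨β, hβ, hclosed⟩ := hS hclub
  have hgβ : ∀ α < β, g α < β := fun α hα =>
    hclosed {.inl α} (by simpa [StarVertex.rank] using hα) (.inl (g α))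
      (.inr (by simp [StarVertex.rank]))
  have hlt : ∀ α ∈ C β, typeLT (Set.range (f α)) < δ := fun α hα =>
    typeLT_range_lt hδ' hinter hβ hα fun _ =>
      ⟨g α, (hg α ⟨β, hβ, hα⟩).1, (hg α ⟨β, hβ, hα⟩).2, (hgβ α ((hC β hβ).1.1 hα)).ne⟩
  have hcofβ : ℵ₀ < Order.cof (Set.Iio β) := by
    rw [hcof β hβ]
    exact aleph0_lt_aleph_one
  -- Since C_β is nonempty, some nonempty F_α has type below δ, so δ exceeds 1 and finite sets have
  -- type below δ.
  have h1 : 1 < δ := by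
    have hne : typeLT (C β) ≠ 0 := by
      rw [(hC β hβ).2]
      exact (omega_pos 1).ne'
    obtain ⟨α, hα⟩ := type_ne_zero_iff_nonempty.1 hne
    refine lt_of_le_of_lt ?_ (hlt α hα)
    rw [Order.one_le_iff_pos, pos_iff_ne_zero, type_ne_zero_iff_nonempty]
    exact (Set.range_nonempty _).to_subtype
  refine ⟨{v | v.rank < β}, fun s hs v hv => hclosed s hs v (.inl hv), .inl β,
    fun h : β < β => h.false, fun K hKX hK => ?_⟩
  obtain ⟨α, hα, h⟩ := exists_infinite_agreement_starLabel hδ hprin h1 hβ hcofβ (hC β hβ).1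
    (he β hβ) K hK fun w hw => typeLT_agreement_starLabel_lt hinter h0 hβ (he β hβ) hlt w (by
      rintro rfl
      exact (show β < β from hKX hw).false)
  exact ⟨.inr (α, e β ∘ f α), (hC β hβ).1.1 hα, h⟩

theorem mainTheorem4 (star : StarPrinciple) :
    ∃ (G C : Type) (_ : AddCommGroup G) (_ : AddCommGroup C) (π : C →+ G),
      IsAddTorsionFree G ∧ #G = ℵ_ (ω + 1) ∧ ¬ AdmitsAleph0PrebalancedChain G ∧
      IsBalancedProjectiveResolution π ∧ #C = ℵ_ (ω + 1) ∧
      #π.ker = ℵ_ (ω + 1) ∧ ¬ IsB₂Group π.ker := by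
  rcases le_or_gt (ℵ_ 2) (𝔠 : Cardinal.{0}) with h2 | h1
  · obtain ⟨lab, hlab⟩ := exists_hasUncoveredVertices_of_aleph_two_le
      (V := BelowAlephOmegaSucc) h2 (by
        rw [BelowAlephOmegaSucc.mk_eq]
        exact aleph_le_aleph.2 ((natCast_lt_omega0 2).le.trans le_self_add))
    have : Infinite BelowAlephOmegaSucc := by
      rw [infinite_iff, BelowAlephOmegaSucc.mk_eq]
      exact aleph0_le_aleph _
    have := exists_group_of_hasUncoveredVertices lab hlab
    rwa [BelowAlephOmegaSucc.mk_eq] at this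
  · have hc : (𝔠 : Cardinal.{0}) ≤ ℵ₁ := by
      rwa [← one_add_one_eq_two, ← succ_aleph, Order.lt_succ_iff] at h1
    obtain ⟨lab, hlab⟩ := star.exists_hasUncoveredVertices hc
    have hV := StarVertex.mk_eq hc
    have : Infinite StarVertex := by
      rw [infinite_iff, hV]
      exact aleph0_le_aleph _
    have := exists_group_of_hasUncoveredVertices lab hlab
    rwa [hV] at this
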